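/- **Setting.** Let $0<R_f'<R_f''$ and let $v_f\in C^2([0,R_f''];\mathbb R_+)$ satisfy $v_f(R_f'')>0$ and, on $[0,R_f'']$, $v_f'\le 0$, $v_f+\rho v_f'>0$, $2v_f'+\rho v_f''\le 0$. Let $p\in C^2([R_f',\infty))$ satisfy $p'>0$ and $2p'+\rho p''>0$. Assume that $v_f+p$ is increasing on $[R_f',R_f'']$ and $v_f(\rho)<\rho p'(\rho)$ there. Put $V_{\max}=v_f(0)$, $V_f=v_f(R_f'')$, $W_{\max}=p(R_f'')+V_f$, $W_c=p(R_f')+v_f(R_f')$; assume that $W_{\max}$ is in the range of $p$ and put $R_{\max}=p^{-1}(W_{\max})$. Fix $V_c\in(0,V_f)$. States are $u=(\rho,v)$ and $$\Omega_f=\{\rho\in[0,R_f''],\ v=v_f(\rho)\},\qquad \Omega_c=\{\rho\in[R_f',R_{\max}],\ v\in[0,V_c],\ W_c\le v+p(\rho)\le W_{\max}\},\qquad \Omega=\Omega_f\cup\Omega_c,$$ with $\Omega_f'=\Omega_f\cap\{\rho<R_f'\}$ and $\Omega_f''=\Omega_f\setminus\Omega_f'$. Put $w_1(u)=v$ on $\Omega_c$,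 $w_1(u)=V_f$ on $\Omega_f$; $w_2(u)=v+p(\rho)$ on $\Omega_c\cup\Omega_f''$, $w_2(u)=W_c+v_f(R_f')-v_f(\rho)$ on $\Omega_f'$. For $w\in[W_c,W_{\max}]$ let $\rho_f(w)\in[R_f',R_f'']$ be the solution of $v_f(\rho)+p(\rho)=w$, and put $\sigma(u,u')=(\rho'v'-\rho v)/(\rho'-\rho)$. **Model.** In $\Omega_f$ (LWR): $\rho_t+[\rho v_f(\rho)]_x=0$. In $\Omega_c$ (ARZ): $\rho_t+[\rho v]_x=0$, $[\rho w_2]_t+[\rho w_2 v]_x=0$. **Riemann solver.** Let $\mathcal R_{LWR}$, $\mathcal R_{ARZ}$ be the Lax Riemann solvers on $\Omega_f\times\Omega_f$ and $\Omega_c\times\Omega_c$. That is, $\mathcal R_{LWR}[u_\ell,u_r]$ is a shock of speed $\sigma(u_\ell,u_r)$ if $\rho_\ell<\rho_r$, and otherwise a centred rarefaction for the speed $v_f+\rho v_f'$ (with contact discontinuities across intervals where that speed is constant); $\mathcal R_{ARZ}[u_\ell,u_r]$ is a 1-wave along $w_2=w_2(u_\ell)$ from $u_\ell$ to $u_m=(p^{-1}(w_2(u_\ell)-v_r),v_r)$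 (a shock of speed $\sigma(u_\ell,u_m)$ if $v_r<v_\ell$, a centred rarefaction for the speed $v-\rho p'(\rho)$ otherwise), followed by a contact discontinuity of speed $v_r$ from $u_m$ to $u_r$. Then $\mathcal R$ equals $\mathcal R_{LWR}$ on $\Omega_f\times\Omega_f$ and $\mathcal R_{ARZ}$ on $\Omega_c\times\Omega_c$, and: * if $u_\ell\in\Omega_f$, $u_r\in\Omega_c$, then $\mathcal R[u_\ell,u_r](x)=u_\ell$ for $x<\sigma(u_\ell,u_m)$ and $=\mathcal R_{ARZ}[u_m,u_r](x)$ for $x>\sigma(u_\ell,u_m)$, where $u_m=(p^{-1}(\max\{W_c,w_2(u_\ell)\}-v_r),v_r)$; * if $u_\ell\in\Omega_c$, $u_r\in\Omega_f$, then $\mathcal R[u_\ell,u_r](x)=\mathcal R_{ARZ}[u_\ell,u_m'](x)$ for $x<\sigma(u_m',u_m'')$ and $=\mathcal R_{LWR}[u_m'',u_r](x)$ for $x>\sigma(u_m',u_m'')$, where $u_m'=(p^{-1}(w_2(u_\ell)-V_c),V_c)$, $\rho_m''=\rho_f(w_2(u_\ell))$, $v_m''=v_f(\rho_m'')$. Each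 profile $\mathcal R[u_\ell,u_r]$ is taken right-continuous. **Solutions.** A *phase transition* of a profile is a jump between its left limit $u_-$ and right limit $u_+$ when these lie one in $\Omega_f$, the other in $\Omega_c$. Let $$\mathcal G_1=\{(u_-,u_+)\in\Omega_f'\times\Omega_c:[w_2(u_+)-W_c]\rho_-=0\},\quad \mathcal G_2=\{(u_-,u_+)\in\Omega_f''\times\Omega_c: w_2(u_-)=w_2(u_+)\},$$ $$\mathcal G_3=\{(u_-,u_+)\in\Omega_c\times\Omega_f'': w_2(u_-)=w_2(u_+),\ v_-=V_c\},\quad \mathcal G_w=\mathcal G_1\cup\mathcal G_2\cup\mathcal G_1^T\cup\mathcal G_2^T,\quad \mathcal G_e=\mathcal G_1\cup\mathcal G_2\cup\mathcal G_3.$$ Let $\bar u\in BV(\mathbb R;\Omega)$ (finite total variation; integrability on $\mathbb R$ is not required). A function $u\in L^\infty(]0,\infty[;BV(\mathbb R;\Omega))\cap C^0([0,\infty[;L^1_{loc}(\mathbb R;\Omega))$ with $u(0,\cdot)=\bar u$ a.e. is a *weak solution* if * (W.1) $\iint\rho[\varphi_t+v_f(\rho)\varphi_x]\,dx\,dt=0$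 for all $\varphi\in C_c^\infty(]0,\infty[\times\mathbb R)$ with $u\in\Omega_f$ a.e. on $\operatorname{supp}\varphi$; * (W.2) $\iint\rho[\varphi_t+v\varphi_x]\,dx\,dt=0=\iint\rho\,w_2(u)[\varphi_t+v\varphi_x]\,dx\,dt$ for all such $\varphi$ with $u\in\Omega_c$ a.e. on $\operatorname{supp}\varphi$; * (W.3) all phase transitions of $u(t,\cdot)$, $t>0$, lie on finitely many Lipschitz curves $x=x_i(t)$, and at a phase transition from $u_-$ to $u_+$ across $x=x_i(t)$ one has $\dot x_i(t)=\sigma(u_-,u_+)$ and $(u_-,u_+)\in\mathcal G_w$. It is an *entropy solution* if in addition * (E.1) $\iint\big[|\rho-h|\varphi_t+\operatorname{sign}(\rho-h)(\rho v_f(\rho)-hv_f(h))\varphi_x\big]dx\,dt\ge0$ for all $h\in[0,R_f'']$ and all $\varphi\ge0$ as in (W.1); * (E.2) $\iint[\mathcal E^k(u)\varphi_t+\mathcal Q^k(u)\varphi_x]\,dx\,dt\ge0$ for all $k\in[0,V_c]$ and all $\varphi\ge0$ as in (W.2), where $\mathcal E^k=\mathcal Q^k=0$ if $v\le k$, and $\mathcal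 E^k=1-\rho/p^{-1}(w_2(u)-k)$, $\mathcal Q^k=k-\rho v/p^{-1}(w_2(u)-k)$ if $v>k$; * (E.3) every phase transition from $u_-$ to $u_+$ performed by $u(t,\cdot)$, $t>0$, satisfies $(u_-,u_+)\in\mathcal G_e$. **Proposition.** $\mathcal R[u_\ell,u_r]$ is a measurable function with values in $\Omega$ for all $u_\ell,u_r\in\Omega$, and: 1. $\mathcal R$ is consistent: for all $u_\ell,u_m,u_r\in\Omega$ and $\bar x\in\mathbb R$, (I) if $\mathcal R[u_\ell,u_r](\bar x)=u_m$, then $\mathcal R[u_\ell,u_m](x)$ equals $\mathcal R[u_\ell,u_r](x)$ for $x\le\bar x$ and $u_m$ for $x>\bar x$, while $\mathcal R[u_m,u_r](x)$ equals $u_m$ for $x<\bar x$ and $\mathcal R[u_\ell,u_r](x)$ for $x\ge\bar x$; (II) if $\mathcal R[u_\ell,u_m](\bar x)=u_m=\mathcal R[u_m,u_r](\bar x)$, then $\mathcal R[u_\ell,u_r](x)$ equals $\mathcal R[u_\ell,u_m](x)$ for $x<\bar x$ and $\mathcal R[u_m,u_r](x)$ for $x\ge\bar x$. 2. $\mathcal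 R:\Omega\times\Omega\to L^1_{loc}(\mathbb R;\Omega)$ is continuous for the usual distance of the coordinates $(\rho,v)$; it is also continuous for the distance $|w_1(u)-w_1(u')|+|w_2(u)-w_2(u')|$ whenever $(w_1,w_2)$ is injective on $\Omega$ (so that this is a distance). 3. For all $u_\ell,u_r\in\Omega$, the function $(t,x)\mapsto\mathcal R[u_\ell,u_r](x/t)$ for $t>0$, with value at $t=0$ the datum $u_\ell$ for $x<0$ and $u_r$ for $x>0$, is an entropy solution with that initial datum. -/

import Mathlib

open MeasureTheory Filter Topology

/-- The data of the two phase traffic model: the free-flow velocity `vf` on `[0, Rf₂]`, the pressure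
`p` on `[Rf₁, ∞)`, the thresholds `Rf₁ = R_f'` and `Rf₂ = R_f''`, the maximal congested velocity `Vc`
and the maximal density `Rmax = p⁻¹(p(Rf₂) + vf(Rf₂))`. -/
structure TwoPhase where
  vf : ℝ → ℝ
  p : ℝ → ℝ
  Rf₁ : ℝ
  Rf₂ : ℝ
  Vc : ℝ
  Rmax : ℝ
  Rf₁_pos : 0 < Rf₁
  Rf₁_lt : Rf₁ < Rf₂
  -- assumptions on the free-flow velocity
  vf_contDiff : ContDiffOn ℝ 2 vf (Set.Icc 0 Rf₂)
  vf_end_pos : 0 < vf Rf₂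
  vf_deriv_nonpos : ∀ ρ ∈ Set.Icc 0 Rf₂, derivWithin vf (Set.Icc 0 Rf₂) ρ ≤ 0
  vf_speed_pos : ∀ ρ ∈ Set.Icc 0 Rf₂, 0 < vf ρ + ρ * derivWithin vf (Set.Icc 0 Rf₂) ρ
  vf_concave : ∀ ρ ∈ Set.Icc 0 Rf₂,
    2 * derivWithin vf (Set.Icc 0 Rf₂) ρ + ρ * iteratedDerivWithin 2 vf (Set.Icc 0 Rf₂) ρ ≤ 0
  -- assumptions on the pressure
  p_contDiff : ContDiffOn ℝ 2 p (Set.Ici Rf₁)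
  p_deriv_pos : ∀ ρ ∈ Set.Ici Rf₁, 0 < derivWithin p (Set.Ici Rf₁) ρ
  p_convex : ∀ ρ ∈ Set.Ici Rf₁,
    0 < 2 * derivWithin p (Set.Ici Rf₁) ρ + ρ * iteratedDerivWithin 2 p (Set.Ici Rf₁) ρ
  -- compatibility (capacity drop)
  compat_mono : StrictMonoOn (fun ρ => vf ρ + p ρ) (Set.Icc Rf₁ Rf₂)
  compat_drop : ∀ ρ ∈ Set.Icc Rf₁ Rf₂, vf ρ < ρ * derivWithin p (Set.Ici Rf₁) ρ
  -- the remaining parameters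
  Rmax_ge : Rf₁ ≤ Rmax
  p_Rmax : p Rmax = p Rf₂ + vf Rf₂
  Vc_pos : 0 < Vc
  Vc_lt : Vc < vf Rf₂

namespace TwoPhase

noncomputable section

open Classical

variable (M : TwoPhase)

def Vmax : ℝ := M.vf 0

def Vf : ℝ := M.vf M.Rf₂

def Wmax : ℝ := M.p M.Rf₂ + M.Vf

def Wc : ℝ := M.p M.Rf₁ + M.vf M.Rf₁

/-- The inverse `p⁻¹` of the (increasing) pressure, with values in `[Rf₁, Rmax]`. -/
def pInv (y : ℝ) : ℝ := Function.invFunOn M.p (Set.Icc M.Rf₁ M.Rmax) y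

/-- `ρ_f(w)`: the density in `[Rf₁, Rf₂]` with `ρ vf(ρ) = ρ (w - p(ρ))`, i.e. `vf(ρ) + p(ρ) = w`. -/
def rhoF (w : ℝ) : ℝ :=
  Function.invFunOn (fun ρ => M.vf ρ + M.p ρ) (Set.Icc M.Rf₁ M.Rf₂) w

/-! ### Phases. A state is `u = (ρ, v)`. -/

/-- Free phases. -/
def OmegaF : Set (ℝ × ℝ) :=
  {u | u.1 ∈ Set.Icc 0 M.Rf₂ ∧ u.2 ∈ Set.Icc M.Vf M.Vmax ∧ u.2 = M.vf u.1}

/-- Congested phases; the pressure is only defined on `[Rf₁, ∞)`. -/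
def OmegaC : Set (ℝ × ℝ) :=
  {u | u.1 ∈ Set.Icc M.Rf₁ M.Rmax ∧ u.2 ∈ Set.Icc 0 M.Vc ∧
    u.2 + M.p u.1 ∈ Set.Icc M.Wc M.Wmax}

/-- `Ω_f'`. -/
def OmegaF₁ : Set (ℝ × ℝ) := {u | u ∈ M.OmegaF ∧ u.1 < M.Rf₁}

/-- `Ω_f''`. -/
def OmegaF₂ : Set (ℝ × ℝ) := {u | u ∈ M.OmegaF ∧ M.Rf₁ ≤ u.1}

def Omega : Set (ℝ × ℝ) := M.OmegaF ∪ M.OmegaC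

/-- First extended Riemann invariant. -/
def w₁ (u : ℝ × ℝ) : ℝ := if u ∈ M.OmegaC then u.2 else M.Vf

/-- Second extended Riemann invariant. -/
def w₂ (u : ℝ × ℝ) : ℝ :=
  if u ∈ M.OmegaF₁ then M.Wc + M.vf M.Rf₁ - M.vf u.1 else u.2 + M.p u.1

/-- The distance in the extended Riemann invariant coordinates. -/
def wDist (u u' : ℝ × ℝ) : ℝ := |M.w₁ u - M.w₁ u'| + |M.w₂ u - M.w₂ u'|

/-- Rankine-Hugoniot speed of a jump from `u` to `u'`. -/
def sigma (u u' : ℝ × ℝ) : ℝ := (u'.1 * u'.2 - u.1 * u.2) / (u'.1 - u.1)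

/-! ### Riemann solvers. All profiles `ξ ↦ 𝓡[uℓ, ur](ξ)` are the right-continuous representatives. -/

/-- Centred rarefaction profile from density `ρℓ` down to density `ρr ≤ ρℓ` for a non-increasing
characteristic speed `lam`: the right-continuous generalized inverse of `lam` on `[ρr, ρℓ]`, equal to
`ρℓ` for `ξ < lam ρℓ` and to `ρr` for `ξ ≥ lam ρr`. It jumps exactly across the intervals where `lam`
is constant (contact discontinuities). -/
def fan (lam : ℝ → ℝ) (ρℓ ρr ξ : ℝ) : ℝ :=
  sInf (insert ρℓ {ρ | ρ ∈ Set.Icc ρr ρℓ ∧ lam ρ ≤ ξ})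

/-- Characteristic speed of LWR. -/
def lamF (ρ : ℝ) : ℝ := M.vf ρ + ρ * derivWithin M.vf (Set.Icc 0 M.Rf₂) ρ

/-- First characteristic speed of ARZ along the curve `v + p(ρ) = w`. -/
def lam₁ (w ρ : ℝ) : ℝ := w - M.p ρ - ρ * derivWithin M.p (Set.Ici M.Rf₁) ρ

/-- Lax Riemann solver for LWR (concave flux `ρ vf(ρ)`): a shock if the density increases,
a rarefaction if it decreases. -/
def RLWR (uℓ ur : ℝ × ℝ) (ξ : ℝ) : ℝ × ℝ :=
  if uℓ.1 < ur.1 then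
    (if ξ < sigma uℓ ur then uℓ else ur)
  else
    (fan M.lamF uℓ.1 ur.1 ξ, M.vf (fan M.lamF uℓ.1 ur.1 ξ))

/-- Intermediate state of the Lax solution for ARZ: the second invariant of `uℓ`, the velocity of
`ur`. -/
def midARZ (uℓ ur : ℝ × ℝ) : ℝ × ℝ := (M.pInv (M.w₂ uℓ - ur.2), ur.2)

/-- Lax 1-wave for ARZ from `uℓ` to `um`, two states with the same second invariant:
a shock if the velocity decreases, a rarefaction if it increases. -/
def wave₁ (uℓ um : ℝ × ℝ) (ξ : ℝ) : ℝ × ℝ :=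
  if um.2 < uℓ.2 then
    (if ξ < sigma uℓ um then uℓ else um)
  else
    (fan (M.lam₁ (M.w₂ uℓ)) uℓ.1 um.1 ξ,
      M.w₂ uℓ - M.p (fan (M.lam₁ (M.w₂ uℓ)) uℓ.1 um.1 ξ))

/-- Lax Riemann solver for ARZ: a 1-wave to the intermediate state, followed by a contact
discontinuity of speed `v_r`. -/
def RARZ (uℓ ur : ℝ × ℝ) (ξ : ℝ) : ℝ × ℝ :=
  if ξ < ur.2 then M.wave₁ uℓ (M.midARZ uℓ ur) ξ else ur

/-- The state `u_m` behind a phase transition from the free phase `uℓ` to the congested phase. -/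
def midFC (uℓ ur : ℝ × ℝ) : ℝ × ℝ := (M.pInv (max M.Wc (M.w₂ uℓ) - ur.2), ur.2)

/-- The congested state `u_m'` of the phase transition from the congested to the free phase. -/
def midCF₁ (uℓ : ℝ × ℝ) : ℝ × ℝ := (M.pInv (M.w₂ uℓ - M.Vc), M.Vc)

/-- The free state `u_m''` of the phase transition from the congested to the free phase. -/
def midCF₂ (uℓ : ℝ × ℝ) : ℝ × ℝ := (M.rhoF (M.w₂ uℓ), M.vf (M.rhoF (M.w₂ uℓ)))

/-- The two phase Riemann solver `𝓡[uℓ, ur]`, for `uℓ, ur ∈ Ω`. -/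
def R (uℓ ur : ℝ × ℝ) (ξ : ℝ) : ℝ × ℝ :=
  if uℓ ∈ M.OmegaF then
    if ur ∈ M.OmegaF then M.RLWR uℓ ur ξ
    else if ξ < sigma uℓ (M.midFC uℓ ur) then uℓ else M.RARZ (M.midFC uℓ ur) ur ξ
  else
    if ur ∈ M.OmegaF then
      if ξ < sigma (M.midCF₁ uℓ) (M.midCF₂ uℓ) then M.RARZ uℓ (M.midCF₁ uℓ) ξ
      else M.RLWR (M.midCF₂ uℓ) ur ξ
    else M.RARZ uℓ ur ξ

/-- Heaviside datum. -/
def riemannDatum (uℓ ur : ℝ × ℝ) (x : ℝ) : ℝ × ℝ := if x < 0 then uℓ else ur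

/-- `(t, x) ↦ 𝓡[uℓ, ur](x / t)` for `t > 0`, with the Heaviside datum as value at `t = 0`. -/
def riemannSolution (uℓ ur : ℝ × ℝ) (t x : ℝ) : ℝ × ℝ :=
  if 0 < t then M.R uℓ ur (x / t) else riemannDatum uℓ ur x

/-- Property (I): splitting. -/
def ConsistentI : Prop :=
  ∀ uℓ ∈ M.Omega, ∀ um ∈ M.Omega, ∀ ur ∈ M.Omega, ∀ x₀ : ℝ,
    M.R uℓ ur x₀ = um →
      (∀ x, M.R uℓ um x = if x ≤ x₀ then M.R uℓ ur x else um) ∧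
      (∀ x, M.R um ur x = if x < x₀ then um else M.R uℓ ur x)

/-- Property (II): merging. -/
def ConsistentII : Prop :=
  ∀ uℓ ∈ M.Omega, ∀ um ∈ M.Omega, ∀ ur ∈ M.Omega, ∀ x₀ : ℝ,
    M.R uℓ um x₀ = um → M.R um ur x₀ = um →
      ∀ x, M.R uℓ ur x = if x < x₀ then M.R uℓ um x else M.R um ur x

/-! ### Weak and entropy solutions -/

/-- Test functions `φ ∈ C_c^∞(]0, ∞[ × ℝ)`, in the variables `(t, x)`. -/
def IsTest (φ : ℝ × ℝ → ℝ) : Prop :=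
  ContDiff ℝ (↑(⊤ : ℕ∞)) φ ∧ HasCompactSupport φ ∧ tsupport φ ⊆ Set.Ioi 0 ×ˢ Set.univ

def dt (φ : ℝ × ℝ → ℝ) (z : ℝ × ℝ) : ℝ := fderiv ℝ φ z (1, 0)

def dx (φ : ℝ × ℝ → ℝ) (z : ℝ × ℝ) : ℝ := fderiv ℝ φ z (0, 1)

/-- The half plane `t > 0`. -/
def halfPlane : Set (ℝ × ℝ) := Set.Ioi 0 ×ˢ Set.univ

/-- The function `u` takes values in `S` almost everywhere on the support of `φ`. -/
def AEOnSupport (u : ℝ → ℝ → ℝ × ℝ) (φ : ℝ × ℝ → ℝ) (S : Set (ℝ × ℝ)) : Prop :=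
  ∀ᵐ z : ℝ × ℝ, z ∈ tsupport φ → u z.1 z.2 ∈ S

/-- Essential total variation: the least pointwise variation among a.e. representatives. -/
def essVariation (f : ℝ → ℝ × ℝ) : ENNReal :=
  ⨅ (g : ℝ → ℝ × ℝ) (_ : g =ᵐ[volume] f), eVariationOn g Set.univ

/-- Total variation of a profile at most `C`, both in the coordinates `(ρ, v)` and in the extended
Riemann invariant coordinates. -/
def TVLe (f : ℝ → ℝ × ℝ) (C : NNReal) : Prop :=
  essVariation f ≤ C ∧ essVariation (fun x => (M.w₁ (f x), M.w₂ (f x))) ≤ C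

/-- `f ∈ BV(ℝ; Ω)`. -/
def IsBV (f : ℝ → ℝ × ℝ) : Prop :=
  AEStronglyMeasurable f volume ∧ (∀ᵐ x, f x ∈ M.Omega) ∧ ∃ C, M.TVLe f C

/-- `u ∈ L^∞(]0, ∞[; BV(ℝ; Ω)) ∩ C⁰([0, ∞[; L¹_loc(ℝ; Ω))`. -/
def InSolutionSpace (u : ℝ → ℝ → ℝ × ℝ) : Prop :=
  AEStronglyMeasurable (fun z : ℝ × ℝ => u z.1 z.2) (volume.restrict halfPlane) ∧
  (∀ t, 0 ≤ t → AEStronglyMeasurable (u t) volume ∧ ∀ᵐ x, u t x ∈ M.Omega) ∧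
  (∃ C, ∀ᵐ t ∂(volume.restrict (Set.Ioi (0 : ℝ))), M.TVLe (u t) C) ∧
  (∀ t₀, 0 ≤ t₀ → ∀ a b : ℝ,
    Tendsto (fun t => ∫⁻ x in Set.Icc a b, edist (u t x) (u t₀ x)) (𝓝[Set.Ici 0] t₀) (𝓝 0))

/-- The profile `f` performs at `x` a phase transition from `um` to `up`: these are its (essential)
left and right limits at `x`, and they lie in different phases. -/
def PhaseTransition (f : ℝ → ℝ × ℝ) (x : ℝ) (um up : ℝ × ℝ) : Prop :=
  Tendsto f (𝓝[<] x ⊓ ae volume) (𝓝 um) ∧ Tendsto f (𝓝[>] x ⊓ ae volume) (𝓝 up) ∧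
  ((um ∈ M.OmegaF ∧ up ∈ M.OmegaC) ∨ (um ∈ M.OmegaC ∧ up ∈ M.OmegaF))

def G₁ : Set ((ℝ × ℝ) × (ℝ × ℝ)) :=
  {q | q.1 ∈ M.OmegaF₁ ∧ q.2 ∈ M.OmegaC ∧ (M.w₂ q.2 - M.Wc) * q.1.1 = 0}

def G₂ : Set ((ℝ × ℝ) × (ℝ × ℝ)) :=
  {q | q.1 ∈ M.OmegaF₂ ∧ q.2 ∈ M.OmegaC ∧ M.w₂ q.1 = M.w₂ q.2}

def G₃ : Set ((ℝ × ℝ) × (ℝ × ℝ)) :=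
  {q | q.1 ∈ M.OmegaC ∧ q.2 ∈ M.OmegaF₂ ∧ M.w₂ q.1 = M.w₂ q.2 ∧ q.1.2 = M.Vc}

/-- Admissible phase transitions of weak solutions. -/
def Gw : Set ((ℝ × ℝ) × (ℝ × ℝ)) :=
  M.G₁ ∪ M.G₂ ∪ {q | q.swap ∈ M.G₁} ∪ {q | q.swap ∈ M.G₂}

/-- Admissible phase transitions of entropy solutions. -/
def Ge : Set ((ℝ × ℝ) × (ℝ × ℝ)) := M.G₁ ∪ M.G₂ ∪ M.G₃

/-- Weak form of LWR against the test function `φ`. -/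
def WeakLWR (u : ℝ → ℝ → ℝ × ℝ) (φ : ℝ × ℝ → ℝ) : Prop :=
  ∫ z in halfPlane, (u z.1 z.2).1 * (dt φ z + M.vf (u z.1 z.2).1 * dx φ z) = 0

/-- Weak form of ARZ against the test function `φ`. -/
def WeakARZ (u : ℝ → ℝ → ℝ × ℝ) (φ : ℝ × ℝ → ℝ) : Prop :=
  (∫ z in halfPlane, (u z.1 z.2).1 * (dt φ z + (u z.1 z.2).2 * dx φ z) = 0) ∧
  (∫ z in halfPlane,
    (u z.1 z.2).1 * M.w₂ (u z.1 z.2) * (dt φ z + (u z.1 z.2).2 * dx φ z) = 0)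

def ELWR (h : ℝ) (u : ℝ × ℝ) : ℝ := |u.1 - h|

def QLWR (h : ℝ) (u : ℝ × ℝ) : ℝ := Real.sign (u.1 - h) * (u.1 * M.vf u.1 - h * M.vf h)

def EARZ (k : ℝ) (u : ℝ × ℝ) : ℝ :=
  if u.2 ≤ k then 0 else 1 - u.1 / M.pInv (M.w₂ u - k)

def QARZ (k : ℝ) (u : ℝ × ℝ) : ℝ :=
  if u.2 ≤ k then 0 else k - u.1 * u.2 / M.pInv (M.w₂ u - k)

/-- Weak solutions of the two phase model with initial datum `ubar`. -/
structure IsWeakSolution (ubar : ℝ → ℝ × ℝ) (u : ℝ → ℝ → ℝ × ℝ) : Prop where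
  datum_bv : M.IsBV ubar
  space : M.InSolutionSpace u
  initial : ∀ᵐ x, u 0 x = ubar x
  free : ∀ φ, IsTest φ → AEOnSupport u φ M.OmegaF → M.WeakLWR u φ
  congested : ∀ φ, IsTest φ → AEOnSupport u φ M.OmegaC → M.WeakARZ u φ
  /-- All phase transitions occur along finitely many Lipschitz curves, with the Rankine-Hugoniot
  speed and with states in `Gw`. -/
  transitions : ∃ (n : ℕ) (γ : Fin n → ℝ → ℝ),
    (∀ i, ∃ K, LipschitzOnWith K (γ i) (Set.Ici 0)) ∧
    (∀ t, 0 < t → ∀ x um up, M.PhaseTransition (u t) x um up → ∃ i, x = γ i t) ∧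
    (∀ i t, 0 < t → ∀ um up, M.PhaseTransition (u t) (γ i t) um up →
      HasDerivAt (γ i) (sigma um up) t ∧ (um, up) ∈ M.Gw)

/-- Entropy solutions of the two phase model with initial datum `ubar`. -/
structure IsEntropySolution (ubar : ℝ → ℝ × ℝ) (u : ℝ → ℝ → ℝ × ℝ) : Prop where
  weak : M.IsWeakSolution ubar u
  free : ∀ φ, IsTest φ → (∀ z, 0 ≤ φ z) → AEOnSupport u φ M.OmegaF →
    ∀ h ∈ Set.Icc 0 M.Rf₂,
      0 ≤ ∫ z in halfPlane, (ELWR h (u z.1 z.2) * dt φ z + M.QLWR h (u z.1 z.2) * dx φ z)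
  congested : ∀ φ, IsTest φ → (∀ z, 0 ≤ φ z) → AEOnSupport u φ M.OmegaC →
    ∀ k ∈ Set.Icc 0 M.Vc,
      0 ≤ ∫ z in halfPlane, (M.EARZ k (u z.1 z.2) * dt φ z + M.QARZ k (u z.1 z.2) * dx φ z)
  transitions : ∀ t, 0 < t → ∀ x um up, M.PhaseTransition (u t) x um up → (um, up) ∈ M.Ge

end

end TwoPhase

/-! Both phases reduce to one scalar problem. In the free phase a state is determined by its
density, and the flux `ρ vf(ρ)` is concave. In the congested phase, along a curve `v + p(ρ) = w`,
the flux is `ρ (w - p(ρ))`, strictly concave. For a concave flux on `[A, B]` the Lax solution from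
`a` to `b` is either one jump, with the slope of the chord as speed, or the clamp to `[b, a]` of a
generalized inverse of the characteristic speed taken on all of `[A, B]`, the same for all data
(`fan_eq_clamp`). Splitting (`lax_split`) is then algebra of clamps, merging (`lax_merge`) a
comparison of chord and tangent slopes, and continuity in the data (`tendsto_lax`) the continuity of
the clamp away from the shock speed.

The phases are linked by the density `rhoF w`, where the free curve meets `v + p = w`. A transition
from the congested to the free phase is a chord of `fluxC w` issued from `rhoF w`. The capacity drop
makes the tangent there, hence every such chord, decreasing: these transitions have negative speed,
while free waves have positive speed. A transition from a free state `u` to a congested state `c` is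
at least as fast as the chord from `rhoF` to `c`, and slower than `lamF u.1`
(`OmegaF.sigma_bounds`). Together with strict concavity, these inequalities exclude the encounters
of waves that would break merging; what remains is inherited from LWR and ARZ (`R_split`,
`R_merge`).

Since `Vc` is below `Vf`, the phases are disjoint compact sets, so nearby data fall in the same case
of the solver. The profiles then converge at almost every point (`ae_tendsto_R`) and stay bounded,
and dominated convergence gives continuity into `L¹_loc`. If the invariants are injective on the
compact set `Omega`, they are a homeomorphism onto their image, so both distances define the same
topology.

For a self-similar pair, `E(x/t)ₜ + Q(x/t)ₓ ≤ 0` means `dQ ≤ ξ dE`. `Dissipative` expresses this by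
increments, with an error that vanishes in the limit of small steps; this form is stable under sums
and under gluing at a dissipative jump, and `Dissipative.integral_nonneg` returns to the integral
inequality. Mass and momentum satisfy it with both signs. The entropies of LWR and ARZ reduce to
`-min ρ h`, up to scaling, conserved pairs and constants (`dissipative_neg_min_lax`). A test
function supported where the solution lies in one phase does not see the other, so the two phase
profile may be replaced by a profile of LWR or ARZ alone. Phase transitions lie on a single ray, on
which both traces are computed. -/

section

/-- A continuous injective map on a compact set reflects convergence. -/
theorem IsCompact.tendsto_of_injOn {X Y ι : Type*} [TopologicalSpace X] [TopologicalSpace Y]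
    [T2Space Y] {K : Set X} (hK : IsCompact K) {h : X → Y} (hc : ContinuousOn h K)
    (hi : Set.InjOn h K) {l : Filter ι} {x : ι → X} {x₀ : X} (hx : ∀ᶠ i in l, x i ∈ K)
    (hx₀ : x₀ ∈ K) (hlim : Tendsto (fun i => h (x i)) l (𝓝 (h x₀))) : Tendsto x l (𝓝 x₀) := by
  classical
  have : CompactSpace K := isCompact_iff_compactSpace.1 hK
  have hemb : IsClosedEmbedding (K.domRestrict h) :=
    (continuousOn_iff_continuous_domRestrict.1 hc).isClosedEmbedding (Set.injOn_iff_injective.1 hi)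
  -- Indices with `x i ∉ K` are sent to `x₀`; eventually there are none.
  let x' : ι → K := fun i => if hi : x i ∈ K then ⟨x i, hi⟩ else ⟨x₀, hx₀⟩
  have hx' : ∀ᶠ i in l, (x' i : X) = x i := by
    filter_upwards [hx] with i hi
    simp [x', hi]
  have h1 : Tendsto (fun i => K.domRestrict h (x' i)) l (𝓝 (K.domRestrict h ⟨x₀, hx₀⟩)) := by
    refine hlim.congr' ?_
    filter_upwards [hx'] with i hi
    simp [Set.domRestrict, hi]
  have h2 : Tendsto x' l (𝓝 ⟨x₀, hx₀⟩) := (hemb.isInducing.tendsto_nhds_iff).2 h1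
  exact ((continuous_subtype_val.tendsto _).comp h2).congr' hx'

/-! ### Scalar concave conservation laws -/

/-- A `C¹` concave flux `f` on `[A, B]` with derivative `lam`. -/
structure IsConcaveFlux (f lam : ℝ → ℝ) (A B : ℝ) : Prop where
  le : A ≤ B
  deriv : ∀ ρ ∈ Set.Icc A B, HasDerivWithinAt f (lam ρ) (Set.Icc A B) ρ
  cont : ContinuousOn lam (Set.Icc A B)
  anti : AntitoneOn lam (Set.Icc A B)

/-- Slope of a chord. -/
noncomputable def chord (f : ℝ → ℝ) (a b : ℝ) : ℝ := (f b - f a) / (b - a)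

/-- Value at `ξ` of the Lax solution between the densities `a` and `b`: a shock of speed `s` if
`a < b`, otherwise the generalized inverse `g` of the characteristic speed clamped to `[b, a]`. -/
noncomputable def lax (a b s g ξ : ℝ) : ℝ :=
  if a < b then (if ξ < s then a else b) else max b (min a g)

theorem lax_self (a s g ξ : ℝ) : lax a a s g ξ = a := by simp [lax]

theorem lax_mem {a b A B : ℝ} (s g ξ : ℝ) (ha : a ∈ Set.Icc A B) (hb : b ∈ Set.Icc A B) :
    lax a b s g ξ ∈ Set.Icc A B := by
  obtain ⟨h1, h2⟩ := ha
  obtain ⟨h3, h4⟩ := hb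
  unfold lax
  split_ifs with h h'
  · exact ⟨h1, h2⟩
  · exact ⟨h3, h4⟩
  · exact ⟨le_max_of_le_left h3, max_le h4 ((min_le_left _ _).trans h2)⟩

theorem lax_between (a b s g ξ : ℝ) : lax a b s g ξ ∈ Set.Icc (min a b) (max a b) :=
  lax_mem s g ξ ⟨min_le_left _ _, le_max_left _ _⟩ ⟨min_le_right _ _, le_max_right _ _⟩

/-- Convergence of the Lax solution under convergence of its data. -/
theorem tendsto_lax {ι : Type*} {l : Filter ι} {a b s g : ι → ℝ} {a₀ b₀ s₀ g₀ ξ : ℝ}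
    (ha : Tendsto a l (𝓝 a₀)) (hb : Tendsto b l (𝓝 b₀)) (hg : Tendsto g l (𝓝 g₀))
    (hs : a₀ < b₀ → Tendsto s l (𝓝 s₀) ∧ ξ ≠ s₀) :
    Tendsto (fun i => lax (a i) (b i) (s i) (g i) ξ) l (𝓝 (lax a₀ b₀ s₀ g₀ ξ)) := by
  rcases lt_trichotomy a₀ b₀ with h | h | h
  · obtain ⟨hs, hξ⟩ := hs h
    have hlt := ha.eventually_lt hb h
    rcases lt_or_gt_of_ne hξ with h' | h'
    · simp only [lax, if_pos h, if_pos h']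
      refine ha.congr' ?_
      filter_upwards [hlt, hs.eventually (lt_mem_nhds h')] with i h1 h2
      simp [h1, h2]
    · simp only [lax, if_pos h, if_neg h'.not_gt]
      refine hb.congr' ?_
      filter_upwards [hlt, hs.eventually (gt_mem_nhds h')] with i h1 h2
      simp [h1, h2.not_gt]
  -- For equal limits the branch may alternate along `l` and the shock speed need not converge; the
  -- value stays between `a i` and `b i`, which have the same limit.
  · subst h
    rw [lax_self]
    refine tendsto_of_tendsto_of_tendsto_of_le_of_le (g := fun i => min (a i) (b i))
      (h := fun i => max (a i) (b i)) ?_ ?_ (fun i => (lax_between _ _ _ _ _).1)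
      (fun i => (lax_between _ _ _ _ _).2)
    · simpa using ha.min hb
    · simpa using ha.max hb
  · have hlt := hb.eventually_lt ha h
    simp only [lax, if_neg h.not_gt]
    refine (hb.max (ha.min hg)).congr' ?_
    filter_upwards [hlt] with i h1
    simp [h1.not_gt]

namespace TwoPhase

/-! ### The generalized inverse of a non-increasing speed -/

section Fan

variable {lam : ℝ → ℝ} {A B : ℝ}

theorem fan_set_bddBelow (hAB : A ≤ B) (ξ : ℝ) :
    BddBelow (insert B {ρ | ρ ∈ Set.Icc A B ∧ lam ρ ≤ ξ}) :=
  ⟨A, by rintro x (rfl | ⟨h, -⟩); exacts [hAB, h.1]⟩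

theorem fan_le (hAB : A ≤ B) (ξ : ℝ) : fan lam B A ξ ≤ B :=
  csInf_le (fan_set_bddBelow hAB ξ) (Set.mem_insert _ _)

theorem le_fan (hAB : A ≤ B) (ξ : ℝ) : A ≤ fan lam B A ξ :=
  le_csInf ⟨B, Set.mem_insert _ _⟩ (by rintro x (rfl | ⟨h, -⟩); exacts [hAB, h.1])

theorem fan_le_of_speed_le {r ξ : ℝ} (hr : r ∈ Set.Icc A B) (h : lam r ≤ ξ) :
    fan lam B A ξ ≤ r :=
  csInf_le (fan_set_bddBelow (hr.1.trans hr.2) ξ) (Or.inr ⟨hr, h⟩)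

theorem lt_speed_of_lt_fan {r ξ : ℝ} (hr : r ∈ Set.Icc A B) (h : r < fan lam B A ξ) :
    ξ < lam r := by
  by_contra h'
  exact absurd (fan_le_of_speed_le hr (not_lt.1 h')) (not_le.2 h)

theorem fan_antitone (hAB : A ≤ B) : Antitone (fan lam B A) := fun x y hxy => by
  refine csInf_le_csInf (fan_set_bddBelow hAB y) ⟨B, Set.mem_insert _ _⟩ ?_
  rintro r (rfl | ⟨h, h'⟩)
  · exact Set.mem_insert _ _
  · exact Or.inr ⟨h, h'.trans hxy⟩

theorem speed_le_of_fan_lt (hanti : AntitoneOn lam (Set.Icc A B)) {r ξ : ℝ}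
    (hr : r ∈ Set.Icc A B) (h : fan lam B A ξ < r) : lam r ≤ ξ := by
  obtain ⟨s, hs, hsr⟩ := exists_lt_of_csInf_lt ⟨B, Set.mem_insert _ _⟩ h
  rcases hs with rfl | ⟨hs, hle⟩
  · exact absurd hr.2 hsr.not_ge
  · exact (hanti hs hr hsr.le).trans hle

/-- Every density in `(r, B)` lies strictly above the fan, so its speed is at most `ξ`; letting it
decrease to `r` uses continuity. The end `B` is excluded because it belongs to the set defining
`fan` whatever its speed. -/
theorem speed_le_of_fan_le (hanti : AntitoneOn lam (Set.Icc A B))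
    (hcont : ContinuousOn lam (Set.Icc A B)) {r ξ : ℝ}
    (hr : r ∈ Set.Icc A B) (hrB : r < B) (h : fan lam B A ξ ≤ r) : lam r ≤ ξ := by
  have hsub : Set.Ioo r B ⊆ Set.Icc A B := fun x hx => ⟨hr.1.trans hx.1.le, hx.2.le⟩
  have ht : Tendsto lam (𝓝[Set.Ioo r B] r) (𝓝 (lam r)) := (hcont r hr).mono hsub
  have : (𝓝[Set.Ioo r B] r).NeBot := by
    rw [nhdsWithin_Ioo_eq_nhdsGT hrB]; infer_instance
  refine le_of_tendsto ht ?_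
  filter_upwards [self_mem_nhdsWithin] with x hx
  exact speed_le_of_fan_lt hanti (hsub hx) (h.trans_lt hx.1)

/-- At a density strictly between the two sides, both fans depend on the same test `lam r ≤ ξ`, so
nothing can separate them. This frees the generalized inverse from the data `a`, `b`, which only
enter through the clamp. -/
theorem fan_eq_clamp (hanti : AntitoneOn lam (Set.Icc A B)) {a b : ℝ} (hb : A ≤ b) (hba : b ≤ a)
    (ha : a ≤ B) (ξ : ℝ) : fan lam a b ξ = max b (min a (fan lam B A ξ)) := by
  have hanti' : AntitoneOn lam (Set.Icc b a) := hanti.mono (Set.Icc_subset_Icc hb ha)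
  apply le_antisymm
  · by_contra hlt
    obtain ⟨r, h1, h2⟩ := exists_between (not_le.1 hlt)
    have hbr := (le_max_left _ _).trans_lt h1
    have hra := h2.trans_le (fan_le hba ξ)
    have hgr : fan lam B A ξ < r := by
      rcases min_lt_iff.1 ((le_max_right _ _).trans_lt h1) with h | h
      · exact absurd h hra.not_gt
      · exact h
    have := speed_le_of_fan_lt hanti ⟨hb.trans hbr.le, hra.le.trans ha⟩ hgr
    exact absurd (fan_le_of_speed_le ⟨hbr.le, hra.le⟩ this) (not_le.2 h2)
  · refine max_le (le_fan hba ξ) ?_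
    by_contra hlt
    obtain ⟨r, h1, h2⟩ := exists_between (not_le.1 hlt)
    obtain ⟨hra, hrg⟩ := lt_min_iff.1 h2
    have hbr := (le_fan hba ξ).trans_lt h1
    have := speed_le_of_fan_lt hanti' ⟨hbr.le, hra.le⟩ h1
    exact absurd (fan_le_of_speed_le ⟨hb.trans hbr.le, hra.le.trans ha⟩ this) (not_le.2 hrg)

end Fan

end TwoPhase

open TwoPhase

/-! ### Chords, splitting and merging for a concave flux -/

namespace IsConcaveFlux

variable {f lam : ℝ → ℝ} {A B : ℝ}

/-- The mean value theorem. The comparisons of chord slopes below go through such an intermediate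
density and the monotonicity of `lam`. -/
theorem exists_speed (hf : IsConcaveFlux f lam A B) {x y : ℝ} (hx : x ∈ Set.Icc A B)
    (hy : y ∈ Set.Icc A B) (hxy : x < y) : ∃ z ∈ Set.Ioo x y, f y - f x = lam z * (y - x) := by
  have hsub : Set.Icc x y ⊆ Set.Icc A B := Set.Icc_subset_Icc hx.1 hy.2
  obtain ⟨z, hz, h⟩ := exists_hasDerivAt_eq_slope f lam hxy
    (fun r hr => ((hf.deriv r (hsub hr)).continuousWithinAt).mono hsub)
    (fun r hr => (hf.deriv r (hsub ⟨hr.1.le, hr.2.le⟩)).hasDerivAt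
      (Icc_mem_nhds (hx.1.trans_lt hr.1) (hr.2.trans_le hy.2)))
  refine ⟨z, hz, ?_⟩
  rw [h, div_mul_cancel₀ _ (sub_pos.2 hxy).ne']

theorem exists_chord (hf : IsConcaveFlux f lam A B) {x y : ℝ} (hx : x ∈ Set.Icc A B)
    (hy : y ∈ Set.Icc A B) (hxy : x < y) : ∃ z ∈ Set.Ioo x y, chord f x y = lam z := by
  obtain ⟨z, hz, h⟩ := hf.exists_speed hx hy hxy
  exact ⟨z, hz, by rw [chord, h, mul_div_cancel_right₀ _ (sub_pos.2 hxy).ne']⟩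

theorem speed_le_chord (hf : IsConcaveFlux f lam A B) {x y : ℝ} (hx : x ∈ Set.Icc A B)
    (hy : y ∈ Set.Icc A B) (hxy : x < y) : lam y ≤ chord f x y := by
  obtain ⟨z, hz, h⟩ := hf.exists_chord hx hy hxy
  rw [h]
  exact hf.anti ⟨hx.1.trans hz.1.le, hz.2.le.trans hy.2⟩ hy hz.2.le

theorem chord_le_speed (hf : IsConcaveFlux f lam A B) {x y : ℝ} (hx : x ∈ Set.Icc A B)
    (hy : y ∈ Set.Icc A B) (hxy : x < y) : chord f x y ≤ lam x := by
  obtain ⟨z, hz, h⟩ := hf.exists_chord hx hy hxy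
  rw [h]
  exact hf.anti hx ⟨hx.1.trans hz.1.le, hz.2.le.trans hy.2⟩ hz.1.le

/-- Chords from a fixed left end point have decreasing slope. -/
theorem chord_anti_right (hf : IsConcaveFlux f lam A B) {x y z : ℝ} (hx : x ∈ Set.Icc A B)
    (hz : z ∈ Set.Icc A B) (hxy : x < y) (hyz : y ≤ z) :
    chord f x z * (y - x) ≤ f y - f x := by
  rcases hyz.eq_or_lt with rfl | hyz
  · rw [chord, div_mul_cancel₀ _ (sub_pos.2 hxy).ne']
  have hy : y ∈ Set.Icc A B := ⟨hx.1.trans hxy.le, hyz.le.trans hz.2⟩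
  obtain ⟨c, hc, h1⟩ := hf.exists_speed hx hy hxy
  obtain ⟨d, hd, h2⟩ := hf.exists_speed hy hz hyz
  have hcd : lam d ≤ lam c := hf.anti ⟨hx.1.trans hc.1.le, hc.2.le.trans hy.2⟩
    ⟨hy.1.trans hd.1.le, hd.2.le.trans hz.2⟩ (hc.2.trans hd.1).le
  have hxz : 0 < z - x := by linarith
  rw [chord, div_mul_eq_mul_div, div_le_iff₀ hxz]
  have e : f z - f x = lam c * (y - x) + lam d * (z - y) := by linarith
  rw [e, h1]
  nlinarith [mul_nonneg (mul_nonneg (sub_nonneg.2 hcd) (sub_pos.2 hxy).le) (sub_pos.2 hyz).le]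

theorem exists_lipschitz (hf : IsConcaveFlux f lam A B) : ∃ L, 0 ≤ L ∧
    ∀ x ∈ Set.Icc A B, ∀ y ∈ Set.Icc A B, x ≤ y → |f y - f x| ≤ L * (y - x) := by
  refine ⟨max |lam A| |lam B|, le_max_of_le_left (abs_nonneg _), fun x hx y hy hxy => ?_⟩
  rcases hxy.eq_or_lt with rfl | hxy
  · simp
  obtain ⟨z, hz, h⟩ := hf.exists_speed hx hy hxy
  have hz' : z ∈ Set.Icc A B := ⟨hx.1.trans hz.1.le, hz.2.le.trans hy.2⟩
  rw [h, abs_mul, abs_of_pos (sub_pos.2 hxy)]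
  refine mul_le_mul_of_nonneg_right ?_ (sub_pos.2 hxy).le
  exact (abs_le_max_abs_abs (hf.anti hz' ⟨hf.le, le_rfl⟩ hz'.2)
    (hf.anti ⟨le_rfl, hf.le⟩ hz' hz'.1)).trans_eq (max_comm _ _)

/-- Splitting of the Lax solution at one of its states. -/
theorem lax_split {g : ℝ → ℝ} (hg : Antitone g) {a b m x₀ : ℝ} (s : ℝ → ℝ → ℝ)
    (h : lax a b (s a b) (g x₀) x₀ = m) (x : ℝ) :
    lax a m (s a m) (g x) x = (if x ≤ x₀ then lax a b (s a b) (g x) x else m) ∧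
    lax m b (s m b) (g x) x = (if x < x₀ then m else lax a b (s a b) (g x) x) := by
  by_cases hab : a < b
  · by_cases hx₀ : x₀ < s a b
    · obtain rfl : a = m := by simpa [lax, hab, hx₀] using h
      simp only [lax_self]
      simp only [lax, hab, if_true]
      constructor
      · split_ifs with h1 h2 <;> first | rfl | (exfalso; linarith)
      · split_ifs with h1 h2 <;> first | rfl | (exfalso; linarith)
    · obtain rfl : b = m := by simpa [lax, hab, hx₀] using h
      simp only [lax_self]
      simp only [lax, hab, if_true]
      constructor
      · split_ifs with h1 h2 <;> first | rfl | (exfalso; linarith)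
      · split_ifs with h1 h2 <;> first | rfl | (exfalso; linarith)
  -- Rarefaction: `m` is the clamp of `g x₀` to `[b, a]`. As `g` is antitone, the clamp of `g x` is
  -- at least `m` for `x ≤ x₀` and at most `m` afterwards, so clamping to `[m, a]` or `[b, m]`
  -- instead either changes nothing or returns `m`.
  · rw [lax, if_neg hab] at h
    have hba := not_lt.1 hab
    have hbm : b ≤ m := h ▸ le_max_left _ _
    have hma : m ≤ a := h ▸ max_le hba (min_le_left _ _)
    simp only [lax, hbm.not_gt, hma.not_gt, hab, if_false]
    constructor
    · split_ifs with hx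
      · have : m ≤ max b (min a (g x)) :=
          h ▸ max_le_max le_rfl (min_le_min le_rfl (hg hx))
        apply le_antisymm
        · exact max_le this (le_max_right _ _)
        · exact max_le (le_max_of_le_left hbm) (le_max_right _ _)
      · refine max_eq_left ?_
        exact (min_le_min le_rfl (hg (not_le.1 hx).le)).trans (h ▸ le_max_right _ _)
    · split_ifs with hx
      · have : m ≤ max b (min a (g x)) :=
          h ▸ max_le_max le_rfl (min_le_min le_rfl (hg hx.le))
        refine le_antisymm (max_le hbm (min_le_left _ _)) ?_
        rcases le_max_iff.1 this with h1 | h1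
        · exact le_max_of_le_left h1
        · exact le_max_of_le_right (le_min le_rfl (h1.trans (min_le_right _ _)))
      · have h1 : min a (g x) ≤ m :=
          (min_le_min le_rfl (hg (not_lt.1 hx))).trans (h ▸ le_max_right _ _)
        congr 1
        apply le_antisymm
        · exact le_min ((min_le_left _ _).trans hma) (min_le_right _ _)
        · exact le_min h1 (min_le_right _ _)

/-- A completed wave arriving at `m`. -/
theorem speed_of_lax_eq_right (hf : IsConcaveFlux f lam A B) {a m x₀ : ℝ} (ha : a ∈ Set.Icc A B)
    (hm : m ∈ Set.Icc A B) (ham : a ≠ m)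
    (h : lax a m (chord f a m) (fan lam B A x₀) x₀ = m) : lam m ≤ x₀ := by
  rcases lt_or_gt_of_ne ham with h1 | h1
  · rw [lax, if_pos h1] at h
    split_ifs at h with h2
    · exact absurd h ham
    · exact (hf.speed_le_chord ha hm h1).trans (not_lt.1 h2)
  · rw [lax, if_neg h1.not_gt] at h
    have h2 : min a (fan lam B A x₀) ≤ m := h ▸ le_max_right _ _
    rcases min_le_iff.1 h2 with h3 | h3
    · exact absurd h1 h3.not_gt
    · exact speed_le_of_fan_le hf.anti hf.cont hm (h1.trans_le ha.2) h3

/-- The Lax solution has reached its right state. -/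
theorem lax_eq_right {a b x : ℝ}
    (hb : b ∈ Set.Icc A B) (h1 : a < b → chord f a b ≤ x) (h2 : b ≤ a → lam b ≤ x) :
    lax a b (chord f a b) (fan lam B A x) x = b := by
  unfold lax
  split_ifs with h h'
  · exact absurd (h1 h) (not_le.2 h')
  · rfl
  · exact max_eq_left ((min_le_right _ _).trans (fan_le_of_speed_le hb (h2 (not_lt.1 h))))

/-- A wave which has not yet left `m`. -/
theorem speed_of_lax_eq_left (hf : IsConcaveFlux f lam A B) {b m x₀ : ℝ}
    (hm : m ∈ Set.Icc A B) (hb : b ∈ Set.Icc A B)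
    (hmb : m ≠ b) (h : lax m b (chord f m b) (fan lam B A x₀) x₀ = m) {z : ℝ}
    (hz : z ∈ Set.Icc A B) (hzm : z < m) : x₀ < lam z := by
  rcases lt_or_gt_of_ne hmb with h1 | h1
  · rw [lax, if_pos h1] at h
    split_ifs at h with h2
    · exact h2.trans_le ((hf.chord_le_speed hm hb h1).trans (hf.anti hz hm hzm.le))
    · exact absurd h.symm hmb
  · rw [lax, if_neg h1.not_gt] at h
    rcases le_max_iff.1 h.ge with h2 | h2
    · exact absurd h1 h2.not_gt
    · exact lt_speed_of_lt_fan hz (hzm.trans_le (h2.trans (min_le_right _ _)))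

/-- Merging of Lax solutions. -/
theorem lax_merge (hf : IsConcaveFlux f lam A B) {a m b x₀ : ℝ} (ha : a ∈ Set.Icc A B)
    (hm : m ∈ Set.Icc A B) (hb : b ∈ Set.Icc A B)
    (h1 : lax a m (chord f a m) (fan lam B A x₀) x₀ = m)
    (h2 : lax m b (chord f m b) (fan lam B A x₀) x₀ = m) (x : ℝ) :
    lax a b (chord f a b) (fan lam B A x) x =
      if x < x₀ then lax a m (chord f a m) (fan lam B A x) x
      else lax m b (chord f m b) (fan lam B A x) x := by
  have hg : Antitone (fan lam B A) := fan_antitone hf.le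
  by_cases hmb : m = b
  · subst hmb
    rw [lax_self]
    split_ifs with hx
    · rfl
    · have := (lax_split hg (chord f) h1 x).1
      split_ifs at this with h
      · rw [show x = x₀ by linarith, h1]
      · exact this
  by_cases ham : a = m
  · subst ham
    rw [lax_self]
    have := (lax_split hg (chord f) h2 x).2
    split_ifs at this ⊢ with h
    · exact this
    · rfl
  -- An incoming shock would have speed `lam z ≤ x₀` with `z < m`, against the wave still to leave
  -- `m`; an outgoing shock would be faster than `x₀` but not faster than `lam m ≤ x₀`. Two
  -- rarefactions remain, and the common fan equals `m` at `x₀`.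
  have hle := hf.speed_of_lax_eq_right ha hm ham h1
  rcases lt_or_gt_of_ne ham with ham' | ham'
  · exfalso
    rw [lax, if_pos ham'] at h1
    split_ifs at h1 with h3
    · exact ham h1
    obtain ⟨z, hz, hzc⟩ := hf.exists_chord ha hm ham'
    have hzI : z ∈ Set.Icc A B := ⟨ha.1.trans hz.1.le, hz.2.le.trans hm.2⟩
    have := hf.speed_of_lax_eq_left hm hb hmb h2 hzI hz.2
    linarith [not_lt.1 h3]
  · rcases lt_or_gt_of_ne hmb with hmb' | hmb'
    · exfalso
      rw [lax, if_pos hmb'] at h2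
      split_ifs at h2 with h3
      · linarith [hf.chord_le_speed hm hb hmb']
      · exact hmb h2.symm
    · have hba : b < a := hmb'.trans ham'
      rw [lax, if_neg ham'.not_gt] at h1
      rw [lax, if_neg hmb'.not_gt] at h2
      have g1 : m ≤ fan lam B A x₀ := by
        rcases le_max_iff.1 h2.ge with h | h
        · exact absurd hmb' h.not_gt
        · exact h.trans (min_le_right _ _)
      have g2 : fan lam B A x₀ ≤ m := by
        rcases min_le_iff.1 (h1 ▸ le_max_right _ _) with h | h
        · exact absurd ham' h.not_gt
        · exact h
      simp only [lax, hba.not_gt, ham'.not_gt, hmb'.not_gt, if_false]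
      split_ifs with hx
      · have hm' : m ≤ min a (fan lam B A x) := le_min ham'.le (g1.trans (hg hx.le))
        rw [max_eq_right hm', max_eq_right (hmb'.le.trans hm')]
      · have hm' : fan lam B A x ≤ m := (hg (not_lt.1 hx)).trans g2
        rw [min_eq_right hm', min_eq_right (hm'.trans ham'.le)]

end IsConcaveFlux

end

/-! ### Functions of bounded variation dominated by a monotone function -/

/-- Bounded monotone functions. -/
def BddMono (m : ℝ → ℝ) : Prop := Monotone m ∧ ∃ C, ∀ x, |m x| ≤ C

/-- `F` has bounded variation: its increments are dominated by those of a bounded monotone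
function. -/
def HasBV {X : Type*} [PseudoMetricSpace X] (F : ℝ → X) : Prop :=
  ∃ m, BddMono m ∧ ∀ a b, a ≤ b → dist (F a) (F b) ≤ m b - m a

/-- `m₁` before `c`, followed by a jump of size `k` and by `m₂` from `c` on. -/
noncomputable def glue (c k : ℝ) (m₁ m₂ : ℝ → ℝ) (x : ℝ) : ℝ :=
  if x < c then m₁ x else m₂ x - m₂ c + m₁ c + k

theorem glue_sub {c k a b : ℝ} {m₁ m₂ : ℝ → ℝ} (ha : a < c) (hb : c ≤ b) :
    glue c k m₁ m₂ b - glue c k m₁ m₂ a = (m₁ c - m₁ a) + k + (m₂ b - m₂ c) := by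
  simp only [glue, if_pos ha, if_neg hb.not_gt]
  ring

theorem glue_sub_left {c k a b : ℝ} {m₁ m₂ : ℝ → ℝ} (ha : a < c) (hb : b < c) :
    glue c k m₁ m₂ b - glue c k m₁ m₂ a = m₁ b - m₁ a := by
  simp only [glue, if_pos ha, if_pos hb]

theorem glue_sub_right {c k a b : ℝ} {m₁ m₂ : ℝ → ℝ} (ha : c ≤ a) (hb : c ≤ b) :
    glue c k m₁ m₂ b - glue c k m₁ m₂ a = m₂ b - m₂ a := by
  simp only [glue, if_neg ha.not_gt, if_neg hb.not_gt]
  ring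

namespace BddMono

variable {m m₁ m₂ : ℝ → ℝ}

theorem const (c : ℝ) : BddMono fun _ => c := ⟨monotone_const, |c|, fun _ => le_rfl⟩

theorem add (h₁ : BddMono m₁) (h₂ : BddMono m₂) : BddMono fun x => m₁ x + m₂ x := by
  obtain ⟨C₁, hC₁⟩ := h₁.2
  obtain ⟨C₂, hC₂⟩ := h₂.2
  exact ⟨h₁.1.add h₂.1, C₁ + C₂, fun x => (abs_add_le _ _).trans (add_le_add (hC₁ x) (hC₂ x))⟩

theorem const_mul (h : BddMono m) {k : ℝ} (hk : 0 ≤ k) : BddMono fun x => k * m x := by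
  obtain ⟨C, hC⟩ := h.2
  refine ⟨h.1.const_mul hk, k * C, fun x => ?_⟩
  rw [abs_mul, abs_of_nonneg hk]
  exact mul_le_mul_of_nonneg_left (hC x) hk

theorem glue (h₁ : BddMono m₁) (h₂ : BddMono m₂) (c : ℝ) {k : ℝ} (hk : 0 ≤ k) :
    BddMono (glue c k m₁ m₂) := by
  obtain ⟨C₁, hC₁⟩ := h₁.2
  obtain ⟨C₂, hC₂⟩ := h₂.2
  refine ⟨fun a b hab => ?_, C₂ + C₂ + C₁ + k, fun x => ?_⟩
  · rw [← sub_nonneg]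
    rcases lt_or_ge a c with ha | ha
    · rcases lt_or_ge b c with hb | hb
      · rw [glue_sub_left ha hb]; linarith [h₁.1 hab]
      · rw [glue_sub ha hb]; linarith [h₁.1 ha.le, h₂.1 hb]
    · rw [glue_sub_right ha (ha.trans hab)]; linarith [h₂.1 hab]
  · have e1 := abs_le.1 (hC₁ x)
    have e2 := abs_le.1 (hC₂ x)
    have e3 := abs_le.1 (hC₁ c)
    have e4 := abs_le.1 (hC₂ c)
    unfold _root_.glue
    split_ifs
    · exact abs_le.2 ⟨by linarith, by linarith⟩
    · exact abs_le.2 ⟨by linarith, by linarith⟩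

end BddMono

namespace HasBV

variable {X Y : Type*} [PseudoMetricSpace X] [PseudoMetricSpace Y]

theorem const (c : X) : HasBV fun _ => c := ⟨_, BddMono.const 0, fun _ _ _ => by simp⟩

theorem of_monotone {m : ℝ → ℝ} (h : Monotone m) {A B : ℝ} (hm : ∀ x, m x ∈ Set.Icc A B) :
    HasBV m := by
  refine ⟨m, ⟨h, max |A| |B|, fun x => abs_le_max_abs_abs (hm x).1 (hm x).2⟩, fun a b hab => ?_⟩
  rw [dist_comm, Real.dist_eq, abs_of_nonneg (sub_nonneg.2 (h hab))]

theorem comp_lipschitz {F : ℝ → X} (h : HasBV F) {G : ℝ → Y} {K : ℝ} (hK : 0 ≤ K)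
    (hG : ∀ a b, dist (G a) (G b) ≤ K * dist (F a) (F b)) : HasBV G := by
  obtain ⟨m, hm, hF⟩ := h
  refine ⟨_, hm.const_mul hK, fun a b hab => (hG a b).trans ?_⟩
  rw [← mul_sub]
  exact mul_le_mul_of_nonneg_left (hF a b hab) hK

theorem of_antitone {m : ℝ → ℝ} (h : Antitone m) {A B : ℝ} (hm : ∀ x, m x ∈ Set.Icc A B) :
    HasBV m := by
  have : HasBV fun x => -m x := of_monotone (A := -B) (B := -A) h.neg
    fun x => ⟨neg_le_neg (hm x).2, neg_le_neg (hm x).1⟩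
  exact this.comp_lipschitz zero_le_one fun a b => by simp

theorem prodMk {F : ℝ → X} {G : ℝ → Y} (hF : HasBV F) (hG : HasBV G) :
    HasBV fun x => (F x, G x) := by
  obtain ⟨m₁, hm₁, h₁⟩ := hF
  obtain ⟨m₂, hm₂, h₂⟩ := hG
  refine ⟨_, hm₁.add hm₂, fun a b hab => ?_⟩
  rw [Prod.dist_eq]
  have e1 := h₁ a b hab
  have e2 := h₂ a b hab
  have e3 := dist_nonneg (x := F a) (y := F b)
  have e4 := dist_nonneg (x := G a) (y := G b)
  exact max_le (by linarith) (by linarith)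

/-- The jump added to the dominating function is `dist (F c) (G c)`: an increment across `c` is
estimated along `F a`, `F c`, `G c`, `G b`. -/
theorem ite {F G : ℝ → X} (hF : HasBV F) (hG : HasBV G) (c : ℝ) :
    HasBV fun x => if x < c then F x else G x := by
  obtain ⟨m₁, hm₁, h₁⟩ := hF
  obtain ⟨m₂, hm₂, h₂⟩ := hG
  refine ⟨_, hm₁.glue hm₂ c (dist_nonneg (x := F c) (y := G c)), fun a b hab => ?_⟩
  rcases lt_or_ge a c with ha | ha
  · rcases lt_or_ge b c with hb | hb
    · rw [glue_sub_left ha hb]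
      simpa only [if_pos ha, if_pos hb] using h₁ a b hab
    · rw [glue_sub ha hb]
      simp only [if_pos ha, if_neg hb.not_gt]
      have := dist_triangle4 (F a) (F c) (G c) (G b)
      linarith [h₁ a c ha.le, h₂ c b hb]
  · rw [glue_sub_right ha (ha.trans hab)]
    simpa only [if_neg ha.not_gt, if_neg (ha.trans hab).not_gt] using h₂ a b hab

/-- `F` is continuous wherever the dominating monotone function is. This yields both measurability
and continuity almost everywhere. -/
theorem countable_not_continuousAt {F : ℝ → X} (h : HasBV F) :
    {x | ¬ContinuousAt F x}.Countable := by
  obtain ⟨m, hm, hF⟩ := h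
  refine hm.1.countable_not_continuousAt.mono fun x (hx : ¬ContinuousAt F x) => ?_
  rw [Set.mem_ofPred_eq]
  intro hmx
  refine hx ?_
  rw [ContinuousAt, tendsto_iff_dist_tendsto_zero]
  refine squeeze_zero (g := fun y => dist (m y) (m x)) (fun _ => dist_nonneg) (fun y => ?_)
    (tendsto_iff_dist_tendsto_zero.1 hmx)
  rcases le_total y x with hyx | hyx
  · refine (hF y x hyx).trans ?_
    rw [dist_comm, Real.dist_eq]
    exact le_abs_self _
  · rw [dist_comm]
    exact (hF x y hyx).trans (le_abs_self _)

theorem measurable [MeasurableSpace X] [BorelSpace X] {F : ℝ → X} (h : HasBV F) :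
    Measurable F :=
  measurable_of_countable_not_continuousAt h.countable_not_continuousAt

theorem eVariationOn_ne_top {F : ℝ → X} (h : HasBV F) : eVariationOn F Set.univ ≠ ⊤ := by
  obtain ⟨m, ⟨hm, C, hC⟩, hF⟩ := h
  have : eVariationOn F Set.univ ≤ ENNReal.ofReal (2 * C) := by
    refine iSup_le fun p => ?_
    obtain ⟨n, u, hu, -⟩ := p
    calc ∑ i ∈ Finset.range n, edist (F (u (i + 1))) (F (u i))
        ≤ ∑ i ∈ Finset.range n, ENNReal.ofReal (m (u (i + 1)) - m (u i)) := by
          refine Finset.sum_le_sum fun i _ => ?_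
          rw [edist_dist, dist_comm]
          exact ENNReal.ofReal_le_ofReal (hF _ _ (hu (Nat.le_succ i)))
      _ = ENNReal.ofReal (∑ i ∈ Finset.range n, (m (u (i + 1)) - m (u i))) := by
          rw [ENNReal.ofReal_sum_of_nonneg]
          exact fun i _ => sub_nonneg.2 (hm (hu (Nat.le_succ i)))
      _ ≤ ENNReal.ofReal (2 * C) := by
          refine ENNReal.ofReal_le_ofReal ?_
          rw [Finset.sum_range_sub fun i => m (u i)]
          linarith [abs_le.1 (hC (u n)), abs_le.1 (hC (u 0))]
  exact ne_top_of_le_ne_top ENNReal.ofReal_ne_top this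

end HasBV

/-! ### Dissipative self-similar profiles -/

/-- The profiles `E`, `Q` of an entropy pair satisfy `dQ ≤ ξ dE`, so that `E(x/t)ₜ + Q(x/t)ₓ ≤ 0`
in the sense of distributions. -/
def Dissipative (E Q : ℝ → ℝ) : Prop :=
  ∃ m, BddMono m ∧ ∀ a b, a ≤ b → |E b - E a| ≤ m b - m a ∧ |Q b - Q a| ≤ m b - m a ∧
    Q b - Q a - a * (E b - E a) ≤ (b - a) * (m b - m a)

namespace Dissipative

variable {E Q E₁ Q₁ E₂ Q₂ : ℝ → ℝ}

theorem const (e q : ℝ) : Dissipative (fun _ => e) (fun _ => q) :=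
  ⟨_, BddMono.const 0, fun a b _ => by simp⟩

theorem add (h₁ : Dissipative E₁ Q₁) (h₂ : Dissipative E₂ Q₂) :
    Dissipative (fun x => E₁ x + E₂ x) (fun x => Q₁ x + Q₂ x) := by
  obtain ⟨m₁, hm₁, h₁⟩ := h₁
  obtain ⟨m₂, hm₂, h₂⟩ := h₂
  refine ⟨_, hm₁.add hm₂, fun a b hab => ?_⟩
  obtain ⟨p1, p2, p3⟩ := h₁ a b hab
  obtain ⟨q1, q2, q3⟩ := h₂ a b hab
  rw [abs_le] at *
  refine ⟨⟨by linarith, by linarith⟩, abs_le.2 ⟨by linarith, by linarith⟩, by linarith⟩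

theorem const_mul (h : Dissipative E Q) {k : ℝ} (hk : 0 ≤ k) :
    Dissipative (fun x => k * E x) (fun x => k * Q x) := by
  obtain ⟨m, hm, h⟩ := h
  refine ⟨_, hm.const_mul hk, fun a b hab => ?_⟩
  obtain ⟨p1, p2, p3⟩ := h a b hab
  simp only [← mul_sub, abs_mul, abs_of_nonneg hk]
  refine ⟨mul_le_mul_of_nonneg_left p1 hk, mul_le_mul_of_nonneg_left p2 hk, ?_⟩
  have := mul_le_mul_of_nonneg_left p3 hk
  linarith

/-- Concatenation of two profiles at `c` across a dissipative jump. -/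
theorem ite (h₁ : Dissipative E₁ Q₁) (h₂ : Dissipative E₂ Q₂) {c : ℝ}
    (hc : Q₂ c - Q₁ c ≤ c * (E₂ c - E₁ c)) :
    Dissipative (fun x => if x < c then E₁ x else E₂ x)
      (fun x => if x < c then Q₁ x else Q₂ x) := by
  obtain ⟨m₁, hm₁, h₁⟩ := h₁
  obtain ⟨m₂, hm₂, h₂⟩ := h₂
  refine ⟨_, hm₁.glue hm₂ c (add_nonneg (abs_nonneg (E₂ c - E₁ c)) (abs_nonneg (Q₂ c - Q₁ c))),
    fun a b hab => ?_⟩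
  rcases lt_or_ge a c with ha | ha
  · rcases lt_or_ge b c with hb | hb
    · rw [glue_sub_left ha hb]
      simpa only [if_pos ha, if_pos hb] using h₁ a b hab
    · rw [glue_sub ha hb]
      simp only [if_pos ha, if_neg hb.not_gt]
      obtain ⟨p1, p2, p3⟩ := h₁ a c ha.le
      obtain ⟨q1, q2, q3⟩ := h₂ c b hb
      have k1 := abs_nonneg (E₂ c - E₁ c)
      have k2 := abs_nonneg (Q₂ c - Q₁ c)
      have k3 := le_abs_self (E₂ c - E₁ c)
      have k4 := neg_abs_le (E₂ c - E₁ c)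
      have k5 := le_abs_self (Q₂ c - Q₁ c)
      have k6 := neg_abs_le (Q₂ c - Q₁ c)
      set A := |E₂ c - E₁ c|
      set B := |Q₂ c - Q₁ c|
      rw [abs_le] at p1 p2 q1 q2
      have hm1 := hm₁.1 ha.le
      have hm2 := hm₂.1 hb
      refine ⟨abs_le.2 ⟨by linarith, by linarith⟩, abs_le.2 ⟨by linarith, by linarith⟩, ?_⟩
      -- The claim has slope `a`, while the jump and the right part are controlled with slope `c`.
      -- The discrepancy, `c - a` times an increment of `E`, is absorbed by the error term, since
      -- `m` dominates the increments of `E` and the jump.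
      have n1 : (c - a) * (E₂ c - E₁ c) ≤ (c - a) * A :=
        mul_le_mul_of_nonneg_left k3 (by linarith)
      have n2 : (c - a) * (E₂ b - E₂ c) ≤ (c - a) * (m₂ b - m₂ c) :=
        mul_le_mul_of_nonneg_left q1.2 (by linarith)
      have n3 : 0 ≤ (b - c) * (m₁ c - m₁ a) := mul_nonneg (by linarith) (by linarith)
      have n4 : 0 ≤ (b - c) * A := mul_nonneg (by linarith) k1
      have n5 : 0 ≤ (b - a) * B := mul_nonneg (by linarith) k2
      nlinarith
  · rw [glue_sub_right ha (ha.trans hab)]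
    simpa only [if_neg ha.not_gt, if_neg (ha.trans hab).not_gt] using h₂ a b hab

theorem hasBV_left (h : Dissipative E Q) : HasBV E := by
  obtain ⟨m, hm, h⟩ := h
  exact ⟨m, hm, fun a b hab => by rw [dist_comm]; exact (h a b hab).1⟩

theorem hasBV_right (h : Dissipative E Q) : HasBV Q := by
  obtain ⟨m, hm, h⟩ := h
  exact ⟨m, hm, fun a b hab => by rw [dist_comm]; exact (h a b hab).2.1⟩

end Dissipative

/-! ### Integration against compactly supported functions -/

/-- Boundedness on compact sets. -/
def LocBdd {α : Type*} [TopologicalSpace α] (K : α → ℝ) : Prop :=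
  ∀ S, IsCompact S → ∃ C, ∀ x ∈ S, |K x| ≤ C

namespace LocBdd

variable {α : Type*} [TopologicalSpace α] {K L : α → ℝ}

theorem of_bdd {C : ℝ} (h : ∀ x, |K x| ≤ C) : LocBdd K := fun _ _ => ⟨C, fun x _ => h x⟩

theorem of_continuous (h : Continuous K) : LocBdd K := fun S hS => by
  obtain ⟨C, hC⟩ := hS.exists_bound_of_continuousOn h.continuousOn
  exact ⟨C, hC⟩

theorem mul (hK : LocBdd K) (hL : LocBdd L) : LocBdd fun x => K x * L x := fun S hS => by
  obtain ⟨C, hC⟩ := hK S hS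
  obtain ⟨D, hD⟩ := hL S hS
  refine ⟨C * D, fun x hx => ?_⟩
  rw [abs_mul]
  exact mul_le_mul (hC x hx) (hD x hx) (abs_nonneg _) ((abs_nonneg _).trans (hC x hx))

theorem sub (hK : LocBdd K) (hL : LocBdd L) : LocBdd fun x => K x - L x := fun S hS => by
  obtain ⟨C, hC⟩ := hK S hS
  obtain ⟨D, hD⟩ := hL S hS
  exact ⟨C + D, fun x hx => (abs_sub _ _).trans (add_le_add (hC x hx) (hD x hx))⟩

theorem comp {β : Type*} [TopologicalSpace β] {g : β → α} (hK : LocBdd K) (hg : Continuous g) :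
    LocBdd fun x => K (g x) := fun S hS => by
  obtain ⟨C, hC⟩ := hK _ (hS.image hg)
  exact ⟨C, fun x hx => hC _ (Set.mem_image_of_mem g hx)⟩

theorem integrable_mul [MeasurableSpace α] [BorelSpace α] [T2Space α] {μ : Measure α}
    [IsFiniteMeasureOnCompacts μ] (hK : LocBdd K) (hm : Measurable K) {ψ : α → ℝ}
    (hψ : Continuous ψ) (hc : HasCompactSupport ψ) : Integrable (fun x => K x * ψ x) μ := by
  have hsupp : Function.support (fun x => K x * ψ x) ⊆ tsupport ψ := fun x hx =>
    subset_tsupport ψ (right_ne_zero_of_mul hx)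
  rw [← integrableOn_iff_integrable_of_support_subset hsupp]
  obtain ⟨C, hC⟩ := (hK.mul (of_continuous hψ)) _ hc
  exact Measure.integrableOn_of_bounded (M := C) hc.measure_lt_top.ne
    (hm.mul hψ.measurable).aestronglyMeasurable
    ((ae_restrict_iff' hc.isClosed.measurableSet).2 (Eventually.of_forall hC))

end LocBdd

theorem HasBV.exists_bound {E : ℝ → ℝ} (h : HasBV E) : ∃ C, ∀ x, |E x| ≤ C := by
  obtain ⟨m, ⟨hm, C, hC⟩, hE⟩ := h
  refine ⟨|E 0| + 2 * C, fun x => ?_⟩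
  have hd : dist (E x) (E 0) ≤ 2 * C := by
    have e1 := abs_le.1 (hC x)
    have e2 := abs_le.1 (hC 0)
    rcases le_total x 0 with hx | hx
    · linarith [hE x 0 hx]
    · rw [dist_comm]; linarith [hE 0 x hx]
  rw [Real.dist_eq] at hd
  calc |E x| = |E 0 + (E x - E 0)| := by ring_nf
    _ ≤ |E 0| + |E x - E 0| := abs_add_le _ _
    _ ≤ _ := by linarith

theorem HasBV.locBdd {E : ℝ → ℝ} (h : HasBV E) : LocBdd E := by
  obtain ⟨C, hC⟩ := h.exists_bound
  exact LocBdd.of_bdd hC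

/-- Derivative of a correlation with a test function. -/
theorem hasDerivAt_integral_mul_translate {K Φ : ℝ → ℝ} (hK : LocBdd K) (hm : Measurable K)
    (hΦ : ContDiff ℝ 1 Φ) (hc : HasCompactSupport Φ) :
    HasDerivAt (fun s => ∫ ξ, K ξ * Φ (ξ + s)) (∫ ξ, K ξ * deriv Φ ξ) 0 := by
  have hdc : Continuous (deriv Φ) := hΦ.continuous_deriv le_rfl
  obtain ⟨D, hD⟩ := hdc.bounded_above_of_compact_support hc.deriv
  obtain ⟨R, hR⟩ := (Metric.isBounded_iff_subset_closedBall (0 : ℝ)).1 hc.deriv.isBounded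
  -- For `|s| < 1` the translate of `deriv Φ` by `s` is supported in the ball of radius `R + 1`,
  -- which carries the integrable bound.
  obtain ⟨C, hC⟩ := hK _ (isCompact_closedBall (0 : ℝ) (R + 1))
  have hint := fun s : ℝ => hK.integrable_mul (μ := volume) hm
    (hΦ.continuous.comp (continuous_add_const s)) (hc.comp_homeomorph (Homeomorph.addRight s))
  have key := hasDerivAt_integral_of_dominated_loc_of_deriv_le (μ := volume) (𝕜 := ℝ)
    (F := fun s ξ => K ξ * Φ (ξ + s)) (F' := fun s ξ => K ξ * deriv Φ (ξ + s)) (x₀ := 0)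
    (s := Metric.ball 0 1)
    (bound := (Metric.closedBall (0 : ℝ) (R + 1)).indicator fun _ => C * D)
    (Metric.ball_mem_nhds _ one_pos)
    (Eventually.of_forall fun s => (hint s).aestronglyMeasurable) (hint 0)
    (hm.mul (by fun_prop)).aestronglyMeasurable
    (Eventually.of_forall fun ξ s hs => ?_)
    ((integrable_indicator_iff measurableSet_closedBall).2
      (integrableOn_const (measure_closedBall_lt_top).ne))
    (Eventually.of_forall fun ξ s _ => ?_)
  · simpa using key.2
  · by_cases hξ : ξ ∈ Metric.closedBall (0 : ℝ) (R + 1)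
    · rw [Set.indicator_of_mem hξ, norm_mul]
      exact mul_le_mul (hC ξ hξ) (hD _) (norm_nonneg _) ((abs_nonneg _).trans (hC ξ hξ))
    · have : deriv Φ (ξ + s) = 0 := by
        refine image_eq_zero_of_notMem_tsupport fun h => hξ ?_
        have h1 := hR h
        simp only [Metric.mem_closedBall, Metric.mem_ball, dist_zero_right, Real.norm_eq_abs]
          at h1 hs ⊢
        calc |ξ| = |(ξ + s) - s| := by ring_nf
          _ ≤ |ξ + s| + |s| := abs_sub _ _
          _ ≤ R + 1 := by linarith
      rw [Set.indicator_of_notMem hξ, this]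
      simp
  · have h1 : HasDerivAt Φ (deriv Φ (ξ + s)) (ξ + s) :=
      (hΦ.differentiable one_ne_zero _).hasDerivAt
    exact (h1.comp_const_add ξ s).const_mul (K ξ)

namespace Dissipative

variable {E Q : ℝ → ℝ}

theorem locBdd_profile (h : Dissipative E Q) : LocBdd fun ξ => Q ξ - ξ * E ξ :=
  h.hasBV_right.locBdd.sub ((LocBdd.of_continuous continuous_id).mul h.hasBV_left.locBdd)

theorem measurable_profile (h : Dissipative E Q) : Measurable fun ξ => Q ξ - ξ * E ξ :=
  h.hasBV_right.measurable.sub (measurable_id.mul h.hasBV_left.measurable)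

/-- One-dimensional form of the entropy inequality. -/
theorem integral_le (h : Dissipative E Q) {Φ : ℝ → ℝ} (hΦ : ContDiff ℝ 1 Φ)
    (hc : HasCompactSupport Φ) (hnn : ∀ ξ, 0 ≤ Φ ξ) :
    ∫ ξ, E ξ * Φ ξ ≤ ∫ ξ, (Q ξ - ξ * E ξ) * deriv Φ ξ := by
  have hH := h.locBdd_profile
  have hHm := h.measurable_profile
  have hE := h.hasBV_left
  obtain ⟨m, hm, hdis⟩ := h
  set H := fun ξ => Q ξ - ξ * E ξ with hHdef
  have hmB : LocBdd m := by
    obtain ⟨C, hC⟩ := hm.2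
    exact LocBdd.of_bdd hC
  -- The right-hand side of the claim is the derivative at `0` of `s ↦ ∫ H ξ * Φ (ξ + s)`. Shifting
  -- the translation onto `H` leaves only increments of `H` to compare, so neither `E` nor `Q` has
  -- to be differentiable.
  have hcH := hasDerivAt_integral_mul_translate hH hHm hΦ hc
  have hcm := hasDerivAt_integral_mul_translate hmB hm.1.measurable hΦ hc
  have hlim1 := hcH.tendsto_slope_zero_right
  have hlim2 : Tendsto (fun s => ∫ ξ, m ξ * Φ (ξ + s)) (𝓝[>] 0) (𝓝 (∫ ξ, m ξ * Φ (ξ + 0))) :=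
    hcm.continuousAt.tendsto.mono_left nhdsWithin_le_nhds
  have hlim3 := (hlim2.sub_const (∫ ξ, m ξ * Φ (ξ + 0))).const_add (∫ ξ, E ξ * Φ ξ)
  rw [sub_self, add_zero] at hlim3
  refine le_of_tendsto_of_tendsto hlim3 hlim1 ?_
  filter_upwards [self_mem_nhdsWithin] with s hs
  have hs : 0 < s := hs
  have hshift : ∀ K : ℝ → ℝ, ∫ ξ, K ξ * Φ (ξ + s) = ∫ ξ, K (ξ - s) * Φ ξ := fun K => by
    rw [← integral_sub_right_eq_self (fun ξ => K ξ * Φ (ξ + s)) s]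
    simp
  have hint : ∀ {K : ℝ → ℝ}, LocBdd K → Measurable K → Integrable fun ξ => K ξ * Φ ξ :=
    fun h1 h2 => h1.integrable_mul h2 hΦ.continuous hc
  have hsub : Continuous fun ξ : ℝ => ξ - s := by fun_prop
  simp only [add_zero, zero_add, smul_eq_mul]
  rw [hshift, hshift]
  have i1 := hint hH hHm
  have i2 := hint (hH.comp hsub) (hHm.comp hsub.measurable)
  have i3 := hint hmB hm.1.measurable
  have i4 := hint (hmB.comp hsub) (hm.1.measurable.comp hsub.measurable)
  have i5 := hint hE.locBdd hE.measurable
  have i6 : Integrable fun ξ => m (ξ - s) * Φ ξ - m ξ * Φ ξ := i4.sub i3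
  rw [← integral_sub i4 i3, ← integral_sub i2 i1, ← integral_const_mul, ← integral_add i5 i6]
  refine integral_mono (i5.add i6) ((i2.sub i1).const_mul _) fun ξ => ?_
  have hd := (hdis (ξ - s) ξ (by linarith)).2.2
  -- This is the dissipation inequality on `[ξ - s, ξ]` divided by `s`. The error `m ξ - m (ξ - s)`
  -- tends to zero with `s` once integrated against `Φ`.
  have key : E ξ + (m (ξ - s) - m ξ) ≤ s⁻¹ * (H (ξ - s) - H ξ) := by
    rw [le_inv_mul_iff₀ hs]
    simp only [hHdef]
    nlinarith
  have := mul_le_mul_of_nonneg_right key (hnn ξ)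
  beta_reduce
  calc _ = (E ξ + (m (ξ - s) - m ξ)) * Φ ξ := by ring
    _ ≤ _ := this
    _ = _ := by ring

/-- One-dimensional form of the conservation law. -/
theorem integral_eq (h : Dissipative E Q) (h' : Dissipative (fun x => -E x) (fun x => -Q x))
    {Φ : ℝ → ℝ} (hΦ : ContDiff ℝ 1 Φ) (hc : HasCompactSupport Φ) :
    ∫ ξ, (Q ξ - ξ * E ξ) * deriv Φ ξ = ∫ ξ, E ξ * Φ ξ := by
  have hnonneg : ∀ Ψ : ℝ → ℝ, ContDiff ℝ 1 Ψ → HasCompactSupport Ψ → (∀ ξ, 0 ≤ Ψ ξ) →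
      ∫ ξ, (Q ξ - ξ * E ξ) * deriv Ψ ξ = ∫ ξ, E ξ * Ψ ξ := by
    intro Ψ hΨ hcΨ hnn
    have e1 := h.integral_le hΨ hcΨ hnn
    have e2 := h'.integral_le hΨ hcΨ hnn
    have e3 : ∀ ξ, (-Q ξ - ξ * -E ξ) * deriv Ψ ξ = -((Q ξ - ξ * E ξ) * deriv Ψ ξ) :=
      fun ξ => by ring
    simp only [e3, neg_mul, integral_neg] at e2
    linarith
  obtain ⟨C, hC⟩ := hΦ.continuous.bounded_above_of_compact_support hc
  obtain ⟨R, hR⟩ := (Metric.isBounded_iff_subset_closedBall (0 : ℝ)).1 hc.isBounded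
  have hC0 : 0 ≤ C := (norm_nonneg _).trans (hC 0)
  -- The bump is `1` on the support of `Φ` and `C` bounds `|Φ|`, so `Φ + C b` is nonnegative and `Φ`
  -- is a difference of nonnegative test functions. The maximum with `1` keeps the inner radius
  -- positive.
  let b : ContDiffBump (0 : ℝ) := ⟨max R 1, max R 1 + 1, by positivity, by linarith⟩
  have hb1 : ContDiff ℝ 1 fun ξ => C * b ξ := contDiff_const.mul b.contDiff
  have hb2 : HasCompactSupport fun ξ => C * b ξ := b.hasCompactSupport.mul_left
  have hb3 : ∀ ξ, 0 ≤ C * b ξ := fun ξ => mul_nonneg hC0 b.nonneg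
  have hs3 : ∀ ξ, 0 ≤ Φ ξ + C * b ξ := fun ξ => by
    by_cases hξ : ξ ∈ tsupport Φ
    · have : b ξ = 1 := b.one_of_mem_closedBall
        (Metric.closedBall_subset_closedBall (le_max_left _ _) (hR hξ))
      rw [this]
      linarith [(abs_le.1 (hC ξ)).1]
    · rw [image_eq_zero_of_notMem_tsupport hξ, zero_add]
      exact hb3 ξ
  have e1 := hnonneg _ hb1 hb2 hb3
  have e2 := hnonneg _ (hΦ.add hb1) (hc.add hb2) hs3
  have hd : ∀ ξ, deriv (fun ξ => Φ ξ + C * b ξ) ξ = deriv Φ ξ + deriv (fun ξ => C * b ξ) ξ :=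
    fun ξ => deriv_fun_add (hΦ.differentiable one_ne_zero ξ) (hb1.differentiable one_ne_zero ξ)
  have hE := h.hasBV_left
  simp only [hd, mul_add] at e2
  rw [integral_add, integral_add] at e2
  · linarith
  · exact hE.locBdd.integrable_mul hE.measurable hΦ.continuous hc
  · exact hE.locBdd.integrable_mul hE.measurable hb1.continuous hb2
  · exact h.locBdd_profile.integrable_mul h.measurable_profile
      (hΦ.continuous_deriv le_rfl) hc.deriv
  · exact h.locBdd_profile.integrable_mul h.measurable_profile
      (hb1.continuous_deriv le_rfl) hb2.deriv

end Dissipative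

section

open TwoPhase

/-! ### Self-similar functions against test functions -/

/-- The test function in the coordinates `(t, x / t)`. -/
noncomputable def selfSimilarTest (φ : ℝ × ℝ → ℝ) (z : ℝ × ℝ) : ℝ := φ (z.1, z.1 * z.2)

namespace TwoPhase.IsTest

variable {φ : ℝ × ℝ → ℝ}

theorem continuous_fderiv_apply (hφ : IsTest φ) (v : ℝ × ℝ) :
    Continuous fun z => fderiv ℝ φ z v :=
  (hφ.1.continuous_fderiv (by simp)).clm_apply continuous_const

theorem hasCompactSupport_fderiv_apply (hφ : IsTest φ) (v : ℝ × ℝ) :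
    HasCompactSupport fun z => fderiv ℝ φ z v := hφ.2.1.fderiv_apply (𝕜 := ℝ) v

theorem exists_pos_le (hφ : IsTest φ) : ∃ τ > 0, ∀ z ∈ tsupport φ, τ ≤ z.1 := by
  rcases (tsupport φ).eq_empty_or_nonempty with h | h
  · exact ⟨1, one_pos, by simp [h]⟩
  · obtain ⟨z₀, hz₀, hmin⟩ := (show IsCompact (tsupport φ) from hφ.2.1).exists_isMinOn h
      continuous_fst.continuousOn
    exact ⟨z₀.1, (hφ.2.2 hz₀).1, fun z hz => hmin hz⟩

theorem hasDerivAt_comp (hφ : IsTest φ) {a b : ℝ → ℝ} {a' b' s : ℝ} (ha : HasDerivAt a a' s)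
    (hb : HasDerivAt b b' s) :
    HasDerivAt (fun s => φ (a s, b s)) (a' * dt φ (a s, b s) + b' * dx φ (a s, b s)) s := by
  have h1 : HasFDerivAt φ (fderiv ℝ φ (a s, b s)) (a s, b s) :=
    (hφ.1.differentiable (by simp) _).hasFDerivAt
  have h2 := h1.comp_hasDerivAt s (ha.prodMk hb)
  have : (a', b') = a' • ((1, 0) : ℝ × ℝ) + b' • ((0, 1) : ℝ × ℝ) := by simp
  rw [this, map_add, map_smul, map_smul] at h2
  exact h2

theorem contDiff_selfSimilarTest (hφ : IsTest φ) :
    ContDiff ℝ (↑(⊤ : ℕ∞)) (selfSimilarTest φ) :=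
  hφ.1.comp (contDiff_fst.prodMk (contDiff_fst.mul contDiff_snd))

/-- The support of `φ` stays at times `t ≥ τ > 0`, where `(t, x) ↦ (t, x / t)` is continuous, so its
image is compact. -/
theorem hasCompactSupport_selfSimilarTest (hφ : IsTest φ) :
    HasCompactSupport (selfSimilarTest φ) := by
  obtain ⟨τ, hτ, hle⟩ := hφ.exists_pos_le
  have hK : IsCompact (tsupport φ) := hφ.2.1
  have hcont : ContinuousOn (fun z : ℝ × ℝ => (z.1, z.2 / z.1)) (tsupport φ) :=
    continuousOn_fst.prodMk (continuousOn_snd.div continuousOn_fst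
      fun z hz => (hτ.trans_le (hle z hz)).ne')
  refine HasCompactSupport.intro (hK.image_of_continuousOn hcont) fun z hz => ?_
  refine image_eq_zero_of_notMem_tsupport (f := φ) (x := (z.1, z.1 * z.2))
    fun h => hz ⟨_, h, ?_⟩
  have h0 : z.1 ≠ 0 := (hτ.trans_le (hle _ h)).ne'
  ext
  · rfl
  · simp [mul_div_cancel_left₀ _ h0]

theorem contDiff_section (hφ : IsTest φ) (t : ℝ) : ContDiff ℝ 1 fun ξ => φ (t, t * ξ) :=
  (hφ.1.of_le (by exact_mod_cast le_top)).comp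
    (contDiff_const.prodMk (contDiff_const.mul contDiff_id))

theorem hasCompactSupport_section (hφ : IsTest φ) (t : ℝ) :
    HasCompactSupport fun ξ => φ (t, t * ξ) :=
  HasCompactSupport.intro (hφ.hasCompactSupport_selfSimilarTest.image continuous_snd)
    fun ξ hξ => image_eq_zero_of_notMem_tsupport (f := selfSimilarTest φ) (x := (t, ξ))
      fun h1 => hξ ⟨_, h1, rfl⟩

theorem selfSimilarTest_of_nonpos (hφ : IsTest φ) {t : ℝ} (ht : t ≤ 0) (ξ : ℝ) :
    φ (t, t * ξ) = 0 ∧ dt φ (t, t * ξ) = 0 ∧ dx φ (t, t * ξ) = 0 := by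
  have h : (t, t * ξ) ∉ tsupport φ := fun h => absurd (hφ.2.2 h).1 (not_lt.2 ht)
  have h' : fderiv ℝ φ (t, t * ξ) = 0 :=
    image_eq_zero_of_notMem_tsupport fun h1 => h (tsupport_fderiv_subset ℝ h1)
  exact ⟨image_eq_zero_of_notMem_tsupport h, by simp [dt, h'], by simp [dx, h']⟩

end TwoPhase.IsTest

namespace Dissipative

variable {E Q : ℝ → ℝ} {φ : ℝ × ℝ → ℝ}

/-- The weak formulation of a self-similar balance law, reduced to one space dimension. -/
theorem integral_halfPlane (h : Dissipative E Q) (hφ : IsTest φ) :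
    Integrable (fun t => ∫ ξ, (Q ξ - ξ * E ξ) * deriv (fun ξ => φ (t, t * ξ)) ξ) ∧
    Integrable (fun t => ∫ ξ, E ξ * φ (t, t * ξ)) ∧
    ∫ z in halfPlane, (E (z.2 / z.1) * dt φ z + Q (z.2 / z.1) * dx φ z) =
      (∫ t, ∫ ξ, (Q ξ - ξ * E ξ) * deriv (fun ξ => φ (t, t * ξ)) ξ) -
        ∫ t, ∫ ξ, E ξ * φ (t, t * ξ) := by
  have hE := h.hasBV_left
  have hQ := h.hasBV_right
  set H := fun ξ => Q ξ - ξ * E ξ with hH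
  have hψ := hφ.contDiff_selfSimilarTest
  have hψc := hφ.hasCompactSupport_selfSimilarTest
  set ψ := selfSimilarTest φ with hψdef
  have hderξ : ∀ t ξ, HasDerivAt (fun ξ => φ (t, t * ξ)) (t * dx φ (t, t * ξ)) ξ := fun t ξ => by
    simpa using hφ.hasDerivAt_comp (hasDerivAt_const ξ t) ((hasDerivAt_id ξ).const_mul t)
  have hdert : ∀ ξ t, HasDerivAt (fun t => φ (t, t * ξ))
      (dt φ (t, t * ξ) + ξ * dx φ (t, t * ξ)) t := fun ξ t => by
    simpa using hφ.hasDerivAt_comp (hasDerivAt_id t) ((hasDerivAt_id t).mul_const ξ)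
  have hsub : HasCompactSupport fun z : ℝ × ℝ =>
      dt φ (z.1, z.1 * z.2) + z.2 * dx φ (z.1, z.1 * z.2) := by
    have e : (fun z : ℝ × ℝ => dt φ (z.1, z.1 * z.2) + z.2 * dx φ (z.1, z.1 * z.2)) =
        fun z => fderiv ℝ ψ z (1, 0) := by
      funext z
      have h1 : HasFDerivAt ψ (fderiv ℝ ψ z) z := (hψ.differentiable (by simp) _).hasFDerivAt
      have h2 := (HasFDerivAt.comp_hasDerivAt z.1 (f := fun t => (t, z.2)) (by simpa using h1)
        ((hasDerivAt_id z.1).prodMk (hasDerivAt_const z.1 z.2)))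
      exact (hdert z.2 z.1).unique h2
    rw [e]
    exact hψc.fderiv_apply (𝕜 := ℝ) _
  have hsub2 : HasCompactSupport fun z : ℝ × ℝ => z.1 * dx φ (z.1, z.1 * z.2) := by
    have e : (fun z : ℝ × ℝ => z.1 * dx φ (z.1, z.1 * z.2)) = fun z => fderiv ℝ ψ z (0, 1) := by
      funext z
      have h1 : HasFDerivAt ψ (fderiv ℝ ψ z) z := (hψ.differentiable (by simp) _).hasFDerivAt
      have h2 := (HasFDerivAt.comp_hasDerivAt z.2 (f := fun ξ => (z.1, ξ)) (by simpa using h1)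
        ((hasDerivAt_const z.2 z.1).prodMk (hasDerivAt_id z.2)))
      exact (hderξ z.1 z.2).unique h2
    rw [e]
    exact hψc.fderiv_apply (𝕜 := ℝ) _
  have hT : Continuous fun z : ℝ × ℝ => (z.1, z.1 * z.2) := by fun_prop
  have hcdt : Continuous (dt φ) := hφ.continuous_fderiv_apply (1, 0)
  have hcdx : Continuous (dx φ) := hφ.continuous_fderiv_apply (0, 1)
  have hcdt' := hcdt.comp hT
  have hcdx' := hcdx.comp hT
  -- integrability in the plane
  have i1 : Integrable (fun z : ℝ × ℝ => E z.2 * ψ z) (volume.prod volume) :=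
    (hE.locBdd.comp continuous_snd).integrable_mul (hE.measurable.comp measurable_snd)
      hψ.continuous hψc
  have i2 : Integrable (fun z : ℝ × ℝ => H z.2 * (z.1 * dx φ (z.1, z.1 * z.2)))
      (volume.prod volume) :=
    (h.locBdd_profile.comp continuous_snd).integrable_mul
      (h.measurable_profile.comp measurable_snd) (continuous_fst.mul hcdx') hsub2
  have i3 : Integrable (fun z : ℝ × ℝ => E z.2 *
      (z.1 * (dt φ (z.1, z.1 * z.2) + z.2 * dx φ (z.1, z.1 * z.2)))) (volume.prod volume) :=
    (hE.locBdd.comp continuous_snd).integrable_mul (hE.measurable.comp measurable_snd)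
      (continuous_fst.mul (hcdt'.add (continuous_snd.mul hcdx'))) hsub.mul_left
  have hdd : ∀ t ξ, deriv (fun ξ => φ (t, t * ξ)) ξ = t * dx φ (t, t * ξ) :=
    fun t ξ => (hderξ t ξ).deriv
  simp only [hdd]
  refine ⟨i2.integral_prod_left, i1.integral_prod_left, ?_⟩
  -- the left hand side in the new coordinates
  obtain ⟨C, hC⟩ := hE.exists_bound
  obtain ⟨D, hD⟩ := hQ.exists_bound
  have hq : Measurable fun z : ℝ × ℝ => z.2 / z.1 := measurable_snd.div measurable_fst
  have hG : Integrable (fun z : ℝ × ℝ => E (z.2 / z.1) * dt φ z + Q (z.2 / z.1) * dx φ z)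
      (volume.prod volume) :=
    ((LocBdd.of_bdd fun z : ℝ × ℝ => hC (z.2 / z.1)).integrable_mul (hE.measurable.comp hq)
      hcdt (hφ.hasCompactSupport_fderiv_apply _)).add
    ((LocBdd.of_bdd fun z : ℝ × ℝ => hD (z.2 / z.1)).integrable_mul (hQ.measurable.comp hq)
      hcdx (hφ.hasCompactSupport_fderiv_apply _))
  -- Substitution `x = t ξ` at fixed `t > 0`, with Jacobian `t`; the term `ξ E dx φ` is added to the
  -- first factor and removed from the flux, which turns `Q` into `H`.
  have step1 : ∫ z in halfPlane, (E (z.2 / z.1) * dt φ z + Q (z.2 / z.1) * dx φ z) =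
      ∫ t, ∫ ξ, (E ξ * (t * (dt φ (t, t * ξ) + ξ * dx φ (t, t * ξ))) +
        H ξ * (t * dx φ (t, t * ξ))) := by
    rw [halfPlane, Measure.volume_eq_prod, setIntegral_prod _ hG.integrableOn]
    refine Eq.trans ?_
      (setIntegral_eq_integral_of_forall_compl_eq_zero (s := Set.Ioi (0 : ℝ)) ?_)
    · refine setIntegral_congr_fun measurableSet_Ioi fun t ht => ?_
      have ht : 0 < t := ht
      rw [setIntegral_univ]
      have := Measure.integral_comp_mul_left
        (fun x => E (x / t) * dt φ (t, x) + Q (x / t) * dx φ (t, x)) t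
      beta_reduce at this ⊢
      rw [abs_of_pos (inv_pos.2 ht), smul_eq_mul, ← div_eq_inv_mul, eq_div_iff ht.ne'] at this
      rw [← this, ← integral_mul_const]
      refine integral_congr_ae (Eventually.of_forall fun ξ => ?_)
      simp only [mul_div_cancel_left₀ _ ht.ne', hH]
      ring
    · intro t ht
      have ht : t ≤ 0 := not_lt.1 ht
      have h0 := fun ξ => hφ.selfSimilarTest_of_nonpos ht ξ
      simp [(h0 _).2.1, (h0 _).2.2]
  -- At fixed `ξ`, the bracket is the `t`-derivative of `ψ`. Since `t ψ` has compact support, the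
  -- integral of `ψ + t ∂ₜψ` over `t` vanishes.
  have step2 : ∫ z : ℝ × ℝ, E z.2 * (z.1 * (dt φ (z.1, z.1 * z.2) + z.2 * dx φ (z.1, z.1 * z.2)))
      ∂(volume.prod volume) = -∫ z : ℝ × ℝ, E z.2 * ψ z ∂(volume.prod volume) := by
    rw [integral_prod_symm _ i3, integral_prod_symm _ i1, ← integral_neg]
    refine integral_congr_ae (Eventually.of_forall fun ξ => ?_)
    change ∫ t, E ξ * (t * (dt φ (t, t * ξ) + ξ * dx φ (t, t * ξ))) = -∫ t, E ξ * ψ (t, ξ)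
    rw [integral_const_mul, integral_const_mul, ← mul_neg]
    congr 1
    have hcomp : ∀ {F : ℝ × ℝ → ℝ}, Continuous F → HasCompactSupport F →
        Integrable fun t => F (t, ξ) := fun {F} hF hFc =>
      (hF.comp (by fun_prop : Continuous fun t : ℝ => (t, ξ))).integrable_of_hasCompactSupport
        (HasCompactSupport.intro (hFc.image continuous_fst) fun t ht =>
          image_eq_zero_of_notMem_tsupport (f := F) (x := (t, ξ)) fun h1 => ht ⟨_, h1, rfl⟩)
    have j1 := hcomp hψ.continuous hψc
    have j2 := hcomp (continuous_fst.mul (hcdt'.add (continuous_snd.mul hcdx')))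
      (F := fun z => z.1 * (dt φ (z.1, z.1 * z.2) + z.2 * dx φ (z.1, z.1 * z.2))) hsub.mul_left
    have j3 := hcomp (continuous_fst.mul hψ.continuous) (F := fun z => z.1 * ψ z) hψc.mul_left
    have hd : ∀ t, HasDerivAt (fun t => t * ψ (t, ξ))
        (ψ (t, ξ) + t * (dt φ (t, t * ξ) + ξ * dx φ (t, t * ξ))) t := fun t => by
      have hmul := (hasDerivAt_id t).mul (hdert ξ t)
      rw [one_mul] at hmul
      exact hmul
    have := integral_eq_zero_of_hasDerivAt_of_integrable hd (j1.add j2) j3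
    rw [integral_add j1 j2] at this
    exact eq_neg_of_add_eq_zero_right this
  rw [step1]
  have e1 := integral_prod _ (i3.add i2)
  have e2 := integral_prod _ i1
  have e3 := integral_prod _ i2
  simp only [Pi.add_apply] at e1
  rw [integral_add i3 i2, step2, e2, e3] at e1
  rw [← e1]
  simp only [hψdef, selfSimilarTest]
  ring

/-- Entropy inequality for a dissipative self-similar profile. -/
theorem integral_nonneg (h : Dissipative E Q) (hφ : IsTest φ) (hnn : ∀ z, 0 ≤ φ z) :
    0 ≤ ∫ z in halfPlane, (E (z.2 / z.1) * dt φ z + Q (z.2 / z.1) * dx φ z) := by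
  obtain ⟨i1, i2, e⟩ := h.integral_halfPlane hφ
  rw [e, sub_nonneg]
  refine integral_mono i2 i1 fun t => ?_
  exact h.integral_le (hφ.contDiff_section t) (hφ.hasCompactSupport_section t) fun ξ => hnn _

/-- Weak formulation for a conservative self-similar profile. -/
theorem integral_eq_zero (h : Dissipative E Q) (h' : Dissipative (fun x => -E x) (fun x => -Q x))
    (hφ : IsTest φ) :
    ∫ z in halfPlane, (E (z.2 / z.1) * dt φ z + Q (z.2 / z.1) * dx φ z) = 0 := by
  obtain ⟨-, -, e⟩ := h.integral_halfPlane hφ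
  rw [e, sub_eq_zero]
  refine integral_congr_ae (Eventually.of_forall fun t => ?_)
  exact h.integral_eq h' (hφ.contDiff_section t) (hφ.hasCompactSupport_section t)

end Dissipative

end

section

open TwoPhase

/-! ### Variation and dissipation of Lax solutions -/

theorem hasBV_comp_lax {g h : ℝ → ℝ} (hg : Antitone g) {a b A B : ℝ} (ha : a ∈ Set.Icc A B)
    (hb : b ∈ Set.Icc A B) (s : ℝ)
    (hh : MonotoneOn h (Set.Icc A B) ∨ AntitoneOn h (Set.Icc A B)) :
    HasBV fun ξ => h (lax a b s (g ξ) ξ) := by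
  by_cases hab : a < b
  · have : (fun ξ => h (lax a b s (g ξ) ξ)) = fun ξ => if ξ < s then h a else h b := by
      funext ξ
      simp only [lax, if_pos hab, apply_ite h]
    rw [this]
    exact (HasBV.const _).ite (HasBV.const _) s
  · have hmem : ∀ ξ, lax a b s (g ξ) ξ ∈ Set.Icc A B := fun ξ => lax_mem s _ ξ ha hb
    have hanti : Antitone fun ξ => lax a b s (g ξ) ξ := fun x y hxy => by
      simp only [lax, if_neg hab]
      exact max_le_max le_rfl (min_le_min le_rfl (hg hxy))
    have hA : A ∈ Set.Icc A B := ⟨le_rfl, ha.1.trans ha.2⟩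
    have hB : B ∈ Set.Icc A B := ⟨ha.1.trans ha.2, le_rfl⟩
    rcases hh with hh | hh
    · exact HasBV.of_antitone (A := h A) (B := h B)
        (fun x y hxy => hh (hmem _) (hmem _) (hanti hxy))
        fun ξ => ⟨hh hA (hmem ξ) (hmem ξ).1, hh (hmem ξ) hB (hmem ξ).2⟩
    · exact HasBV.of_monotone (A := h B) (B := h A)
        (fun x y hxy => hh (hmem _) (hmem _) (hanti hxy))
        fun ξ => ⟨hh (hmem ξ) hB (hmem ξ).2, hh hA (hmem ξ) (hmem ξ).1⟩

namespace IsConcaveFlux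

variable {f lam : ℝ → ℝ} {A B : ℝ}

/-- If the two values differ, the slope of `f` between them is `lam z` for some `z` strictly
between. There the clamp is inactive, so the fan passes below `z` between `x` and `y`, that is `x <
lam z ≤ y`. -/
theorem clamp_flux_bounds (hf : IsConcaveFlux f lam A B) {a b x y : ℝ} (ha : a ∈ Set.Icc A B)
    (hb : b ∈ Set.Icc A B) (hba : b ≤ a) (hxy : x ≤ y) :
    let r := fun ξ => max b (min a (fan lam B A ξ))
    r y ≤ r x ∧ x * (r x - r y) ≤ f (r x) - f (r y) ∧ f (r x) - f (r y) ≤ y * (r x - r y) := by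
  intro r
  have hle : r y ≤ r x := max_le_max le_rfl (min_le_min le_rfl (fan_antitone hf.le hxy))
  refine ⟨hle, ?_⟩
  rcases hle.eq_or_lt with h | h
  · simp [h]
  have hr : ∀ ξ, r ξ ∈ Set.Icc A B := fun ξ =>
    ⟨le_max_of_le_left hb.1, max_le hb.2 ((min_le_left _ _).trans ha.2)⟩
  obtain ⟨z, hz, he⟩ := hf.exists_speed (hr y) (hr x) h
  have hzI : z ∈ Set.Icc A B := ⟨(hr y).1.trans hz.1.le, hz.2.le.trans (hr x).2⟩
  have hbz : b < z := (le_max_left _ _).trans_lt hz.1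
  have hza : z < a := hz.2.trans_le (max_le hba (min_le_left _ _))
  have h1 : x < lam z := by
    rcases lt_max_iff.1 hz.2 with h1 | h1
    · exact absurd h1 hbz.not_gt
    · exact lt_speed_of_lt_fan hzI (h1.trans_le (min_le_right _ _))
  have h2 : lam z ≤ y := by
    rcases min_lt_iff.1 ((le_max_right _ _).trans_lt hz.1) with h2 | h2
    · exact absurd h2 hza.not_gt
    · exact speed_le_of_fan_lt hf.anti hzI h2
  rw [he]
  exact ⟨mul_le_mul_of_nonneg_right h1.le (sub_pos.2 h).le,
    mul_le_mul_of_nonneg_right h2 (sub_pos.2 h).le⟩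

/-- Rarefactions are conservative. -/
theorem dissipative_clamp (hf : IsConcaveFlux f lam A B) {a b : ℝ} (ha : a ∈ Set.Icc A B)
    (hb : b ∈ Set.Icc A B) (hba : b ≤ a) :
    Dissipative (fun ξ => max b (min a (fan lam B A ξ)))
      (fun ξ => f (max b (min a (fan lam B A ξ)))) ∧
    Dissipative (fun ξ => -max b (min a (fan lam B A ξ)))
      (fun ξ => -f (max b (min a (fan lam B A ξ)))) := by
  obtain ⟨L, hL0, hL⟩ := hf.exists_lipschitz
  have hbd := fun {x y : ℝ} (hxy : x ≤ y) => hf.clamp_flux_bounds ha hb hba hxy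
  set r := fun ξ => max b (min a (fan lam B A ξ)) with hr
  have hmem : ∀ ξ, r ξ ∈ Set.Icc A B := fun ξ =>
    ⟨le_max_of_le_left hb.1, max_le hb.2 ((min_le_left _ _).trans ha.2)⟩
  -- `-r` is non-decreasing, and the factor `1 + L` makes it dominate the increments of the density
  -- and of the flux together.
  have hm : BddMono fun ξ => (1 + L) * -r ξ := by
    refine BddMono.const_mul ⟨fun x y hxy => neg_le_neg (hbd hxy).1, max |A| |B|, fun x => ?_⟩
      (by linarith)
    rw [abs_neg]
    exact abs_le_max_abs_abs (hmem x).1 (hmem x).2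
  have aux : ∀ x y, x ≤ y → |r y - r x| ≤ (1 + L) * -r y - (1 + L) * -r x ∧
      |f (r y) - f (r x)| ≤ (1 + L) * -r y - (1 + L) * -r x ∧
      f (r y) - f (r x) - x * (r y - r x) ≤ 0 ∧
      -(f (r y) - f (r x) - x * (r y - r x)) ≤ (y - x) * ((1 + L) * -r y - (1 + L) * -r x) := by
    intro x y hxy
    obtain ⟨h1, h2, h3⟩ := hbd hxy
    have h4 := hL _ (hmem y) _ (hmem x) h1
    have h5 : 0 ≤ L * (r x - r y) := mul_nonneg hL0 (sub_nonneg.2 h1)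
    have e : (1 + L) * -r y - (1 + L) * -r x = (r x - r y) + L * (r x - r y) := by ring
    have h6 : 0 ≤ (y - x) * (L * (r x - r y)) := mul_nonneg (by linarith) h5
    rw [e]
    refine ⟨?_, ?_, by linarith, by linarith⟩
    · rw [abs_sub_comm, abs_of_nonneg (sub_nonneg.2 h1)]; linarith
    · rw [abs_sub_comm]; linarith
  refine ⟨⟨_, hm, fun x y hxy => ?_⟩, ⟨_, hm, fun x y hxy => ?_⟩⟩
  · obtain ⟨p1, p2, p3, p4⟩ := aux x y hxy
    exact ⟨p1, p2, p3.trans (mul_nonneg (by linarith) ((abs_nonneg _).trans p1))⟩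
  · obtain ⟨p1, p2, p3, p4⟩ := aux x y hxy
    refine ⟨?_, ?_, ?_⟩
    · rwa [neg_sub_neg, abs_sub_comm]
    · rwa [neg_sub_neg, abs_sub_comm]
    · linarith

/-- Lax solutions are conservative. -/
theorem dissipative_lax (hf : IsConcaveFlux f lam A B) {a b : ℝ} (ha : a ∈ Set.Icc A B)
    (hb : b ∈ Set.Icc A B) :
    Dissipative (fun ξ => lax a b (chord f a b) (fan lam B A ξ) ξ)
      (fun ξ => f (lax a b (chord f a b) (fan lam B A ξ) ξ)) ∧
    Dissipative (fun ξ => -lax a b (chord f a b) (fan lam B A ξ) ξ)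
      (fun ξ => -f (lax a b (chord f a b) (fan lam B A ξ) ξ)) := by
  by_cases hab : a < b
  · simp only [lax, if_pos hab, apply_ite f, apply_ite (fun r : ℝ => -r)]
    have e : f b - f a = chord f a b * (b - a) := by
      rw [chord, div_mul_cancel₀ _ (sub_pos.2 hab).ne']
    exact ⟨(Dissipative.const _ _).ite (Dissipative.const _ _) e.le,
      (Dissipative.const _ _).ite (Dissipative.const _ _) (by linarith)⟩
  · simp only [lax, if_neg hab]
    exact hf.dissipative_clamp ha hb (not_lt.1 hab)

/-- Lax solutions dissipate the entropies `-min ρ h`. -/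
theorem dissipative_neg_min_lax (hf : IsConcaveFlux f lam A B) {a b h : ℝ}
    (ha : a ∈ Set.Icc A B) (hb : b ∈ Set.Icc A B) (hh : h ∈ Set.Icc A B) :
    Dissipative (fun ξ => -min (lax a b (chord f a b) (fan lam B A ξ) ξ) h)
      (fun ξ => -f (min (lax a b (chord f a b) (fan lam B A ξ) ξ) h)) := by
  by_cases hab : a < b
  · simp only [lax, if_pos hab, apply_ite (fun r => min r h), apply_ite f, apply_ite (fun r : ℝ => -r)]
    refine (Dissipative.const _ _).ite (Dissipative.const _ _) ?_
    rcases le_or_gt h a with ha' | ha'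
    · simp [min_eq_right ha', min_eq_right (ha'.trans hab.le)]
    · rw [min_eq_left ha'.le]
      -- At the truncated right state the concave flux lies above its chord over `[a, b]`.
      have := hf.chord_anti_right ha hb (lt_min hab ha') (min_le_left b h)
      linarith
  · simp only [lax, if_neg hab]
    -- Truncation at `h` turns the rarefaction from `a` to `b` into the one from `min a h` to `min b
    -- h`, which is conservative.
    have e : ∀ ξ, min (max b (min a (fan lam B A ξ))) h =
        max (min b h) (min (min a h) (fan lam B A ξ)) := fun ξ => by
      rw [min_max_distrib_right, min_right_comm]
    simp only [e]
    exact (hf.dissipative_clamp ⟨le_min ha.1 hh.1, (min_le_left _ _).trans ha.2⟩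
      ⟨le_min hb.1 hh.1, (min_le_left _ _).trans hb.2⟩
      (min_le_min_right _ (not_lt.1 hab))).2

end IsConcaveFlux

end

/-- For a `C²` function `h`, the derivative of `ρ h(ρ)` is differentiable. -/
theorem hasDerivWithinAt_speed {h : ℝ → ℝ} {I : Set ℝ} (hI : UniqueDiffOn ℝ I)
    (hh : ContDiffOn ℝ 2 h I) {ρ : ℝ} (hρ : ρ ∈ I) :
    HasDerivWithinAt h (derivWithin h I ρ) I ρ ∧
    HasDerivWithinAt (fun ρ => h ρ + ρ * derivWithin h I ρ)
      (2 * derivWithin h I ρ + ρ * iteratedDerivWithin 2 h I ρ) I ρ := by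
  have h1 : HasDerivWithinAt h (derivWithin h I ρ) I ρ :=
    ((hh.differentiableOn two_ne_zero) ρ hρ).hasDerivWithinAt
  have h2 : ContDiffOn ℝ 1 (derivWithin h I) I := hh.derivWithin hI (by norm_num)
  have h3 : HasDerivWithinAt (derivWithin h I) (iteratedDerivWithin 2 h I ρ) I ρ := by
    have e : iteratedDerivWithin 2 h I ρ = derivWithin (derivWithin h I) I ρ := by
      rw [iteratedDerivWithin_succ]
      exact derivWithin_congr (fun x _ => congrFun iteratedDerivWithin_one x)
        (congrFun iteratedDerivWithin_one ρ)
    rw [e]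
    exact (h2.differentiableOn one_ne_zero ρ hρ).hasDerivWithinAt
  refine ⟨h1, ?_⟩
  have := h1.add ((hasDerivWithinAt_id ρ I).mul h3)
  refine this.congr_deriv ?_
  simp only [id]
  ring

theorem AntitoneOn.of_hasDerivWithinAt {h h' : ℝ → ℝ} {I : Set ℝ} (hI : Convex ℝ I)
    (hd : ∀ ρ ∈ I, HasDerivWithinAt h (h' ρ) I ρ) (hneg : ∀ ρ ∈ I, h' ρ ≤ 0) :
    AntitoneOn h I :=
  antitoneOn_of_deriv_nonpos hI (fun ρ hρ => (hd ρ hρ).continuousWithinAt)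
    (fun ρ hρ => ((hd ρ (interior_subset hρ)).hasDerivAt
      (mem_interior_iff_mem_nhds.1 hρ)).differentiableAt.differentiableWithinAt)
    fun ρ hρ => by
      rw [((hd ρ (interior_subset hρ)).hasDerivAt (mem_interior_iff_mem_nhds.1 hρ)).deriv]
      exact hneg ρ (interior_subset hρ)

theorem StrictMonoOn.of_hasDerivWithinAt {h h' : ℝ → ℝ} {I : Set ℝ} (hI : Convex ℝ I)
    (hd : ∀ ρ ∈ I, HasDerivWithinAt h (h' ρ) I ρ) (hpos : ∀ ρ ∈ I, 0 < h' ρ) :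
    StrictMonoOn h I :=
  strictMonoOn_of_deriv_pos hI (fun ρ hρ => (hd ρ hρ).continuousWithinAt) fun ρ hρ => by
    rw [((hd ρ (interior_subset hρ)).hasDerivAt (mem_interior_iff_mem_nhds.1 hρ)).deriv]
    exact hpos ρ (interior_subset hρ)

namespace TwoPhase

noncomputable section

open Classical

variable (M : TwoPhase)

/-! ### The free phase -/

theorem Rf₂_pos : 0 < M.Rf₂ := M.Rf₁_pos.trans M.Rf₁_lt

theorem vf_hasDeriv {ρ : ℝ} (hρ : ρ ∈ Set.Icc 0 M.Rf₂) :
    HasDerivWithinAt M.vf (derivWithin M.vf (Set.Icc 0 M.Rf₂) ρ) (Set.Icc 0 M.Rf₂) ρ :=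
  (hasDerivWithinAt_speed (uniqueDiffOn_Icc M.Rf₂_pos) M.vf_contDiff hρ).1

theorem vf_cont : ContinuousOn M.vf (Set.Icc 0 M.Rf₂) := M.vf_contDiff.continuousOn

theorem vf_anti : AntitoneOn M.vf (Set.Icc 0 M.Rf₂) :=
  AntitoneOn.of_hasDerivWithinAt (convex_Icc _ _) (fun _ h => M.vf_hasDeriv h)
    M.vf_deriv_nonpos

/-- The flux of LWR. -/
def fluxF (ρ : ℝ) : ℝ := ρ * M.vf ρ

theorem isConcaveFlux_fluxF : IsConcaveFlux M.fluxF M.lamF 0 M.Rf₂ where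
  le := M.Rf₂_pos.le
  deriv ρ hρ := by
    have := (hasDerivWithinAt_id ρ (Set.Icc 0 M.Rf₂)).mul (M.vf_hasDeriv hρ)
    rw [one_mul] at this
    exact this
  cont ρ hρ := (hasDerivWithinAt_speed (uniqueDiffOn_Icc M.Rf₂_pos)
    M.vf_contDiff hρ).2.continuousWithinAt
  anti := AntitoneOn.of_hasDerivWithinAt (convex_Icc _ _)
    (fun _ hρ => (hasDerivWithinAt_speed (uniqueDiffOn_Icc M.Rf₂_pos) M.vf_contDiff hρ).2)
    M.vf_concave

theorem lamF_pos {ρ : ℝ} (hρ : ρ ∈ Set.Icc 0 M.Rf₂) : 0 < M.lamF ρ := M.vf_speed_pos ρ hρ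

theorem Rf₁_mem : M.Rf₁ ∈ Set.Icc 0 M.Rf₂ := ⟨M.Rf₁_pos.le, M.Rf₁_lt.le⟩

theorem Rf₂_mem : M.Rf₂ ∈ Set.Icc 0 M.Rf₂ := ⟨M.Rf₂_pos.le, le_rfl⟩

theorem Vf_le_vf {ρ : ℝ} (hρ : ρ ∈ Set.Icc 0 M.Rf₂) : M.Vf ≤ M.vf ρ :=
  M.vf_anti hρ M.Rf₂_mem hρ.2

theorem Vc_lt_vf {ρ : ℝ} (hρ : ρ ∈ Set.Icc 0 M.Rf₂) : M.Vc < M.vf ρ :=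
  M.Vc_lt.trans_le (M.Vf_le_vf hρ)

/-! ### The pressure -/

theorem p_hasDeriv {ρ : ℝ} (hρ : M.Rf₁ ≤ ρ) :
    HasDerivWithinAt M.p (derivWithin M.p (Set.Ici M.Rf₁) ρ) (Set.Ici M.Rf₁) ρ :=
  (hasDerivWithinAt_speed (uniqueDiffOn_Ici _) M.p_contDiff hρ).1

theorem p_mono : StrictMonoOn M.p (Set.Ici M.Rf₁) :=
  StrictMonoOn.of_hasDerivWithinAt (convex_Ici _) (fun _ h => M.p_hasDeriv h) M.p_deriv_pos

theorem p_le_p {x y : ℝ} (hx : M.Rf₁ ≤ x) (hy : M.Rf₁ ≤ y) : M.p x ≤ M.p y ↔ x ≤ y :=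
  M.p_mono.le_iff_le hx hy

theorem p_lt_p {x y : ℝ} (hx : M.Rf₁ ≤ x) (hy : M.Rf₁ ≤ y) : M.p x < M.p y ↔ x < y :=
  M.p_mono.lt_iff_lt hx hy

theorem p_cont : ContinuousOn M.p (Set.Icc M.Rf₁ M.Rmax) :=
  M.p_contDiff.continuousOn.mono Set.Icc_subset_Ici_self

theorem p_Rmax_eq : M.p M.Rmax = M.Wmax := M.p_Rmax

theorem Rf₂_lt_Rmax : M.Rf₂ < M.Rmax := by
  rw [← M.p_lt_p M.Rf₁_lt.le M.Rmax_ge, M.p_Rmax]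
  linarith [M.vf_end_pos]

/-- The flux of ARZ along the curve `v + p(ρ) = w`. -/
def fluxC (w ρ : ℝ) : ℝ := ρ * (w - M.p ρ)

/-- `p + ρ p'` has derivative `2 p' + ρ p''`, positive by `p_convex`. Strictness separates
characteristic speeds from the speeds of phase transitions. -/
theorem lam₁_strictAnti (w : ℝ) : StrictAntiOn (M.lam₁ w) (Set.Ici M.Rf₁) := by
  have h := StrictMonoOn.of_hasDerivWithinAt (convex_Ici M.Rf₁)
    (fun _ hρ => (hasDerivWithinAt_speed (uniqueDiffOn_Ici _) M.p_contDiff hρ).2) M.p_convex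
  intro x hx y hy hxy
  have := h hx hy hxy
  simp only [lam₁]
  beta_reduce at this
  linarith

theorem isConcaveFlux_fluxC (w : ℝ) : IsConcaveFlux (M.fluxC w) (M.lam₁ w) M.Rf₁ M.Rmax where
  le := M.Rmax_ge
  deriv ρ hρ := by
    have := (hasDerivWithinAt_id ρ (Set.Icc M.Rf₁ M.Rmax)).mul
      (((M.p_hasDeriv hρ.1).mono Set.Icc_subset_Ici_self).const_sub w)
    refine this.congr_deriv ?_
    simp only [lam₁, id]
    ring
  cont := by
    have h : ContinuousOn (fun ρ => M.p ρ + ρ * derivWithin M.p (Set.Ici M.Rf₁) ρ)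
        (Set.Icc M.Rf₁ M.Rmax) := fun ρ hρ =>
      ((hasDerivWithinAt_speed (uniqueDiffOn_Ici _) M.p_contDiff
        hρ.1).2.continuousWithinAt).mono Set.Icc_subset_Ici_self
    refine (continuousOn_const (c := w).sub h).congr fun ρ _ => ?_
    simp only [lam₁, Pi.sub_apply]
    ring
  anti := (M.lam₁_strictAnti w).antitoneOn.mono Set.Icc_subset_Ici_self

theorem lam₁_lt {w ρ : ℝ} (hρ : M.Rf₁ ≤ ρ) : M.lam₁ w ρ < w - M.p ρ := by
  have := mul_pos (M.Rf₁_pos.trans_le hρ) (M.p_deriv_pos ρ hρ)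
  simp only [lam₁]
  linarith

/-! ### Inverse functions -/

theorem Wc_lt_Wmax : M.Wc < M.Wmax := by
  have := M.compat_mono ⟨le_rfl, M.Rf₁_lt.le⟩ ⟨M.Rf₁_lt.le, le_rfl⟩ M.Rf₁_lt
  simp only [Wc, Wmax, Vf]
  beta_reduce at this
  linarith

theorem p_surj {y : ℝ} (hy : y ∈ Set.Icc (M.p M.Rf₁) M.Wmax) :
    ∃ ρ ∈ Set.Icc M.Rf₁ M.Rmax, M.p ρ = y := by
  have := intermediate_value_Icc M.Rmax_ge M.p_cont
  rw [M.p_Rmax_eq] at this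
  exact this hy

theorem pInv_mem {y : ℝ} (hy : y ∈ Set.Icc (M.p M.Rf₁) M.Wmax) :
    M.pInv y ∈ Set.Icc M.Rf₁ M.Rmax := Function.invFunOn_mem (M.p_surj hy)

theorem p_pInv {y : ℝ} (hy : y ∈ Set.Icc (M.p M.Rf₁) M.Wmax) : M.p (M.pInv y) = y :=
  Function.invFunOn_eq (M.p_surj hy)

theorem pInv_p {ρ : ℝ} (hρ : ρ ∈ Set.Icc M.Rf₁ M.Rmax) : M.pInv (M.p ρ) = ρ := by
  have h : ∃ r ∈ Set.Icc M.Rf₁ M.Rmax, M.p r = M.p ρ := ⟨ρ, hρ, rfl⟩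
  exact M.p_mono.injOn (Function.invFunOn_mem h).1 hρ.1 (Function.invFunOn_eq h)

theorem vfp_cont : ContinuousOn (fun ρ => M.vf ρ + M.p ρ) (Set.Icc M.Rf₁ M.Rf₂) :=
  (M.vf_cont.mono (Set.Icc_subset_Icc_left M.Rf₁_pos.le)).add
    (M.p_cont.mono (Set.Icc_subset_Icc_right M.Rf₂_lt_Rmax.le))

theorem vfp_surj {w : ℝ} (hw : w ∈ Set.Icc M.Wc M.Wmax) :
    ∃ ρ ∈ Set.Icc M.Rf₁ M.Rf₂, M.vf ρ + M.p ρ = w := by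
  have := intermediate_value_Icc M.Rf₁_lt.le M.vfp_cont
  beta_reduce at this
  rw [add_comm (M.vf M.Rf₁), add_comm (M.vf M.Rf₂)] at this
  exact this hw

theorem rhoF_mem {w : ℝ} (hw : w ∈ Set.Icc M.Wc M.Wmax) :
    M.rhoF w ∈ Set.Icc M.Rf₁ M.Rf₂ := Function.invFunOn_mem (M.vfp_surj hw)

theorem rhoF_spec {w : ℝ} (hw : w ∈ Set.Icc M.Wc M.Wmax) :
    M.vf (M.rhoF w) + M.p (M.rhoF w) = w := Function.invFunOn_eq (M.vfp_surj hw)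

theorem rhoF_eq {ρ : ℝ} (hρ : ρ ∈ Set.Icc M.Rf₁ M.Rf₂) : M.rhoF (M.vf ρ + M.p ρ) = ρ := by
  have h : ∃ r ∈ Set.Icc M.Rf₁ M.Rf₂, M.vf r + M.p r = M.vf ρ + M.p ρ := ⟨ρ, hρ, rfl⟩
  exact M.compat_mono.injOn (Function.invFunOn_mem h) hρ (Function.invFunOn_eq h)

theorem rhoF_mem_free {w : ℝ} (hw : w ∈ Set.Icc M.Wc M.Wmax) :
    M.rhoF w ∈ Set.Icc 0 M.Rf₂ :=
  ⟨M.Rf₁_pos.le.trans (M.rhoF_mem hw).1, (M.rhoF_mem hw).2⟩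

/-! ### Phases -/

theorem mem_OmegaF_iff {u : ℝ × ℝ} :
    u ∈ M.OmegaF ↔ u.1 ∈ Set.Icc 0 M.Rf₂ ∧ u.2 = M.vf u.1 := by
  refine ⟨fun h => ⟨h.1, h.2.2⟩, fun h => ⟨h.1, ?_, h.2⟩⟩
  rw [h.2]
  exact ⟨M.Vf_le_vf h.1, M.vf_anti ⟨le_rfl, M.Rf₂_pos.le⟩ h.1 h.1.1⟩

theorem free_mem {ρ : ℝ} (hρ : ρ ∈ Set.Icc 0 M.Rf₂) : (ρ, M.vf ρ) ∈ M.OmegaF :=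
  M.mem_OmegaF_iff.2 ⟨hρ, rfl⟩

variable {M}

theorem OmegaF.eq_mk {u : ℝ × ℝ} (h : u ∈ M.OmegaF) : (u.1, M.vf u.1) = u :=
  Prod.ext rfl h.2.2.symm

theorem Vc_lt_of_mem {u : ℝ × ℝ} (h : u ∈ M.OmegaF) : M.Vc < u.2 := M.Vc_lt.trans_le h.2.1.1

theorem notMem_OmegaC {u : ℝ × ℝ} (h : u ∈ M.OmegaF) : u ∉ M.OmegaC := fun h' =>
  absurd h'.2.1.2 (not_le.2 (Vc_lt_of_mem h))

theorem notMem_OmegaF {u : ℝ × ℝ} (h : u ∈ M.OmegaC) : u ∉ M.OmegaF := fun h' =>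
  notMem_OmegaC h' h

theorem OmegaC.w₂_eq {u : ℝ × ℝ} (h : u ∈ M.OmegaC) : M.w₂ u = u.2 + M.p u.1 := by
  rw [w₂, if_neg]
  exact fun h' => notMem_OmegaF h h'.1

theorem OmegaC.w₂_mem {u : ℝ × ℝ} (h : u ∈ M.OmegaC) : M.w₂ u ∈ Set.Icc M.Wc M.Wmax := by
  rw [OmegaC.w₂_eq h]; exact h.2.2

theorem OmegaC.w₁_eq {u : ℝ × ℝ} (h : u ∈ M.OmegaC) : M.w₁ u = u.2 := if_pos h

theorem OmegaF.w₁_eq {u : ℝ × ℝ} (h : u ∈ M.OmegaF) : M.w₁ u = M.Vf := if_neg (notMem_OmegaC h)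

variable (M)

/-- The second invariant of the free state of density `ρ`. -/
def wFree (ρ : ℝ) : ℝ := if ρ < M.Rf₁ then M.Wc + M.vf M.Rf₁ - M.vf ρ else M.vf ρ + M.p ρ

variable {M}

theorem OmegaF.w₂_eq {u : ℝ × ℝ} (h : u ∈ M.OmegaF) : M.w₂ u = M.wFree u.1 := by
  by_cases h' : u.1 < M.Rf₁
  · rw [w₂, if_pos ⟨h, h'⟩, wFree, if_pos h']
  · rw [w₂, if_neg (fun h1 => h' h1.2), wFree, if_neg h', h.2.2]

theorem wFree_of_lt {ρ : ℝ} (h : ρ < M.Rf₁) (h0 : 0 ≤ ρ) : M.wFree ρ ≤ M.Wc := by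
  rw [wFree, if_pos h]
  linarith [M.vf_anti ⟨h0, h.le.trans M.Rf₁_lt.le⟩ M.Rf₁_mem h.le]

theorem wFree_of_ge {ρ : ℝ} (h : M.Rf₁ ≤ ρ) : M.wFree ρ = M.vf ρ + M.p ρ := by
  rw [wFree, if_neg h.not_gt]

theorem wFree_mem_of_ge {ρ : ℝ} (h : ρ ∈ Set.Icc M.Rf₁ M.Rf₂) :
    M.wFree ρ ∈ Set.Icc M.Wc M.Wmax := by
  rw [wFree_of_ge h.1]
  have h1 := M.compat_mono.monotoneOn ⟨le_rfl, M.Rf₁_lt.le⟩ h h.1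
  have h2 := M.compat_mono.monotoneOn h ⟨M.Rf₁_lt.le, le_rfl⟩ h.2
  simp only [Wc, Wmax, Vf]
  beta_reduce at h1 h2
  exact ⟨by linarith, by linarith⟩

theorem wFree_mono : MonotoneOn M.wFree (Set.Icc 0 M.Rf₂) := by
  intro x hx y hy hxy
  rcases lt_or_ge y M.Rf₁ with hy' | hy'
  · rw [wFree, wFree, if_pos hy', if_pos (hxy.trans_lt hy')]
    linarith [M.vf_anti hx hy hxy]
  · rcases lt_or_ge x M.Rf₁ with hx' | hx'
    · exact (wFree_of_lt hx' hx.1).trans (wFree_mem_of_ge ⟨hy', hy.2⟩).1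
    · rw [wFree_of_ge hx', wFree_of_ge hy']
      exact M.compat_mono.monotoneOn ⟨hx', hx.2⟩ ⟨hy', hy.2⟩ hxy

/-- Both formulas give `Wc` at `Rf₁`; the constant in the lower branch is chosen for this. -/
theorem wFree_cont : ContinuousOn M.wFree (Set.Icc 0 M.Rf₂) := by
  have h1 : ContinuousOn M.wFree (Set.Icc 0 M.Rf₁) := by
    refine (continuousOn_const (c := M.Wc + M.vf M.Rf₁).sub
      (M.vf_cont.mono (Set.Icc_subset_Icc_right M.Rf₁_lt.le))).congr fun ρ hρ => ?_
    rw [Pi.sub_apply]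
    rcases hρ.2.eq_or_lt with rfl | h
    · rw [wFree_of_ge le_rfl, Wc]; ring
    · rw [wFree, if_pos h]
  have h2 : ContinuousOn M.wFree (Set.Icc M.Rf₁ M.Rf₂) :=
    M.vfp_cont.congr fun ρ hρ => wFree_of_ge hρ.1
  have := h1.union_of_isClosed h2 isClosed_Icc isClosed_Icc
  rwa [Set.Icc_union_Icc_eq_Icc M.Rf₁_pos.le M.Rf₁_lt.le] at this

variable (M)

/-- The second invariant of the congested states reached from `u`. -/
def wBar (u : ℝ × ℝ) : ℝ := max M.Wc (M.w₂ u)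

variable {M}

theorem OmegaF.wBar_mem {u : ℝ × ℝ} (h : u ∈ M.OmegaF) : M.wBar u ∈ Set.Icc M.Wc M.Wmax := by
  refine ⟨le_max_left _ _, max_le M.Wc_lt_Wmax.le ?_⟩
  rw [OmegaF.w₂_eq h]
  rcases lt_or_ge u.1 M.Rf₁ with h' | h'
  · exact (wFree_of_lt h' h.1.1).trans M.Wc_lt_Wmax.le
  · exact (wFree_mem_of_ge ⟨h', h.1.2⟩).2

theorem OmegaF.wBar_of_lt {u : ℝ × ℝ} (h : u ∈ M.OmegaF) (h' : u.1 < M.Rf₁) :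
    M.wBar u = M.Wc := by
  rw [wBar, OmegaF.w₂_eq h]
  exact max_eq_left (wFree_of_lt h' h.1.1)

theorem OmegaF.wBar_of_ge {u : ℝ × ℝ} (h : u ∈ M.OmegaF) (h' : M.Rf₁ ≤ u.1) :
    M.wBar u = M.w₂ u := by
  rw [wBar, OmegaF.w₂_eq h]
  exact max_eq_right (wFree_mem_of_ge ⟨h', h.1.2⟩).1

variable (M)

/-- The congested state of second invariant `w` and velocity `v`. -/
def cong (w v : ℝ) : ℝ × ℝ := (M.pInv (w - v), v)

variable {M}

/-- This places `w - v` in the range of `p`. The lower bound needs `Wc - Vc ≥ p Rf₁`, which holds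
because `Vc` is below `vf Rf₁`. -/
theorem sub_mem {w v : ℝ} (hw : w ∈ Set.Icc M.Wc M.Wmax) (hv : v ∈ Set.Icc 0 M.Vc) :
    w - v ∈ Set.Icc (M.p M.Rf₁) M.Wmax := by
  have h1 := M.Vc_lt_vf M.Rf₁_mem
  have h2 := hw.1
  have h3 := hw.2
  rw [Wc] at h2
  exact ⟨by linarith [hv.2], by linarith [hv.1]⟩

theorem p_cong {w v : ℝ} (hw : w ∈ Set.Icc M.Wc M.Wmax) (hv : v ∈ Set.Icc 0 M.Vc) :
    M.p (M.cong w v).1 = w - v := M.p_pInv (sub_mem hw hv)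

theorem cong_mem {w v : ℝ} (hw : w ∈ Set.Icc M.Wc M.Wmax) (hv : v ∈ Set.Icc 0 M.Vc) :
    M.cong w v ∈ M.OmegaC := by
  refine ⟨M.pInv_mem (sub_mem hw hv), hv, ?_⟩
  rw [p_cong hw hv]
  simpa [cong] using hw

theorem w₂_cong {w v : ℝ} (hw : w ∈ Set.Icc M.Wc M.Wmax) (hv : v ∈ Set.Icc 0 M.Vc) :
    M.w₂ (M.cong w v) = w := by
  rw [OmegaC.w₂_eq (cong_mem hw hv), p_cong hw hv]
  simp [cong]

theorem OmegaC.cong_eq {u : ℝ × ℝ} (h : u ∈ M.OmegaC) : M.cong (M.w₂ u) u.2 = u := by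
  rw [OmegaC.w₂_eq h, cong, add_sub_cancel_left, M.pInv_p h.1]

theorem OmegaC.fluxC_eq {u : ℝ × ℝ} (h : u ∈ M.OmegaC) :
    M.fluxC (M.w₂ u) u.1 = u.1 * u.2 := by
  rw [fluxC, OmegaC.w₂_eq h, add_sub_cancel_right]

theorem OmegaF.fluxF_eq {u : ℝ × ℝ} (h : u ∈ M.OmegaF) : M.fluxF u.1 = u.1 * u.2 := by
  rw [fluxF, h.2.2]

theorem Vc_mem : M.Vc ∈ Set.Icc 0 M.Vc := ⟨M.Vc_pos.le, le_rfl⟩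

/-- Density is decreasing in velocity along a curve of constant second invariant. -/
theorem OmegaC.lt_iff {u u' : ℝ × ℝ} (h : u ∈ M.OmegaC) (h' : u' ∈ M.OmegaC)
    (hw : M.w₂ u = M.w₂ u') : u.1 < u'.1 ↔ u'.2 < u.2 := by
  rw [← M.p_lt_p h.1.1 h'.1.1]
  rw [OmegaC.w₂_eq h, OmegaC.w₂_eq h'] at hw
  constructor <;> intro <;> linarith

/-! ### The solvers in terms of scalar Lax solutions -/

variable (M)

/-- Density of the Lax solution of LWR. -/
def laxF (a b ξ : ℝ) : ℝ := lax a b (chord M.fluxF a b) (fan M.lamF M.Rf₂ 0 ξ) ξ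

/-- Density of the Lax 1-wave of ARZ along the curve of second invariant `w`. -/
def laxC (w a b ξ : ℝ) : ℝ :=
  lax a b (chord (M.fluxC w) a b) (fan (M.lam₁ w) M.Rmax M.Rf₁ ξ) ξ

variable {M}

theorem sigma_eq_chord {f : ℝ → ℝ} {u u' : ℝ × ℝ} (h : f u.1 = u.1 * u.2)
    (h' : f u'.1 = u'.1 * u'.2) : sigma u u' = chord f u.1 u'.1 := by
  rw [sigma, chord, h, h']

theorem sigma_comm (u u' : ℝ × ℝ) : sigma u u' = sigma u' u := by
  rw [sigma, sigma, ← neg_sub, ← neg_sub u.1, neg_div_neg_eq]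

/-- The Rankine-Hugoniot speed is a chord slope of `fluxF`, and the fan between the data is the
clamp of the fan on the whole density interval. All properties of LWR are then read off the scalar
Lax solution; `OmegaC.wave₁_eq` plays the same role for 1-waves. -/
theorem OmegaF.RLWR_eq {uℓ ur : ℝ × ℝ} (hℓ : uℓ ∈ M.OmegaF) (hr : ur ∈ M.OmegaF) (ξ : ℝ) :
    M.RLWR uℓ ur ξ = (M.laxF uℓ.1 ur.1 ξ, M.vf (M.laxF uℓ.1 ur.1 ξ)) := by
  rw [RLWR, laxF, lax, sigma_eq_chord (OmegaF.fluxF_eq hℓ) (OmegaF.fluxF_eq hr)]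
  split_ifs with h h'
  · exact (OmegaF.eq_mk hℓ).symm
  · exact (OmegaF.eq_mk hr).symm
  · rw [fan_eq_clamp M.isConcaveFlux_fluxF.anti hr.1.1 (not_lt.1 h) hℓ.1.2]

theorem OmegaC.wave₁_eq {uℓ um : ℝ × ℝ} (hℓ : uℓ ∈ M.OmegaC) (hm : um ∈ M.OmegaC)
    (hw : M.w₂ uℓ = M.w₂ um) (ξ : ℝ) :
    M.wave₁ uℓ um ξ = (M.laxC (M.w₂ uℓ) uℓ.1 um.1 ξ,
      M.w₂ uℓ - M.p (M.laxC (M.w₂ uℓ) uℓ.1 um.1 ξ)) := by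
  have hm' : M.fluxC (M.w₂ uℓ) um.1 = um.1 * um.2 := by rw [hw]; exact OmegaC.fluxC_eq hm
  rw [wave₁, laxC, lax, sigma_eq_chord (OmegaC.fluxC_eq hℓ) hm']
  simp only [← OmegaC.lt_iff hℓ hm hw]
  split_ifs with h h'
  · ext
    · rfl
    · rw [OmegaC.w₂_eq hℓ]; simp
  · ext
    · rfl
    · rw [hw, OmegaC.w₂_eq hm]; simp
  · rw [fan_eq_clamp (M.isConcaveFlux_fluxC _).anti hm.1.1 (not_lt.1 h) hℓ.1.2]

/-- States of the curve `v + p(ρ) = w` between congested states are congested. -/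
theorem curve_mem {w : ℝ} (hw : w ∈ Set.Icc M.Wc M.Wmax) {ρ : ℝ}
    (hρ : ρ ∈ Set.Icc M.Rf₁ M.Rmax) (hv : w - M.p ρ ∈ Set.Icc 0 M.Vc) :
    (ρ, w - M.p ρ) ∈ M.OmegaC ∧ M.w₂ (ρ, w - M.p ρ) = w := by
  have h : (ρ, w - M.p ρ) ∈ M.OmegaC := ⟨hρ, hv, by simpa using hw⟩
  exact ⟨h, by rw [OmegaC.w₂_eq h]; simp⟩

/-- The velocity `w - p(ρ)` is monotone along the curve, so it stays between the two given
velocities and hence in `[0, Vc]`. -/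
theorem OmegaC.mem_of_between {u u' : ℝ × ℝ} (h : u ∈ M.OmegaC) (h' : u' ∈ M.OmegaC)
    (hw : M.w₂ u = M.w₂ u') {ρ : ℝ} (hρ : ρ ∈ Set.Icc (min u.1 u'.1) (max u.1 u'.1)) :
    (ρ, M.w₂ u - M.p ρ) ∈ M.OmegaC ∧ M.w₂ (ρ, M.w₂ u - M.p ρ) = M.w₂ u := by
  have hI : ρ ∈ Set.Icc M.Rf₁ M.Rmax :=
    ⟨(le_min h.1.1 h'.1.1).trans hρ.1, hρ.2.trans (max_le h.1.2 h'.1.2)⟩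
  refine curve_mem (OmegaC.w₂_mem h) hI ⟨?_, ?_⟩
  · rcases le_max_iff.1 hρ.2 with h1 | h1
    · rw [OmegaC.w₂_eq h]
      linarith [(M.p_le_p hI.1 h.1.1).2 h1, h.2.1.1]
    · rw [hw, OmegaC.w₂_eq h']
      linarith [(M.p_le_p hI.1 h'.1.1).2 h1, h'.2.1.1]
  · rcases min_le_iff.1 hρ.1 with h1 | h1
    · rw [OmegaC.w₂_eq h]
      linarith [(M.p_le_p h.1.1 hI.1).2 h1, h.2.1.2]
    · rw [hw, OmegaC.w₂_eq h']
      linarith [(M.p_le_p h'.1.1 hI.1).2 h1, h'.2.1.2]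

theorem OmegaC.wave₁_mem {uℓ um : ℝ × ℝ} (hℓ : uℓ ∈ M.OmegaC) (hm : um ∈ M.OmegaC)
    (hw : M.w₂ uℓ = M.w₂ um) (ξ : ℝ) :
    M.wave₁ uℓ um ξ ∈ M.OmegaC ∧ M.w₂ (M.wave₁ uℓ um ξ) = M.w₂ uℓ := by
  rw [OmegaC.wave₁_eq hℓ hm hw]
  exact OmegaC.mem_of_between hℓ hm hw (lax_between _ _ _ _ _)

theorem OmegaC.midARZ_mem {uℓ ur : ℝ × ℝ} (hℓ : uℓ ∈ M.OmegaC) (hr : ur ∈ M.OmegaC) :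
    M.midARZ uℓ ur ∈ M.OmegaC := cong_mem (OmegaC.w₂_mem hℓ) hr.2.1

theorem OmegaC.w₂_midARZ {uℓ ur : ℝ × ℝ} (hℓ : uℓ ∈ M.OmegaC) (hr : ur ∈ M.OmegaC) :
    M.w₂ (M.midARZ uℓ ur) = M.w₂ uℓ := w₂_cong (OmegaC.w₂_mem hℓ) hr.2.1

theorem OmegaC.RARZ_mem {uℓ ur : ℝ × ℝ} (hℓ : uℓ ∈ M.OmegaC) (hr : ur ∈ M.OmegaC) (ξ : ℝ) :
    M.RARZ uℓ ur ξ ∈ M.OmegaC := by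
  unfold RARZ
  split_ifs
  · exact (OmegaC.wave₁_mem hℓ (OmegaC.midARZ_mem hℓ hr) (OmegaC.w₂_midARZ hℓ hr).symm ξ).1
  · exact hr

theorem OmegaF.laxF_mem {uℓ ur : ℝ × ℝ} (hℓ : uℓ ∈ M.OmegaF) (hr : ur ∈ M.OmegaF) (ξ : ℝ) :
    M.laxF uℓ.1 ur.1 ξ ∈ Set.Icc 0 M.Rf₂ := lax_mem _ _ _ hℓ.1 hr.1

theorem OmegaF.RLWR_mem {uℓ ur : ℝ × ℝ} (hℓ : uℓ ∈ M.OmegaF) (hr : ur ∈ M.OmegaF) (ξ : ℝ) :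
    M.RLWR uℓ ur ξ ∈ M.OmegaF := by
  rw [OmegaF.RLWR_eq hℓ hr]
  exact M.free_mem (OmegaF.laxF_mem hℓ hr ξ)

theorem OmegaF.midFC_mem {uℓ ur : ℝ × ℝ} (hℓ : uℓ ∈ M.OmegaF) (hr : ur ∈ M.OmegaC) :
    M.midFC uℓ ur ∈ M.OmegaC := cong_mem (OmegaF.wBar_mem hℓ) hr.2.1

theorem OmegaF.w₂_midFC {uℓ ur : ℝ × ℝ} (hℓ : uℓ ∈ M.OmegaF) (hr : ur ∈ M.OmegaC) :
    M.w₂ (M.midFC uℓ ur) = M.wBar uℓ := w₂_cong (OmegaF.wBar_mem hℓ) hr.2.1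

theorem OmegaC.midCF₁_mem {uℓ : ℝ × ℝ} (hℓ : uℓ ∈ M.OmegaC) : M.midCF₁ uℓ ∈ M.OmegaC :=
  cong_mem (OmegaC.w₂_mem hℓ) Vc_mem

theorem OmegaC.w₂_midCF₁ {uℓ : ℝ × ℝ} (hℓ : uℓ ∈ M.OmegaC) : M.w₂ (M.midCF₁ uℓ) = M.w₂ uℓ :=
  w₂_cong (OmegaC.w₂_mem hℓ) Vc_mem

theorem OmegaC.midCF₂_mem {uℓ : ℝ × ℝ} (hℓ : uℓ ∈ M.OmegaC) : M.midCF₂ uℓ ∈ M.OmegaF :=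
  M.free_mem (M.rhoF_mem_free (OmegaC.w₂_mem hℓ))

theorem OmegaC.w₂_midCF₂ {uℓ : ℝ × ℝ} (hℓ : uℓ ∈ M.OmegaC) : M.w₂ (M.midCF₂ uℓ) = M.w₂ uℓ := by
  rw [OmegaF.w₂_eq (OmegaC.midCF₂_mem hℓ)]
  exact (wFree_of_ge (M.rhoF_mem (OmegaC.w₂_mem hℓ)).1).trans (M.rhoF_spec (OmegaC.w₂_mem hℓ))

/-! ### The four cases of the solver -/

theorem R_free_free {uℓ ur : ℝ × ℝ} (hℓ : uℓ ∈ M.OmegaF) (hr : ur ∈ M.OmegaF) (ξ : ℝ) :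
    M.R uℓ ur ξ = M.RLWR uℓ ur ξ := by rw [R, if_pos hℓ, if_pos hr]

theorem R_cong_cong {uℓ ur : ℝ × ℝ} (hℓ : uℓ ∈ M.OmegaC) (hr : ur ∈ M.OmegaC) (ξ : ℝ) :
    M.R uℓ ur ξ = M.RARZ uℓ ur ξ := by
  rw [R, if_neg (notMem_OmegaF hℓ), if_neg (notMem_OmegaF hr)]

theorem R_free_cong {uℓ ur : ℝ × ℝ} (hℓ : uℓ ∈ M.OmegaF) (hr : ur ∈ M.OmegaC) (ξ : ℝ) :
    M.R uℓ ur ξ =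
      if ξ < sigma uℓ (M.midFC uℓ ur) then uℓ else M.RARZ (M.midFC uℓ ur) ur ξ := by
  rw [R, if_pos hℓ, if_neg (notMem_OmegaF hr)]

theorem R_cong_free {uℓ ur : ℝ × ℝ} (hℓ : uℓ ∈ M.OmegaC) (hr : ur ∈ M.OmegaF) (ξ : ℝ) :
    M.R uℓ ur ξ = if ξ < sigma (M.midCF₁ uℓ) (M.midCF₂ uℓ) then M.RARZ uℓ (M.midCF₁ uℓ) ξ
      else M.RLWR (M.midCF₂ uℓ) ur ξ := by
  rw [R, if_neg (notMem_OmegaF hℓ), if_pos hr]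

theorem R_mem {uℓ ur : ℝ × ℝ} (hℓ : uℓ ∈ M.Omega) (hr : ur ∈ M.Omega) (ξ : ℝ) :
    M.R uℓ ur ξ ∈ M.Omega := by
  rcases hℓ with hℓ | hℓ <;> rcases hr with hr | hr
  · rw [R_free_free hℓ hr]
    exact Or.inl (OmegaF.RLWR_mem hℓ hr ξ)
  · rw [R_free_cong hℓ hr]
    split_ifs
    · exact Or.inl hℓ
    · exact Or.inr (OmegaC.RARZ_mem (OmegaF.midFC_mem hℓ hr) hr ξ)
  · rw [R_cong_free hℓ hr]
    split_ifs
    · exact Or.inr (OmegaC.RARZ_mem hℓ (OmegaC.midCF₁_mem hℓ) ξ)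
    · exact Or.inl (OmegaF.RLWR_mem (OmegaC.midCF₂_mem hℓ) hr ξ)
  · rw [R_cong_cong hℓ hr]
    exact Or.inr (OmegaC.RARZ_mem hℓ hr ξ)

end

end TwoPhase

namespace IsConcaveFlux

variable {f lam : ℝ → ℝ} {A B : ℝ}

/-- The bound `x₀ < lam z` for `z < m` passes to the limit `z → m`, by continuity of `lam`, when the
wave is a rarefaction; for a shock the chord is compared with the tangent at `m`. -/
theorem le_speed_of_lax_eq_left (hf : IsConcaveFlux f lam A B) {b m x₀ : ℝ}
    (hm : m ∈ Set.Icc A B) (hb : b ∈ Set.Icc A B) (hmb : m ≠ b)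
    (h : lax m b (chord f m b) (TwoPhase.fan lam B A x₀) x₀ = m) : x₀ ≤ lam m := by
  rcases lt_or_gt_of_ne hmb with h1 | h1
  · rw [lax, if_pos h1] at h
    split_ifs at h with h2
    · exact h2.le.trans (hf.chord_le_speed hm hb h1)
    · exact absurd h.symm hmb
  · have hsub : Set.Ioo b m ⊆ Set.Icc A B := fun x hx => ⟨hb.1.trans hx.1.le, hx.2.le.trans hm.2⟩
    have ht : Tendsto lam (𝓝[Set.Ioo b m] m) (𝓝 (lam m)) := (hf.cont m hm).mono hsub
    have : (𝓝[Set.Ioo b m] m).NeBot := by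
      rw [nhdsWithin_Ioo_eq_nhdsLT h1]; infer_instance
    refine ge_of_tendsto ht ?_
    filter_upwards [self_mem_nhdsWithin] with x hx
    exact (hf.speed_of_lax_eq_left hm hb hmb h (hsub hx) hx.2).le

end IsConcaveFlux

namespace TwoPhase

noncomputable section

open Classical

variable {M : TwoPhase}

/-! ### Wave speeds -/

theorem lam₁_lt_chord {w x y : ℝ} (hx : x ∈ Set.Icc M.Rf₁ M.Rmax) (hy : y ∈ Set.Icc M.Rf₁ M.Rmax)
    (hxy : x < y) : M.lam₁ w y < chord (M.fluxC w) x y ∧ chord (M.fluxC w) x y < M.lam₁ w x := by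
  obtain ⟨z, hz, h⟩ := (M.isConcaveFlux_fluxC w).exists_chord hx hy hxy
  rw [h]
  exact ⟨M.lam₁_strictAnti w (hx.1.trans hz.1.le) hy.1 hz.2,
    M.lam₁_strictAnti w hx.1 (hx.1.trans hz.1.le) hz.1⟩

theorem rhoF_mem_cong {w : ℝ} (hw : w ∈ Set.Icc M.Wc M.Wmax) :
    M.rhoF w ∈ Set.Icc M.Rf₁ M.Rmax :=
  ⟨(M.rhoF_mem hw).1, (M.rhoF_mem hw).2.trans M.Rf₂_lt_Rmax.le⟩

/-- The capacity drop. -/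
theorem lam₁_rhoF_neg {w : ℝ} (hw : w ∈ Set.Icc M.Wc M.Wmax) : M.lam₁ w (M.rhoF w) < 0 := by
  have h1 := M.compat_drop _ (M.rhoF_mem hw)
  have h2 := M.rhoF_spec hw
  rw [lam₁]
  linarith

theorem fluxC_rhoF {w : ℝ} (hw : w ∈ Set.Icc M.Wc M.Wmax) :
    M.fluxC w (M.rhoF w) = M.rhoF w * M.vf (M.rhoF w) := by
  rw [fluxC, ← eq_sub_iff_add_eq.2 (M.rhoF_spec hw)]

/-- Both states satisfy `v + p = w`, and the free one is faster than `Vc`; its pressure is therefore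
smaller. -/
theorem rhoF_lt {w : ℝ} (hw : w ∈ Set.Icc M.Wc M.Wmax) {c : ℝ × ℝ} (hc : c ∈ M.OmegaC)
    (hcw : M.w₂ c = w) : M.rhoF w < c.1 := by
  rw [← M.p_lt_p (M.rhoF_mem hw).1 hc.1.1]
  have h1 := M.rhoF_spec hw
  have h2 := M.Vc_lt_vf (M.rhoF_mem_free hw)
  rw [OmegaC.w₂_eq hc] at hcw
  linarith [hc.2.1.2]

/-- By concavity the chord lies below the tangent at `rhoF w`, whose slope is negative by the
capacity drop. -/
theorem chord_rhoF_neg {w : ℝ} (hw : w ∈ Set.Icc M.Wc M.Wmax) {c : ℝ × ℝ} (hc : c ∈ M.OmegaC)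
    (hcw : M.w₂ c = w) : chord (M.fluxC w) (M.rhoF w) c.1 < 0 :=
  (lam₁_lt_chord (rhoF_mem_cong hw) hc.1 (rhoF_lt hw hc hcw)).2.trans (lam₁_rhoF_neg hw)

/-- Equality holds as soon as `Rf₁ ≤ u.1`, since `u` is then itself the free state on its curve. -/
theorem OmegaF.le_rhoF {u : ℝ × ℝ} (hu : u ∈ M.OmegaF) : u.1 ≤ M.rhoF (M.wBar u) := by
  rcases lt_or_ge u.1 M.Rf₁ with h | h
  · exact h.le.trans (M.rhoF_mem (OmegaF.wBar_mem hu)).1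
  · rw [OmegaF.wBar_of_ge hu h, OmegaF.w₂_eq hu, wFree_of_ge h, M.rhoF_eq ⟨h, hu.1.2⟩]

theorem OmegaF.lt_of_w₂_eq {u c : ℝ × ℝ} (hu : u ∈ M.OmegaF) (hc : c ∈ M.OmegaC)
    (hcw : M.w₂ c = M.wBar u) : u.1 < c.1 :=
  (OmegaF.le_rhoF hu).trans_lt (rhoF_lt (OmegaF.wBar_mem hu) hc hcw)

/-- Speed of a phase transition from the free to the congested phase. -/
theorem OmegaF.sigma_bounds {u c : ℝ × ℝ} (hu : u ∈ M.OmegaF) (hc : c ∈ M.OmegaC)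
    (hcw : M.w₂ c = M.wBar u) :
    chord (M.fluxC (M.wBar u)) (M.rhoF (M.wBar u)) c.1 ≤ sigma u c ∧
      sigma u c < M.lamF u.1 := by
  have hw := OmegaF.wBar_mem hu
  set w := M.wBar u
  set r := M.rhoF w
  have hur : u.1 ≤ r := OmegaF.le_rhoF hu
  have hrc : r < c.1 := rhoF_lt hw hc hcw
  have hneg := chord_rhoF_neg hw hc hcw
  have hpos := M.lamF_pos hu.1
  have hden : 0 < c.1 - u.1 := by linarith
  have e1 : M.fluxC w c.1 - M.fluxC w r = chord (M.fluxC w) r c.1 * (c.1 - r) := by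
    rw [chord, div_mul_cancel₀ _ (sub_pos.2 hrc).ne']
  have e2 : M.fluxC w c.1 = c.1 * c.2 := by rw [← OmegaC.fluxC_eq hc, hcw]
  have e3 : M.fluxC w r = M.fluxF r := fluxC_rhoF hw
  have e4 := OmegaF.fluxF_eq hu
  have e5 : 0 ≤ M.fluxF r - M.fluxF u.1 ∧ M.fluxF r - M.fluxF u.1 ≤ M.lamF u.1 * (r - u.1) := by
    rcases hur.eq_or_lt with h | h
    · rw [← h]; simp
    · have hr := M.rhoF_mem_free hw
      obtain ⟨z, hz, he⟩ := M.isConcaveFlux_fluxF.exists_speed hu.1 hr h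
      have hz' : z ∈ Set.Icc 0 M.Rf₂ := ⟨hu.1.1.trans hz.1.le, hz.2.le.trans hr.2⟩
      rw [he]
      exact ⟨mul_nonneg (M.lamF_pos hz').le (by linarith), mul_le_mul_of_nonneg_right
        (M.isConcaveFlux_fluxF.anti hu.1 hz' hz.1.le) (by linarith)⟩
  -- The jump from `u` to `c` is cut at the free state of density `r`: a decreasing chord of
  -- `fluxC`, then an increment of `fluxF` between `0` and `lamF u.1 * (r - u.1)`. Each sign gives
  -- one of the two bounds.
  have e6 : c.1 * c.2 - u.1 * u.2 =
      chord (M.fluxC w) r c.1 * (c.1 - r) + (M.fluxF r - M.fluxF u.1) := by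
    rw [← e1, e2, e3, ← e4]; ring
  rw [sigma, le_div_iff₀ hden, div_lt_iff₀ hden, e6]
  constructor
  · nlinarith [mul_nonneg (neg_nonneg.2 hneg.le) (sub_nonneg.2 hur)]
  · nlinarith [mul_pos (neg_pos.2 hneg) (sub_pos.2 hrc), mul_pos hpos (sub_pos.2 hrc)]

/-- A jump to a larger density and a smaller velocity is not faster than the final velocity. -/
theorem sigma_le {u c : ℝ × ℝ} (h0 : 0 ≤ u.1) (h : u.1 < c.1) (hv : c.2 ≤ u.2) :
    sigma u c ≤ c.2 := by
  rw [sigma, div_le_iff₀ (sub_pos.2 h)]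
  nlinarith [mul_le_mul_of_nonneg_left hv h0]

theorem sigma_lt {u c : ℝ × ℝ} (h0 : 0 < u.1) (h : u.1 < c.1) (hv : c.2 < u.2) :
    sigma u c < c.2 := by
  rw [sigma, div_lt_iff₀ (sub_pos.2 h)]
  nlinarith [mul_lt_mul_of_pos_left hv h0]

theorem sigma_of_eq_zero {u c : ℝ × ℝ} (h0 : u.1 = 0) (h : c.1 ≠ 0) : sigma u c = c.2 := by
  rw [sigma, h0]
  simp [h]

theorem OmegaC.pos {u : ℝ × ℝ} (hu : u ∈ M.OmegaC) : 0 < u.1 := M.Rf₁_pos.trans_le hu.1.1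

theorem OmegaF.sigma_midFC_le {uℓ ur : ℝ × ℝ} (hℓ : uℓ ∈ M.OmegaF) (hr : ur ∈ M.OmegaC) :
    sigma uℓ (M.midFC uℓ ur) ≤ ur.2 :=
  sigma_le hℓ.1.1 (OmegaF.lt_of_w₂_eq hℓ (OmegaF.midFC_mem hℓ hr) (OmegaF.w₂_midFC hℓ hr))
    (hr.2.1.2.trans (Vc_lt_of_mem hℓ).le)

theorem OmegaC.sigma_midCF {uℓ : ℝ × ℝ} (hℓ : uℓ ∈ M.OmegaC) :
    sigma (M.midCF₁ uℓ) (M.midCF₂ uℓ) =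
      chord (M.fluxC (M.w₂ uℓ)) (M.rhoF (M.w₂ uℓ)) (M.midCF₁ uℓ).1 := by
  have h : M.fluxC (M.w₂ uℓ) (M.midCF₁ uℓ).1 = (M.midCF₁ uℓ).1 * (M.midCF₁ uℓ).2 := by
    rw [← OmegaC.fluxC_eq (OmegaC.midCF₁_mem hℓ), OmegaC.w₂_midCF₁ hℓ]
  rw [sigma_comm]
  exact sigma_eq_chord (f := M.fluxC (M.w₂ uℓ)) (u := M.midCF₂ uℓ)
    (fluxC_rhoF (OmegaC.w₂_mem hℓ)) h

theorem OmegaC.sigma_midCF_neg {uℓ : ℝ × ℝ} (hℓ : uℓ ∈ M.OmegaC) :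
    sigma (M.midCF₁ uℓ) (M.midCF₂ uℓ) < 0 := by
  rw [OmegaC.sigma_midCF hℓ]
  exact chord_rhoF_neg (OmegaC.w₂_mem hℓ) (OmegaC.midCF₁_mem hℓ) (OmegaC.w₂_midCF₁ hℓ)

/-- The transition speed is a chord of a strictly concave flux with its right end at `midCF₁`, so it
exceeds the tangent slope there: the 1-wave is completed strictly before the transition. -/
theorem OmegaC.lam₁_lt_sigma_midCF {uℓ : ℝ × ℝ} (hℓ : uℓ ∈ M.OmegaC) :
    M.lam₁ (M.w₂ uℓ) (M.midCF₁ uℓ).1 < sigma (M.midCF₁ uℓ) (M.midCF₂ uℓ) := by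
  rw [OmegaC.sigma_midCF hℓ]
  exact (lam₁_lt_chord (rhoF_mem_cong (OmegaC.w₂_mem hℓ)) (OmegaC.midCF₁_mem hℓ).1
    (rhoF_lt (OmegaC.w₂_mem hℓ) (OmegaC.midCF₁_mem hℓ) (OmegaC.w₂_midCF₁ hℓ))).1

/-- The 1-wave of ARZ is completed before the contact discontinuity. -/
theorem OmegaC.wave₁_eq_right {uℓ um : ℝ × ℝ} (hℓ : uℓ ∈ M.OmegaC) (hm : um ∈ M.OmegaC)
    (hw : M.w₂ uℓ = M.w₂ um) {ξ : ℝ} (h1 : uℓ.1 < um.1 → sigma uℓ um ≤ ξ)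
    (h2 : um.1 ≤ uℓ.1 → M.lam₁ (M.w₂ uℓ) um.1 ≤ ξ) : M.wave₁ uℓ um ξ = um := by
  have hm' : M.fluxC (M.w₂ uℓ) um.1 = um.1 * um.2 := by rw [hw]; exact OmegaC.fluxC_eq hm
  rw [sigma_eq_chord (OmegaC.fluxC_eq hℓ) hm'] at h1
  have : M.laxC (M.w₂ uℓ) uℓ.1 um.1 ξ = um.1 := IsConcaveFlux.lax_eq_right hm.1 h1 h2
  rw [OmegaC.wave₁_eq hℓ hm hw, this, hw, OmegaC.w₂_eq hm]
  simp

/-- Waves of the first family are slower than the final velocity: `lam₁ < v`, and a shock from a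
positive density into slower, denser traffic is overtaken by that traffic. -/
theorem OmegaC.wave₁_of_le {uℓ um : ℝ × ℝ} (hℓ : uℓ ∈ M.OmegaC) (hm : um ∈ M.OmegaC)
    (hw : M.w₂ uℓ = M.w₂ um) {ξ : ℝ} (hξ : um.2 ≤ ξ) : M.wave₁ uℓ um ξ = um := by
  refine OmegaC.wave₁_eq_right hℓ hm hw (fun h => ?_) fun _ => ?_
  · exact (sigma_lt (OmegaC.pos hℓ) h ((OmegaC.lt_iff hℓ hm hw).1 h)).le.trans hξ
  · refine (M.lam₁_lt hm.1.1).le.trans ?_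
    rw [hw, OmegaC.w₂_eq hm]
    simpa using hξ

theorem OmegaC.wave₁_self {u : ℝ × ℝ} (hu : u ∈ M.OmegaC) (ξ : ℝ) : M.wave₁ u u ξ = u := by
  rw [OmegaC.wave₁_eq hu hu rfl, laxC, lax_self, OmegaC.w₂_eq hu]
  simp

theorem OmegaC.midARZ_eq {uℓ um : ℝ × ℝ} (hm : um ∈ M.OmegaC) (hw : M.w₂ uℓ = M.w₂ um) :
    M.midARZ uℓ um = um := by
  change M.cong (M.w₂ uℓ) um.2 = um
  rw [hw, OmegaC.cong_eq hm]

theorem OmegaC.RARZ_eq_wave₁ {uℓ um : ℝ × ℝ} (hℓ : uℓ ∈ M.OmegaC) (hm : um ∈ M.OmegaC)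
    (hw : M.w₂ uℓ = M.w₂ um) (ξ : ℝ) : M.RARZ uℓ um ξ = M.wave₁ uℓ um ξ := by
  rw [RARZ, OmegaC.midARZ_eq hm hw]
  split_ifs with h
  · rfl
  · exact (OmegaC.wave₁_of_le hℓ hm hw (not_lt.1 h)).symm

theorem OmegaC.RARZ_self {u : ℝ × ℝ} (hu : u ∈ M.OmegaC) (ξ : ℝ) : M.RARZ u u ξ = u := by
  rw [OmegaC.RARZ_eq_wave₁ hu hu rfl, OmegaC.wave₁_self hu]

/-- A contact discontinuity of ARZ. -/
theorem OmegaC.RARZ_contact {u ur : ℝ × ℝ} (hu : u ∈ M.OmegaC) (hv : u.2 = ur.2) (ξ : ℝ) :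
    M.RARZ u ur ξ = if ξ < ur.2 then u else ur := by
  have : M.midARZ u ur = u := by
    change M.cong (M.w₂ u) ur.2 = u
    rw [← hv, OmegaC.cong_eq hu]
  rw [RARZ, this, OmegaC.wave₁_self hu]

theorem OmegaF.RLWR_self {u : ℝ × ℝ} (hu : u ∈ M.OmegaF) (ξ : ℝ) : M.RLWR u u ξ = u := by
  rw [OmegaF.RLWR_eq hu hu, laxF, lax_self, OmegaF.eq_mk hu]

/-! ### Splitting and merging for LWR and ARZ -/

theorem OmegaF.RLWR_split {uℓ um ur : ℝ × ℝ} (hℓ : uℓ ∈ M.OmegaF) (hr : ur ∈ M.OmegaF) {x₀ : ℝ}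
    (h : M.RLWR uℓ ur x₀ = um) (x : ℝ) :
    M.RLWR uℓ um x = (if x ≤ x₀ then M.RLWR uℓ ur x else um) ∧
    M.RLWR um ur x = (if x < x₀ then um else M.RLWR uℓ ur x) := by
  have hm : um ∈ M.OmegaF := h ▸ OmegaF.RLWR_mem hℓ hr x₀
  rw [OmegaF.RLWR_eq hℓ hm, OmegaF.RLWR_eq hm hr, OmegaF.RLWR_eq hℓ hr]
  rw [OmegaF.RLWR_eq hℓ hr] at h
  obtain ⟨h1, h2⟩ := IsConcaveFlux.lax_split (fan_antitone (lam := M.lamF) M.Rf₂_pos.le)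
    (chord M.fluxF) (congrArg Prod.fst h) x
  change M.laxF uℓ.1 um.1 x = (if x ≤ x₀ then M.laxF uℓ.1 ur.1 x else um.1) at h1
  change M.laxF um.1 ur.1 x = (if x < x₀ then um.1 else M.laxF uℓ.1 ur.1 x) at h2
  rw [h1, h2]
  constructor
  · split_ifs
    · rfl
    · exact OmegaF.eq_mk hm
  · split_ifs
    · exact OmegaF.eq_mk hm
    · rfl

theorem OmegaF.RLWR_merge {uℓ um ur : ℝ × ℝ} (hℓ : uℓ ∈ M.OmegaF) (hm : um ∈ M.OmegaF)
    (hr : ur ∈ M.OmegaF) {x₀ : ℝ} (h1 : M.RLWR uℓ um x₀ = um) (h2 : M.RLWR um ur x₀ = um)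
    (x : ℝ) : M.RLWR uℓ ur x = if x < x₀ then M.RLWR uℓ um x else M.RLWR um ur x := by
  rw [OmegaF.RLWR_eq hℓ hm] at h1 ⊢
  rw [OmegaF.RLWR_eq hm hr] at h2 ⊢
  rw [OmegaF.RLWR_eq hℓ hr, laxF, M.isConcaveFlux_fluxF.lax_merge hℓ.1 hm.1 hr.1
    (congrArg Prod.fst h1) (congrArg Prod.fst h2)]
  split_ifs <;> rfl

theorem OmegaC.wave₁_split {uℓ um ur : ℝ × ℝ} (hℓ : uℓ ∈ M.OmegaC) (hr : ur ∈ M.OmegaC)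
    (hw : M.w₂ uℓ = M.w₂ ur) {x₀ : ℝ} (h : M.wave₁ uℓ ur x₀ = um) (x : ℝ) :
    M.wave₁ uℓ um x = (if x ≤ x₀ then M.wave₁ uℓ ur x else um) ∧
    M.wave₁ um ur x = (if x < x₀ then um else M.wave₁ uℓ ur x) := by
  obtain ⟨hm, hmw⟩ := OmegaC.wave₁_mem hℓ hr hw x₀
  rw [h] at hm hmw
  have hu : um = (um.1, M.w₂ uℓ - M.p um.1) := by
    rw [← hmw, OmegaC.w₂_eq hm]; simp
  rw [OmegaC.wave₁_eq hℓ hm hmw.symm, OmegaC.wave₁_eq hm hr (hmw.trans hw),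
    OmegaC.wave₁_eq hℓ hr hw, hmw]
  rw [OmegaC.wave₁_eq hℓ hr hw] at h
  obtain ⟨h1, h2⟩ := IsConcaveFlux.lax_split
    (fan_antitone (lam := M.lam₁ (M.w₂ uℓ)) M.Rmax_ge)
    (chord (M.fluxC (M.w₂ uℓ))) (congrArg Prod.fst h) x
  change M.laxC (M.w₂ uℓ) uℓ.1 um.1 x = (if x ≤ x₀ then M.laxC (M.w₂ uℓ) uℓ.1 ur.1 x else um.1)
    at h1
  change M.laxC (M.w₂ uℓ) um.1 ur.1 x = (if x < x₀ then um.1 else M.laxC (M.w₂ uℓ) uℓ.1 ur.1 x)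
    at h2
  rw [h1, h2]
  constructor
  · split_ifs
    · rfl
    · exact hu.symm
  · split_ifs
    · exact hu.symm
    · rfl

/-- Before the contact, `um` lies on the 1-wave and has the second invariant of `uℓ`, so the
intermediate state seen from `um` is the same. From the contact on, `um` is `ur`. -/
theorem OmegaC.RARZ_split {uℓ um ur : ℝ × ℝ} (hℓ : uℓ ∈ M.OmegaC) (hr : ur ∈ M.OmegaC) {x₀ : ℝ}
    (h : M.RARZ uℓ ur x₀ = um) (x : ℝ) :
    M.RARZ uℓ um x = (if x ≤ x₀ then M.RARZ uℓ ur x else um) ∧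
    M.RARZ um ur x = (if x < x₀ then um else M.RARZ uℓ ur x) := by
  rcases lt_or_ge x₀ ur.2 with hx₀ | hx₀
  · have hmid := OmegaC.midARZ_mem hℓ hr
    have hmidw := OmegaC.w₂_midARZ hℓ hr
    rw [RARZ, if_pos hx₀] at h
    obtain ⟨hm, hmw⟩ := OmegaC.wave₁_mem hℓ hmid hmidw.symm x₀
    rw [h] at hm hmw
    obtain ⟨h1, h2⟩ := OmegaC.wave₁_split hℓ hmid hmidw.symm h x
    constructor
    · rw [OmegaC.RARZ_eq_wave₁ hℓ hm hmw.symm, h1]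
      split_ifs with hx
      · rw [RARZ, if_pos (hx.trans_lt hx₀)]
      · rfl
    · have e : M.midARZ um ur = M.midARZ uℓ ur := by rw [midARZ, midARZ, hmw]
      rw [RARZ, e, h2, RARZ]
      split_ifs with h3 h4 h5
      · rfl
      · rfl
      · exact absurd (h5.trans hx₀) h3
      · rfl
  · obtain rfl : ur = um := by rw [← h, RARZ, if_neg hx₀.not_gt]
    rw [OmegaC.RARZ_self hr]
    constructor
    · split_ifs with hx
      · rfl
      · rw [RARZ, if_neg (hx₀.trans (not_le.1 hx).le).not_gt]
    · split_ifs with hx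
      · rfl
      · rw [RARZ, if_neg (hx₀.trans (not_lt.1 hx)).not_gt]

/-- A solution of ARZ which has not yet left its left state. -/
theorem OmegaC.lt_of_RARZ_eq_left {um ur : ℝ × ℝ} (hm : um ∈ M.OmegaC) (hr : ur ∈ M.OmegaC)
    (hne : um ≠ ur) {x₀ : ℝ} (h : M.RARZ um ur x₀ = um) :
    x₀ < ur.2 ∧ x₀ < um.2 ∧ M.wave₁ um (M.midARZ um ur) x₀ = um ∧
      (ur.2 ≠ um.2 → x₀ ≤ M.lam₁ (M.w₂ um) um.1) := by
  have hx : x₀ < ur.2 := by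
    by_contra hx
    rw [RARZ, if_neg hx] at h
    exact hne h.symm
  rw [RARZ, if_pos hx] at h
  have hmid := OmegaC.midARZ_mem hm hr
  have hmidw := OmegaC.w₂_midARZ hm hr
  have key : ur.2 ≠ um.2 → x₀ ≤ M.lam₁ (M.w₂ um) um.1 := fun hv => by
    have h1 : um.1 ≠ (M.midARZ um ur).1 := fun h1 => by
      have h2 := hmidw
      rw [OmegaC.w₂_eq hmid, OmegaC.w₂_eq hm, ← h1] at h2
      exact hv (add_right_cancel h2)
    rw [OmegaC.wave₁_eq hm hmid hmidw.symm] at h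
    exact (M.isConcaveFlux_fluxC (M.w₂ um)).le_speed_of_lax_eq_left hm.1 hmid.1 h1
      (congrArg Prod.fst h)
  refine ⟨hx, ?_, h, key⟩
  by_cases hv : ur.2 = um.2
  · rwa [← hv]
  · have h1 := M.lam₁_lt (w := M.w₂ um) hm.1.1
    have h2 := OmegaC.w₂_eq hm
    linarith [key hv]

theorem OmegaC.RARZ_merge {uℓ um ur : ℝ × ℝ} (hℓ : uℓ ∈ M.OmegaC) (hm : um ∈ M.OmegaC)
    (hr : ur ∈ M.OmegaC) {x₀ : ℝ} (h1 : M.RARZ uℓ um x₀ = um) (h2 : M.RARZ um ur x₀ = um)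
    (x : ℝ) : M.RARZ uℓ ur x = if x < x₀ then M.RARZ uℓ um x else M.RARZ um ur x := by
  by_cases hne : um = ur
  · subst hne
    rw [OmegaC.RARZ_self hm]
    have := (OmegaC.RARZ_split hℓ hm h1 x).1
    rcases lt_or_ge x x₀ with h3 | h3
    · rw [if_pos h3]
    · rw [if_neg h3.not_gt]
      rcases h3.eq_or_lt with rfl | h4
      · exact h1
      · exact this.trans (if_neg h4.not_ge)
  obtain ⟨hx₁, hx₂, hwave, -⟩ := OmegaC.lt_of_RARZ_eq_left hm hr hne h2
  rw [RARZ, if_pos hx₂] at h1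
  -- As `x₀ < um.2`, the contact of the first solution has not passed, so `um` is reached within the
  -- 1-wave and shares the second invariant of `uℓ`.
  have hw : M.w₂ uℓ = M.w₂ um := by
    rw [← (OmegaC.wave₁_mem hℓ (OmegaC.midARZ_mem hℓ hm) (OmegaC.w₂_midARZ hℓ hm).symm x₀).2, h1]
  rw [OmegaC.midARZ_eq hm hw] at h1
  have hmid := OmegaC.midARZ_mem hm hr
  have hmidw := OmegaC.w₂_midARZ hm hr
  have e : M.midARZ uℓ ur = M.midARZ um ur := by rw [midARZ, midARZ, hw]
  have key : M.wave₁ uℓ (M.midARZ um ur) x =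
      if x < x₀ then M.wave₁ uℓ um x else M.wave₁ um (M.midARZ um ur) x := by
    rw [OmegaC.wave₁_eq hℓ hm hw] at h1 ⊢
    rw [OmegaC.wave₁_eq hm hmid hmidw.symm, ← hw] at hwave ⊢
    rw [OmegaC.wave₁_eq hℓ hmid (hw.trans hmidw.symm), laxC,
      (M.isConcaveFlux_fluxC (M.w₂ uℓ)).lax_merge hℓ.1 hm.1 hmid.1
      (congrArg Prod.fst h1) (congrArg Prod.fst hwave)]
    split_ifs <;> rfl
  rw [RARZ, e, key, OmegaC.RARZ_eq_wave₁ hℓ hm hw, RARZ]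
  split_ifs with h3 h4 h5
  · rfl
  · rfl
  · exact absurd (h5.trans hx₁) h3
  · rfl

/-! ### Consistency of the two phase solver -/

theorem R_self {u : ℝ × ℝ} (hu : u ∈ M.Omega) (ξ : ℝ) : M.R u u ξ = u := by
  rcases hu with hu | hu
  · rw [R_free_free hu hu, OmegaF.RLWR_self hu]
  · rw [R_cong_cong hu hu, OmegaC.RARZ_self hu]

theorem OmegaF.midFC_contact {uℓ ur : ℝ × ℝ} (hℓ : uℓ ∈ M.OmegaF) (hr : ur ∈ M.OmegaC) (ξ : ℝ) :
    M.RARZ (M.midFC uℓ ur) ur ξ = if ξ < ur.2 then M.midFC uℓ ur else ur :=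
  OmegaC.RARZ_contact (ur := ur) (OmegaF.midFC_mem hℓ hr) rfl ξ

theorem midFC_congr (uℓ : ℝ × ℝ) {u u' : ℝ × ℝ} (h : u.2 = u'.2) :
    M.midFC uℓ u = M.midFC uℓ u' := by rw [midFC, midFC, h]

theorem midCF₁_congr {u u' : ℝ × ℝ} (h : M.w₂ u = M.w₂ u') : M.midCF₁ u = M.midCF₁ u' := by
  rw [midCF₁, midCF₁, h]

theorem midCF₂_congr {u u' : ℝ × ℝ} (h : M.w₂ u = M.w₂ u') : M.midCF₂ u = M.midCF₂ u' := by
  rw [midCF₂, midCF₂, h]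

/-- Cutting within one phase leaves the transition unchanged. Behind a free-to-congested transition
every state has velocity `ur.2`, which fixes `midFC`; ahead of a congested-to-free transition every
state has second invariant `M.w₂ uℓ`, which fixes `midCF₁` and `midCF₂`. -/
theorem R_split {uℓ um ur : ℝ × ℝ} (hℓ : uℓ ∈ M.Omega) (hr : ur ∈ M.Omega) {x₀ : ℝ}
    (h : M.R uℓ ur x₀ = um) (x : ℝ) :
    M.R uℓ um x = (if x ≤ x₀ then M.R uℓ ur x else um) ∧
    M.R um ur x = (if x < x₀ then um else M.R uℓ ur x) := by
  rcases hℓ with hℓ | hℓ <;> rcases hr with hr | hr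
  · rw [R_free_free hℓ hr] at h
    have hm : um ∈ M.OmegaF := h ▸ OmegaF.RLWR_mem hℓ hr x₀
    rw [R_free_free hℓ hr, R_free_free hℓ hm, R_free_free hm hr]
    exact OmegaF.RLWR_split hℓ hr h x
  · rw [R_free_cong hℓ hr] at h
    split_ifs at h with hx₀
    · subst h
      rw [R_self (Or.inl hℓ), R_free_cong hℓ hr]
      constructor
      · split_ifs with h1 h2
        · rfl
        · exact absurd (h1.trans_lt hx₀) h2
        · rfl
      · split_ifs with h1 h2 h3
        · rfl
        · rfl
        · exact absurd (h3.trans hx₀) h1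
        · rfl
    · have hmid := OmegaF.midFC_mem hℓ hr
      have hm : um ∈ M.OmegaC := h ▸ OmegaC.RARZ_mem hmid hr x₀
      have hv : um.2 = ur.2 := by
        rw [← h, OmegaF.midFC_contact hℓ hr]
        split_ifs <;> rfl
      rw [R_free_cong hℓ hm, R_cong_cong hm hr, R_free_cong hℓ hr, midFC_congr uℓ hv]
      obtain ⟨h1, h2⟩ := OmegaC.RARZ_split hmid hr h x
      rw [h1, h2]
      constructor
      · split_ifs with h3 h4
        · rfl
        · exact absurd (h3.trans_le (not_lt.1 hx₀)).le h4
        · rfl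
        · rfl
      · split_ifs with h3 h4
        · rfl
        · exact absurd ((h4.trans_le (not_lt.1 hx₀))) h3
        · rfl
  · have hmid := OmegaC.midCF₁_mem hℓ
    have hmid₂ := OmegaC.midCF₂_mem hℓ
    rw [R_cong_free hℓ hr] at h
    split_ifs at h with hx₀
    · have hm : um ∈ M.OmegaC := h ▸ OmegaC.RARZ_mem hℓ hmid x₀
      have hw : M.w₂ um = M.w₂ uℓ := by
        rw [← h, OmegaC.RARZ_eq_wave₁ hℓ hmid (OmegaC.w₂_midCF₁ hℓ).symm]
        exact (OmegaC.wave₁_mem hℓ hmid (OmegaC.w₂_midCF₁ hℓ).symm x₀).2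
      obtain ⟨h1, h2⟩ := OmegaC.RARZ_split hℓ hmid h x
      rw [R_cong_cong hℓ hm, R_cong_free hm hr, R_cong_free hℓ hr, midCF₁_congr hw,
        midCF₂_congr hw, h1, h2]
      constructor
      · split_ifs with h3 h4
        · rfl
        · exact absurd (h3.trans_lt hx₀) h4
        · rfl
      · split_ifs with h3 h4 h5
        · rfl
        · rfl
        · exact absurd (h5.trans hx₀) h3
        · rfl
    · have hm : um ∈ M.OmegaF := h ▸ OmegaF.RLWR_mem hmid₂ hr x₀
      obtain ⟨h1, h2⟩ := OmegaF.RLWR_split hmid₂ hr h x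
      rw [R_cong_free hℓ hm, R_free_free hm hr, R_cong_free hℓ hr, h1, h2]
      constructor
      · split_ifs with h3 h4
        · rfl
        · exact absurd (h3.trans_le (not_lt.1 hx₀)).le h4
        · rfl
        · rfl
      · split_ifs with h3 h4
        · rfl
        · exact absurd (h4.trans_le (not_lt.1 hx₀)) h3
        · rfl
  · rw [R_cong_cong hℓ hr] at h
    have hm : um ∈ M.OmegaC := h ▸ OmegaC.RARZ_mem hℓ hr x₀
    rw [R_cong_cong hℓ hr, R_cong_cong hℓ hm, R_cong_cong hm hr]
    exact OmegaC.RARZ_split hℓ hr h x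

theorem OmegaF.lt_sigma_of_R_eq {um ur : ℝ × ℝ} (hm : um ∈ M.OmegaF) (hr : ur ∈ M.OmegaC) {x₀ : ℝ}
    (h : M.R um ur x₀ = um) : x₀ < sigma um (M.midFC um ur) := by
  by_contra hx
  rw [R_free_cong hm hr, if_neg hx] at h
  exact notMem_OmegaC hm (h ▸ OmegaC.RARZ_mem (OmegaF.midFC_mem hm hr) hr x₀)

/-- No phase transition can follow a completed nontrivial wave of the free phase. -/
theorem OmegaF.not_free_then_transition {uℓ um ur : ℝ × ℝ} (hℓ : uℓ ∈ M.OmegaF)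
    (hm : um ∈ M.OmegaF) (hr : ur ∈ M.OmegaC) (hne : uℓ ≠ um) {x₀ : ℝ}
    (h1 : M.RLWR uℓ um x₀ = um) (h2 : x₀ < sigma um (M.midFC um ur)) : False := by
  rw [OmegaF.RLWR_eq hℓ hm] at h1
  have hne' : uℓ.1 ≠ um.1 := fun h => hne (by rw [← OmegaF.eq_mk hℓ, ← OmegaF.eq_mk hm, h])
  have h3 := M.isConcaveFlux_fluxF.speed_of_lax_eq_right hℓ.1 hm.1 hne' (congrArg Prod.fst h1)
  have h4 := (OmegaF.sigma_bounds hm (OmegaF.midFC_mem hm hr) (OmegaF.w₂_midFC hm hr)).2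
  linarith

/-- A congested state entered through a phase transition and not yet left. -/
theorem OmegaF.eq_midFC {uℓ um : ℝ × ℝ} (hℓ : uℓ ∈ M.OmegaF) (hm : um ∈ M.OmegaC) {x₀ : ℝ}
    (h : M.R uℓ um x₀ = um) (hx : x₀ < um.2) :
    M.midFC uℓ um = um ∧ M.w₂ um = M.wBar uℓ ∧ sigma uℓ um ≤ x₀ := by
  rw [R_free_cong hℓ hm] at h
  split_ifs at h with hx₀
  · exact absurd (h ▸ hm) (fun h' => notMem_OmegaC hℓ h')
  · rw [OmegaF.midFC_contact hℓ hm, if_pos hx] at h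
    refine ⟨h, ?_, ?_⟩
    · rw [← OmegaF.w₂_midFC hℓ hm, h]
    · rw [h] at hx₀; exact not_lt.1 hx₀

/-- With trivial waves set aside, speeds exclude the phase patterns free-free-congested,
free-congested-free and congested-free-congested. Free-congested-congested survives only when a
contact follows the transition, and the other patterns reduce to merging in one phase. -/
theorem R_merge {uℓ um ur : ℝ × ℝ} (hℓ : uℓ ∈ M.Omega) (hm : um ∈ M.Omega) (hr : ur ∈ M.Omega)
    {x₀ : ℝ} (h1 : M.R uℓ um x₀ = um) (h2 : M.R um ur x₀ = um) (x : ℝ) :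
    M.R uℓ ur x = if x < x₀ then M.R uℓ um x else M.R um ur x := by
  by_cases hne : um = ur
  · subst hne
    rw [R_self hm]
    have := (R_split hℓ hm h1 x).1
    rcases lt_or_ge x x₀ with h3 | h3
    · rw [if_pos h3]
    · rw [if_neg h3.not_gt]
      rcases h3.eq_or_lt with rfl | h4
      · exact h1
      · exact this.trans (if_neg h4.not_ge)
  by_cases hne' : uℓ = um
  · subst hne'
    rw [R_self hm]
    exact (R_split hm hr h2 x).2
  rcases hℓ with hℓ | hℓ <;> rcases hm with hm | hm <;> rcases hr with hr | hr
  · rw [R_free_free hℓ hm] at h1 ⊢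
    rw [R_free_free hm hr] at h2 ⊢
    rw [R_free_free hℓ hr]
    exact OmegaF.RLWR_merge hℓ hm hr h1 h2 x
  · rw [R_free_free hℓ hm] at h1
    exact (OmegaF.not_free_then_transition hℓ hm hr hne' h1 (OmegaF.lt_sigma_of_R_eq hm hr h2)).elim
  · exfalso
    have hmid := OmegaC.midCF₁_mem hm
    have hmidw := OmegaC.w₂_midCF₁ hm
    rw [R_cong_free hm hr] at h2
    split_ifs at h2 with hx₀
    · have hx : x₀ < um.2 := (hx₀.trans (OmegaC.sigma_midCF_neg hm)).trans_le hm.2.1.1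
      obtain ⟨-, hw, hσ⟩ := OmegaF.eq_midFC hℓ hm h1 hx
      have hb := (OmegaF.sigma_bounds hℓ hm hw).1
      -- The arrival speed at `um` is at most `x₀` and at least the chord from `rhoF w` to `um`. If
      -- `um` is left directly by the reverse transition, `x₀` is below this same chord; if it is
      -- left by a 1-wave, `x₀ ≤ lam₁`, which is again below the chord.
      by_cases he : um = M.midCF₁ um
      · have := OmegaC.sigma_midCF hm
        rw [← he, hw] at this
        rw [← he] at hx₀
        linarith
      · have h3 := (OmegaC.lt_of_RARZ_eq_left hm hmid he h2).2.2.2 fun hv => he (by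
          conv_lhs => rw [← OmegaC.cong_eq hm, ← hv]
          rfl)
        have h4 := (lam₁_lt_chord (w := M.wBar uℓ) (rhoF_mem_cong (OmegaF.wBar_mem hℓ)) hm.1
          (rhoF_lt (OmegaF.wBar_mem hℓ) hm hw)).1
        rw [hw] at h3
        linarith
    · exact notMem_OmegaC (OmegaF.RLWR_mem (OmegaC.midCF₂_mem hm) hr x₀) (by rw [h2]; exact hm)
  · rw [R_cong_cong hm hr] at h2 ⊢
    obtain ⟨hx₁, hx₂, -, hlam⟩ := OmegaC.lt_of_RARZ_eq_left hm hr hne h2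
    obtain ⟨hmid, hw, hσ⟩ := OmegaF.eq_midFC hℓ hm h1 hx₂
    have hb := (OmegaF.sigma_bounds hℓ hm hw).1
    -- Equal velocities leave only a contact. An outgoing 1-wave would require `x₀ ≤ lam₁` at `um`,
    -- which is less than the arrival speed.
    by_cases hv : ur.2 = um.2
    · rw [R_free_cong hℓ hr, R_free_cong hℓ hm, midFC_congr uℓ hv, hmid, OmegaC.RARZ_self hm,
        OmegaC.RARZ_contact hm hv.symm]
      rcases lt_or_ge x x₀ with h3 | h3
      · rw [if_pos h3, if_pos (h3.trans hx₁)]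
      · rw [if_neg h3.not_gt, if_neg (hσ.trans h3).not_gt]
    · exfalso
      have h3 := hlam hv
      have h4 := (lam₁_lt_chord (w := M.wBar uℓ) (rhoF_mem_cong (OmegaF.wBar_mem hℓ)) hm.1
        (rhoF_lt (OmegaF.wBar_mem hℓ) hm hw)).1
      rw [hw] at h3
      linarith
  · have hmid₂ := OmegaC.midCF₂_mem hℓ
    rw [R_free_free hm hr] at h2 ⊢
    rw [R_cong_free hℓ hm] at h1 ⊢
    split_ifs at h1 with hx₀
    · exact absurd (h1 ▸ OmegaC.RARZ_mem hℓ (OmegaC.midCF₁_mem hℓ) x₀) (notMem_OmegaC hm)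
    · rw [R_cong_free hℓ hr, OmegaF.RLWR_merge hmid₂ hm hr h1 h2]
      split_ifs with h3 h4
      · rfl
      · exact absurd (h3.trans_le (not_lt.1 hx₀)) h4
      · rfl
      · rfl
  · exfalso
    have hmid := OmegaC.midCF₁_mem hℓ
    have hmid₂ := OmegaC.midCF₂_mem hℓ
    have hlt := OmegaF.lt_sigma_of_R_eq hm hr h2
    rw [R_cong_free hℓ hm] at h1
    split_ifs at h1 with hx₀
    · exact absurd (h1 ▸ OmegaC.RARZ_mem hℓ hmid x₀) (notMem_OmegaC hm)
    -- If no free wave separates the transitions, both are chords from `rhoF` on the same curve. The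
    -- second ends at a velocity at most `Vc`, so at a density at least that of `midCF₁`, and is not
    -- faster than the first.
    · by_cases he : M.midCF₂ uℓ = um
      · have hw := OmegaC.w₂_mem hℓ
        have hwb : M.wBar um = M.w₂ uℓ := by
          rw [wBar, ← he, OmegaC.w₂_midCF₂ hℓ]
          exact max_eq_right hw.1
        have hc := OmegaF.midFC_mem hm hr
        have hcw := (OmegaF.w₂_midFC hm hr).trans hwb
        have hσ : sigma um (M.midFC um ur) =
            chord (M.fluxC (M.w₂ uℓ)) (M.rhoF (M.w₂ uℓ)) (M.midFC um ur).1 := by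
          have := sigma_eq_chord (f := M.fluxC (M.w₂ uℓ)) (u := M.midCF₂ uℓ)
            (u' := M.midFC um ur) (fluxC_rhoF hw) (by rw [← hcw]; exact OmegaC.fluxC_eq hc)
          rw [he] at this
          rw [this, ← he]
          rfl
        have hle : (M.midCF₁ uℓ).1 ≤ (M.midFC um ur).1 := by
          by_contra hlt'
          have h3 := (OmegaC.lt_iff hc hmid (hcw.trans (OmegaC.w₂_midCF₁ hℓ).symm)).1
            (not_le.1 hlt')
          exact absurd hr.2.1.2 (not_le.2 h3)
        have hlt' := rhoF_lt hw hmid (OmegaC.w₂_midCF₁ hℓ)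
        have h4 := (M.isConcaveFlux_fluxC (M.w₂ uℓ)).chord_anti_right (rhoF_mem_cong hw) hc.1
          hlt' hle
        rw [← le_div_iff₀ (sub_pos.2 hlt')] at h4
        have h5 := OmegaC.sigma_midCF hℓ
        rw [chord] at h5
        linarith
      · exact OmegaF.not_free_then_transition hmid₂ hm hr he h1 hlt
  · have hmid := OmegaC.midCF₁_mem hm
    rw [R_cong_cong hℓ hm] at h1 ⊢
    rw [R_cong_free hm hr] at h2 ⊢
    split_ifs at h2 with hx₀
    · have hx : x₀ < um.2 := (hx₀.trans (OmegaC.sigma_midCF_neg hm)).trans_le hm.2.1.1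
      have hw : M.w₂ uℓ = M.w₂ um := by
        have h3 := h1
        rw [RARZ, if_pos hx] at h3
        rw [← (OmegaC.wave₁_mem hℓ (OmegaC.midARZ_mem hℓ hm)
          (OmegaC.w₂_midARZ hℓ hm).symm x₀).2, h3]
      rw [R_cong_free hℓ hr, midCF₁_congr hw, midCF₂_congr hw,
        OmegaC.RARZ_merge hℓ hm hmid h1 h2]
      split_ifs with h3 h4 h5
      · rfl
      · rfl
      · exact absurd (h5.trans hx₀) h3
      · rfl
    · exact absurd (h2 ▸ OmegaF.RLWR_mem (OmegaC.midCF₂_mem hm) hr x₀) (notMem_OmegaF hm)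
  · rw [R_cong_cong hℓ hm] at h1 ⊢
    rw [R_cong_cong hm hr] at h2 ⊢
    rw [R_cong_cong hℓ hr]
    exact OmegaC.RARZ_merge hℓ hm hr h1 h2 x

end

end TwoPhase

/-- Convergence to zero of integrals over bounded intervals, by dominated convergence. -/
theorem tendsto_lintegral_Icc_zero {ι : Type*} {l : Filter ι} [l.IsCountablyGenerated]
    {d : ι → ℝ → ENNReal} {C : ENNReal} (hC : C ≠ ⊤) (hm : ∀ᶠ i in l, Measurable (d i))
    (hb : ∀ᶠ i in l, ∀ x, d i x ≤ C) (hlim : ∀ᵐ x, Tendsto (fun i => d i x) l (𝓝 0)) (a b : ℝ) :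
    Tendsto (fun i => ∫⁻ x in Set.Icc a b, d i x) l (𝓝 0) := by
  have := tendsto_lintegral_filter_of_dominated_convergence (μ := volume.restrict (Set.Icc a b))
    (f := fun _ => (0 : ENNReal)) (fun _ => C) hm
    (hb.mono fun i hi => Eventually.of_forall hi)
    (by simp only [lintegral_const, Measure.restrict_apply_univ]
        exact ENNReal.mul_ne_top hC isCompact_Icc.measure_lt_top.ne)
    (ae_restrict_of_ae hlim)
  simpa using this

namespace TwoPhase

noncomputable section

open Classical

variable {M : TwoPhase}

/-! ### Bounded variation of the profiles -/

variable (M)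

/-- Bounded variation in both systems of coordinates. -/
def ProfileBV (F : ℝ → ℝ × ℝ) : Prop := HasBV F ∧ HasBV fun ξ => (M.w₁ (F ξ), M.w₂ (F ξ))

variable {M}

theorem ProfileBV.const (u : ℝ × ℝ) : M.ProfileBV fun _ => u := ⟨HasBV.const _, HasBV.const _⟩

theorem ProfileBV.ite {F G : ℝ → ℝ × ℝ} (hF : M.ProfileBV F) (hG : M.ProfileBV G) (c : ℝ) :
    M.ProfileBV fun x => if x < c then F x else G x := by
  refine ⟨hF.1.ite hG.1 c, ?_⟩
  have := hF.2.ite hG.2 c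
  refine (congrArg HasBV ?_).mp this
  funext x
  by_cases h : x < c
  · simp only [if_pos h]
  · simp only [if_neg h]

theorem OmegaF.profileBV_RLWR {uℓ ur : ℝ × ℝ} (hℓ : uℓ ∈ M.OmegaF) (hr : ur ∈ M.OmegaF) :
    M.ProfileBV (M.RLWR uℓ ur) := by
  have hg : Antitone (fan M.lamF M.Rf₂ 0) := fan_antitone M.Rf₂_pos.le
  constructor
  · rw [funext (OmegaF.RLWR_eq hℓ hr)]
    exact (hasBV_comp_lax hg hℓ.1 hr.1 _ (Or.inl monotoneOn_id)).prodMk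
      (hasBV_comp_lax hg hℓ.1 hr.1 _ (Or.inr M.vf_anti))
  · have : ∀ ξ, (M.w₁ (M.RLWR uℓ ur ξ), M.w₂ (M.RLWR uℓ ur ξ)) =
        (M.Vf, M.wFree (M.laxF uℓ.1 ur.1 ξ)) := fun ξ => by
      have h := OmegaF.RLWR_mem hℓ hr ξ
      rw [OmegaF.w₁_eq h, OmegaF.w₂_eq h, OmegaF.RLWR_eq hℓ hr]
    rw [funext this]
    exact (HasBV.const _).prodMk (hasBV_comp_lax hg hℓ.1 hr.1 _ (Or.inl wFree_mono))

theorem OmegaC.profileBV_wave₁ {uℓ um : ℝ × ℝ} (hℓ : uℓ ∈ M.OmegaC) (hm : um ∈ M.OmegaC)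
    (hw : M.w₂ uℓ = M.w₂ um) : M.ProfileBV (M.wave₁ uℓ um) := by
  have hg : Antitone (fan (M.lam₁ (M.w₂ uℓ)) M.Rmax M.Rf₁) := fan_antitone M.Rmax_ge
  have hp : AntitoneOn (fun ρ => M.w₂ uℓ - M.p ρ) (Set.Icc M.Rf₁ M.Rmax) :=
    fun x hx y hy hxy => sub_le_sub_left ((M.p_le_p hx.1 hy.1).2 hxy) _
  have hv := hasBV_comp_lax hg hℓ.1 hm.1 (chord (M.fluxC (M.w₂ uℓ)) uℓ.1 um.1) (Or.inr hp)
  constructor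
  · rw [funext (OmegaC.wave₁_eq hℓ hm hw)]
    exact (hasBV_comp_lax hg hℓ.1 hm.1 _ (Or.inl monotoneOn_id)).prodMk hv
  · have : ∀ ξ, (M.w₁ (M.wave₁ uℓ um ξ), M.w₂ (M.wave₁ uℓ um ξ)) =
        (M.w₂ uℓ - M.p (M.laxC (M.w₂ uℓ) uℓ.1 um.1 ξ), M.w₂ uℓ) := fun ξ => by
      have h := OmegaC.wave₁_mem hℓ hm hw ξ
      rw [OmegaC.w₁_eq h.1, h.2, OmegaC.wave₁_eq hℓ hm hw]
    rw [funext this]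
    exact hv.prodMk (HasBV.const _)

theorem OmegaC.profileBV_RARZ {uℓ ur : ℝ × ℝ} (hℓ : uℓ ∈ M.OmegaC) (hr : ur ∈ M.OmegaC) :
    M.ProfileBV (M.RARZ uℓ ur) :=
  (OmegaC.profileBV_wave₁ hℓ (OmegaC.midARZ_mem hℓ hr) (OmegaC.w₂_midARZ hℓ hr).symm).ite
    (ProfileBV.const ur) _

theorem profileBV_R {uℓ ur : ℝ × ℝ} (hℓ : uℓ ∈ M.Omega) (hr : ur ∈ M.Omega) :
    M.ProfileBV (M.R uℓ ur) := by
  rcases hℓ with hℓ | hℓ <;> rcases hr with hr | hr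
  · rw [funext (R_free_free hℓ hr)]
    exact OmegaF.profileBV_RLWR hℓ hr
  · rw [funext (R_free_cong hℓ hr)]
    exact (ProfileBV.const uℓ).ite (OmegaC.profileBV_RARZ (OmegaF.midFC_mem hℓ hr) hr) _
  · rw [funext (R_cong_free hℓ hr)]
    exact (OmegaC.profileBV_RARZ hℓ (OmegaC.midCF₁_mem hℓ)).ite
      (OmegaF.profileBV_RLWR (OmegaC.midCF₂_mem hℓ) hr) _
  · rw [funext (R_cong_cong hℓ hr)]
    exact OmegaC.profileBV_RARZ hℓ hr

theorem measurable_R {uℓ ur : ℝ × ℝ} (hℓ : uℓ ∈ M.Omega) (hr : ur ∈ M.Omega) :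
    Measurable (M.R uℓ ur) := (profileBV_R hℓ hr).1.measurable

/-! ### Topology of the phases -/

theorem isCompact_OmegaF : IsCompact M.OmegaF := by
  have h : M.OmegaF = (fun ρ => (ρ, M.vf ρ)) '' Set.Icc 0 M.Rf₂ := by
    ext u
    constructor
    · exact fun hu => ⟨u.1, hu.1, OmegaF.eq_mk hu⟩
    · rintro ⟨ρ, hρ, rfl⟩
      exact M.free_mem hρ
  rw [h]
  exact isCompact_Icc.image_of_continuousOn (continuousOn_id.prodMk M.vf_cont)

theorem continuousOn_sum : ContinuousOn (fun u : ℝ × ℝ => u.2 + M.p u.1)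
    (Set.Icc M.Rf₁ M.Rmax ×ˢ Set.Icc 0 M.Vc) :=
  continuousOn_snd.add (M.p_cont.comp continuousOn_fst fun _ hu => hu.1)

theorem isCompact_OmegaC : IsCompact M.OmegaC := by
  have hK : IsCompact (Set.Icc M.Rf₁ M.Rmax ×ˢ Set.Icc 0 M.Vc) := isCompact_Icc.prod isCompact_Icc
  have h : M.OmegaC = (Set.Icc M.Rf₁ M.Rmax ×ˢ Set.Icc 0 M.Vc) ∩
      (fun u : ℝ × ℝ => u.2 + M.p u.1) ⁻¹' Set.Icc M.Wc M.Wmax := by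
    ext u
    exact ⟨fun hu => ⟨⟨hu.1, hu.2.1⟩, hu.2.2⟩, fun hu => ⟨hu.1.1, hu.1.2, hu.2⟩⟩
  rw [h]
  exact hK.of_isClosed_subset
    (continuousOn_sum.preimage_isClosed_of_isClosed hK.isClosed isClosed_Icc) Set.inter_subset_left

theorem isCompact_Omega : IsCompact M.Omega := isCompact_OmegaF.union isCompact_OmegaC

/-- Disjoint closed phases make the phase locally constant on `Omega`, so nearby data use the same
branch of the solver. -/
theorem eventually_mem_OmegaF {ι : Type*} {l : Filter ι} {a : ι → ℝ × ℝ} {a₀ : ℝ × ℝ}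
    (ha : Tendsto a l (𝓝 a₀)) (hΩ : ∀ᶠ i in l, a i ∈ M.Omega) (h₀ : a₀ ∈ M.OmegaF) :
    ∀ᶠ i in l, a i ∈ M.OmegaF := by
  filter_upwards [hΩ, ha.eventually (isCompact_OmegaC.isClosed.isOpen_compl.mem_nhds
    (notMem_OmegaC h₀))] with i h1 h2
  exact h1.resolve_right h2

theorem eventually_mem_OmegaC {ι : Type*} {l : Filter ι} {a : ι → ℝ × ℝ} {a₀ : ℝ × ℝ}
    (ha : Tendsto a l (𝓝 a₀)) (hΩ : ∀ᶠ i in l, a i ∈ M.Omega) (h₀ : a₀ ∈ M.OmegaC) :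
    ∀ᶠ i in l, a i ∈ M.OmegaC := by
  filter_upwards [hΩ, ha.eventually (isCompact_OmegaF.isClosed.isOpen_compl.mem_nhds
    (notMem_OmegaF h₀))] with i h1 h2
  exact h1.resolve_left h2

/-! ### Pointwise convergence of the profiles -/

section Tendsto

variable {ι : Type*} {l : Filter ι} {a b : ι → ℝ × ℝ} {a₀ b₀ : ℝ × ℝ}

theorem tendsto_comp_of_continuousOn {X : Type*} [TopologicalSpace X] {K : Set X} {h : X → ℝ}
    (hc : ContinuousOn h K) {x : ι → X} {x₀ : X} (hx : Tendsto x l (𝓝 x₀))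
    (hK : ∀ᶠ i in l, x i ∈ K) (h₀ : x₀ ∈ K) : Tendsto (fun i => h (x i)) l (𝓝 (h x₀)) :=
  (hc x₀ h₀).tendsto.comp (tendsto_nhdsWithin_iff.2 ⟨hx, hK⟩)

theorem tendsto_fst (ha : Tendsto a l (𝓝 a₀)) : Tendsto (fun i => (a i).1) l (𝓝 a₀.1) :=
  (continuous_fst.tendsto _).comp ha

theorem tendsto_snd (ha : Tendsto a l (𝓝 a₀)) : Tendsto (fun i => (a i).2) l (𝓝 a₀.2) :=
  (continuous_snd.tendsto _).comp ha

theorem tendsto_sigma (ha : Tendsto a l (𝓝 a₀)) (hb : Tendsto b l (𝓝 b₀)) (h : a₀.1 ≠ b₀.1) :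
    Tendsto (fun i => sigma (a i) (b i)) l (𝓝 (sigma a₀ b₀)) :=
  (((tendsto_fst hb).mul (tendsto_snd hb)).sub ((tendsto_fst ha).mul (tendsto_snd ha))).div
    ((tendsto_fst hb).sub (tendsto_fst ha)) (sub_ne_zero.2 h.symm)

theorem tendsto_w₂_free (ha : Tendsto a l (𝓝 a₀)) (haF : ∀ᶠ i in l, a i ∈ M.OmegaF)
    (h₀ : a₀ ∈ M.OmegaF) : Tendsto (fun i => M.w₂ (a i)) l (𝓝 (M.w₂ a₀)) := by
  rw [OmegaF.w₂_eq h₀]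
  refine (tendsto_comp_of_continuousOn wFree_cont (tendsto_fst ha) (haF.mono fun i h => h.1)
    h₀.1).congr' ?_
  filter_upwards [haF] with i h
  rw [OmegaF.w₂_eq h]

theorem tendsto_w₂_cong (ha : Tendsto a l (𝓝 a₀)) (haC : ∀ᶠ i in l, a i ∈ M.OmegaC)
    (h₀ : a₀ ∈ M.OmegaC) : Tendsto (fun i => M.w₂ (a i)) l (𝓝 (M.w₂ a₀)) := by
  rw [OmegaC.w₂_eq h₀]
  refine ((tendsto_snd ha).add (tendsto_comp_of_continuousOn M.p_cont (tendsto_fst ha)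
    (haC.mono fun i h => h.1) h₀.1)).congr' ?_
  filter_upwards [haC] with i h
  rw [OmegaC.w₂_eq h]

/-- Continuity of `pInv` comes from compactness: `p` is continuous and injective on the compact
interval where `pInv` takes its values. The same argument serves `rhoF`. -/
theorem tendsto_cong {w v : ι → ℝ} {w₀ v₀ : ℝ} (hw : Tendsto w l (𝓝 w₀)) (hv : Tendsto v l (𝓝 v₀))
    (hwI : ∀ᶠ i in l, w i ∈ Set.Icc M.Wc M.Wmax) (hvI : ∀ᶠ i in l, v i ∈ Set.Icc 0 M.Vc)
    (hw₀ : w₀ ∈ Set.Icc M.Wc M.Wmax) (hv₀ : v₀ ∈ Set.Icc 0 M.Vc) :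
    Tendsto (fun i => M.cong (w i) (v i)) l (𝓝 (M.cong w₀ v₀)) := by
  refine Tendsto.prodMk_nhds ?_ hv
  refine isCompact_Icc.tendsto_of_injOn M.p_cont
    (M.p_mono.injOn.mono Set.Icc_subset_Ici_self) ?_ (M.pInv_mem (sub_mem hw₀ hv₀)) ?_
  · filter_upwards [hwI, hvI] with i h1 h2
    exact M.pInv_mem (sub_mem h1 h2)
  · rw [M.p_pInv (sub_mem hw₀ hv₀)]
    refine (hw.sub hv).congr' ?_
    filter_upwards [hwI, hvI] with i h1 h2
    rw [M.p_pInv (sub_mem h1 h2)]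

theorem tendsto_rhoF {w : ι → ℝ} {w₀ : ℝ} (hw : Tendsto w l (𝓝 w₀))
    (hwI : ∀ᶠ i in l, w i ∈ Set.Icc M.Wc M.Wmax) (hw₀ : w₀ ∈ Set.Icc M.Wc M.Wmax) :
    Tendsto (fun i => M.rhoF (w i)) l (𝓝 (M.rhoF w₀)) := by
  refine isCompact_Icc.tendsto_of_injOn M.vfp_cont M.compat_mono.injOn ?_ (M.rhoF_mem hw₀) ?_
  · filter_upwards [hwI] with i h1
    exact M.rhoF_mem h1
  · rw [M.rhoF_spec hw₀]
    refine hw.congr' ?_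
    filter_upwards [hwI] with i h1
    rw [M.rhoF_spec h1]

/-- Only the shock speed is to be avoided: the underlying fan does not depend on the data, so a
rarefaction converges at every `x`, even where it jumps. -/
theorem tendsto_RLWR (ha : Tendsto a l (𝓝 a₀)) (hb : Tendsto b l (𝓝 b₀))
    (haF : ∀ᶠ i in l, a i ∈ M.OmegaF) (hbF : ∀ᶠ i in l, b i ∈ M.OmegaF) (ha₀ : a₀ ∈ M.OmegaF)
    (hb₀ : b₀ ∈ M.OmegaF) {x : ℝ} (hx : x ≠ sigma a₀ b₀) :
    Tendsto (fun i => M.RLWR (a i) (b i) x) l (𝓝 (M.RLWR a₀ b₀ x)) := by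
  have hlax : Tendsto (fun i => M.laxF (a i).1 (b i).1 x) l (𝓝 (M.laxF a₀.1 b₀.1 x)) := by
    refine tendsto_lax (tendsto_fst ha) (tendsto_fst hb) tendsto_const_nhds fun hlt => ?_
    rw [← sigma_eq_chord (OmegaF.fluxF_eq ha₀) (OmegaF.fluxF_eq hb₀)]
    refine ⟨(tendsto_sigma ha hb hlt.ne).congr' ?_, hx⟩
    filter_upwards [haF, hbF] with i h1 h2
    rw [sigma_eq_chord (OmegaF.fluxF_eq h1) (OmegaF.fluxF_eq h2)]
  rw [OmegaF.RLWR_eq ha₀ hb₀]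
  have hvf : Tendsto (fun i => M.vf (M.laxF (a i).1 (b i).1 x)) l
      (𝓝 (M.vf (M.laxF a₀.1 b₀.1 x))) := by
    refine tendsto_comp_of_continuousOn M.vf_cont hlax ?_ (OmegaF.laxF_mem ha₀ hb₀ x)
    filter_upwards [haF, hbF] with i h1 h2
    exact OmegaF.laxF_mem h1 h2 x
  refine (hlax.prodMk_nhds hvf).congr' ?_
  filter_upwards [haF, hbF] with i h1 h2
  rw [OmegaF.RLWR_eq h1 h2]

/-- The invariant `w` only shifts the speed. A single antitone function thus serves all curves, and
its countable set of discontinuities gives the null set to be avoided when `w` varies. -/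
theorem fan_lam₁ (w ξ : ℝ) :
    fan (M.lam₁ w) M.Rmax M.Rf₁ ξ = fan (M.lam₁ 0) M.Rmax M.Rf₁ (ξ - w) := by
  unfold fan
  congr 2
  ext ρ
  have : M.lam₁ w ρ ≤ ξ ↔ M.lam₁ 0 ρ ≤ ξ - w := by
    simp only [lam₁]
    constructor <;> intro <;> linarith
  simp only [Set.mem_ofPred_eq, this]

theorem tendsto_wave₁ (ha : Tendsto a l (𝓝 a₀)) (hb : Tendsto b l (𝓝 b₀))
    (haC : ∀ᶠ i in l, a i ∈ M.OmegaC) (hbC : ∀ᶠ i in l, b i ∈ M.OmegaC)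
    (hab : ∀ᶠ i in l, M.w₂ (a i) = M.w₂ (b i)) (ha₀ : a₀ ∈ M.OmegaC) (hb₀ : b₀ ∈ M.OmegaC)
    (hab₀ : M.w₂ a₀ = M.w₂ b₀) {x : ℝ} (hx : x ≠ sigma a₀ b₀)
    (hfan : ContinuousAt (fan (M.lam₁ 0) M.Rmax M.Rf₁) (x - M.w₂ a₀)) :
    Tendsto (fun i => M.wave₁ (a i) (b i) x) l (𝓝 (M.wave₁ a₀ b₀ x)) := by
  have hw := tendsto_w₂_cong ha haC ha₀
  have hflux : ∀ {u u' : ℝ × ℝ}, u ∈ M.OmegaC → u' ∈ M.OmegaC → M.w₂ u = M.w₂ u' →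
      sigma u u' = chord (M.fluxC (M.w₂ u)) u.1 u'.1 := fun h h' hw =>
    sigma_eq_chord (OmegaC.fluxC_eq h) (by rw [hw]; exact OmegaC.fluxC_eq h')
  have hlax : Tendsto (fun i => M.laxC (M.w₂ (a i)) (a i).1 (b i).1 x) l
      (𝓝 (M.laxC (M.w₂ a₀) a₀.1 b₀.1 x)) := by
    refine tendsto_lax (tendsto_fst ha) (tendsto_fst hb) ?_ fun hlt => ?_
    · simp only [fan_lam₁ (M.w₂ _)]
      exact hfan.tendsto.comp (tendsto_const_nhds.sub hw)
    · rw [← hflux ha₀ hb₀ hab₀]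
      refine ⟨(tendsto_sigma ha hb hlt.ne).congr' ?_, hx⟩
      filter_upwards [haC, hbC, hab] with i h1 h2 h3
      rw [hflux h1 h2 h3]
  have hmem : ∀ {u u' : ℝ × ℝ}, u ∈ M.OmegaC → u' ∈ M.OmegaC →
      M.laxC (M.w₂ u) u.1 u'.1 x ∈ Set.Icc M.Rf₁ M.Rmax := fun h h' => lax_mem _ _ _ h.1 h'.1
  rw [OmegaC.wave₁_eq ha₀ hb₀ hab₀]
  have hp : Tendsto (fun i => M.p (M.laxC (M.w₂ (a i)) (a i).1 (b i).1 x)) l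
      (𝓝 (M.p (M.laxC (M.w₂ a₀) a₀.1 b₀.1 x))) := by
    refine tendsto_comp_of_continuousOn M.p_cont hlax ?_ (hmem ha₀ hb₀)
    filter_upwards [haC, hbC] with i h1 h2
    exact hmem h1 h2
  refine (hlax.prodMk_nhds (hw.sub hp)).congr' ?_
  filter_upwards [haC, hbC, hab] with i h1 h2 h3
  rw [OmegaC.wave₁_eq h1 h2 h3]

theorem tendsto_midARZ (ha : Tendsto a l (𝓝 a₀)) (hb : Tendsto b l (𝓝 b₀))
    (haC : ∀ᶠ i in l, a i ∈ M.OmegaC) (hbC : ∀ᶠ i in l, b i ∈ M.OmegaC) (ha₀ : a₀ ∈ M.OmegaC)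
    (hb₀ : b₀ ∈ M.OmegaC) :
    Tendsto (fun i => M.midARZ (a i) (b i)) l (𝓝 (M.midARZ a₀ b₀)) :=
  tendsto_cong (tendsto_w₂_cong ha haC ha₀) (tendsto_snd hb)
    (haC.mono fun _ h => OmegaC.w₂_mem h) (hbC.mono fun _ h => h.2.1) (OmegaC.w₂_mem ha₀) hb₀.2.1

theorem tendsto_ite_lt {X : Type*} [TopologicalSpace X] {s : ι → ℝ} {s₀ x : ℝ}
    (hs : Tendsto s l (𝓝 s₀)) (hx : x ≠ s₀) {f g : ι → X} {f₀ g₀ : X}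
    (hf : Tendsto f l (𝓝 f₀)) (hg : Tendsto g l (𝓝 g₀)) :
    Tendsto (fun i => if x < s i then f i else g i) l (𝓝 (if x < s₀ then f₀ else g₀)) := by
  rcases lt_or_gt_of_ne hx with h | h
  · rw [if_pos h]
    refine hf.congr' ?_
    filter_upwards [hs.eventually (lt_mem_nhds h)] with i hi
    rw [if_pos hi]
  · rw [if_neg h.not_gt]
    refine hg.congr' ?_
    filter_upwards [hs.eventually (gt_mem_nhds h)] with i hi
    rw [if_neg hi.not_gt]

theorem tendsto_RARZ (ha : Tendsto a l (𝓝 a₀)) (hb : Tendsto b l (𝓝 b₀))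
    (haC : ∀ᶠ i in l, a i ∈ M.OmegaC) (hbC : ∀ᶠ i in l, b i ∈ M.OmegaC) (ha₀ : a₀ ∈ M.OmegaC)
    (hb₀ : b₀ ∈ M.OmegaC) {x : ℝ} (hx : x ≠ sigma a₀ (M.midARZ a₀ b₀)) (hx' : x ≠ b₀.2)
    (hfan : ContinuousAt (fan (M.lam₁ 0) M.Rmax M.Rf₁) (x - M.w₂ a₀)) :
    Tendsto (fun i => M.RARZ (a i) (b i) x) l (𝓝 (M.RARZ a₀ b₀ x)) := by
  refine tendsto_ite_lt (tendsto_snd hb) hx' ?_ hb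
  refine tendsto_wave₁ ha (tendsto_midARZ ha hb haC hbC ha₀ hb₀) haC ?_ ?_ ha₀
    (OmegaC.midARZ_mem ha₀ hb₀) (OmegaC.w₂_midARZ ha₀ hb₀).symm hx hfan
  · filter_upwards [haC, hbC] with i h1 h2
    exact OmegaC.midARZ_mem h1 h2
  · filter_upwards [haC, hbC] with i h1 h2
    exact (OmegaC.w₂_midARZ h1 h2).symm

end Tendsto

theorem ae_ne_real (c : ℝ) : ∀ᵐ x : ℝ, x ≠ c := (Set.countable_singleton c).ae_notMem volume

theorem ae_continuousAt_fan (w : ℝ) :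
    ∀ᵐ x : ℝ, ContinuousAt (fan (M.lam₁ 0) M.Rmax M.Rf₁) (x - w) := by
  have h := (fan_antitone (lam := M.lam₁ 0) M.Rmax_ge).countable_not_continuousAt
  filter_upwards [(h.preimage (sub_left_injective (b := w))).ae_notMem volume] with x hx
  by_contra hx'
  exact hx hx'

/-- For almost every `x`, the solver depends continuously on its data at `x`. -/
theorem ae_tendsto_R {uℓ ur : ℝ × ℝ} (hℓ : uℓ ∈ M.Omega) (hr : ur ∈ M.Omega) :
    ∀ᵐ x, Tendsto (fun q : M.Omega × M.Omega => M.R q.1 q.2 x) (𝓝 (⟨uℓ, hℓ⟩, ⟨ur, hr⟩))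
      (𝓝 (M.R uℓ ur x)) := by
  set l := 𝓝 ((⟨uℓ, hℓ⟩, ⟨ur, hr⟩) : M.Omega × M.Omega) with hl
  have ha : Tendsto (fun q : M.Omega × M.Omega => (q.1 : ℝ × ℝ)) l (𝓝 uℓ) :=
    (continuous_subtype_val.comp continuous_fst).tendsto _
  have hb : Tendsto (fun q : M.Omega × M.Omega => (q.2 : ℝ × ℝ)) l (𝓝 ur) :=
    (continuous_subtype_val.comp continuous_snd).tendsto _
  have haΩ : ∀ᶠ q : M.Omega × M.Omega in l, (q.1 : ℝ × ℝ) ∈ M.Omega :=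
    Eventually.of_forall fun q => q.1.2
  have hbΩ : ∀ᶠ q : M.Omega × M.Omega in l, (q.2 : ℝ × ℝ) ∈ M.Omega :=
    Eventually.of_forall fun q => q.2.2
  rcases hℓ with hℓ | hℓ
  · have haF := eventually_mem_OmegaF ha haΩ hℓ
    rcases hr with hr | hr
    · have hbF := eventually_mem_OmegaF hb hbΩ hr
      filter_upwards [ae_ne_real (sigma uℓ ur)] with x hx
      rw [R_free_free hℓ hr]
      refine (tendsto_RLWR ha hb haF hbF hℓ hr hx).congr' ?_
      filter_upwards [haF, hbF] with q h1 h2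
      rw [R_free_free h1 h2]
    · have hbC := eventually_mem_OmegaC hb hbΩ hr
      have hmid : Tendsto (fun q : M.Omega × M.Omega => M.midFC q.1 q.2) l (𝓝 (M.midFC uℓ ur)) :=
        tendsto_cong (tendsto_const_nhds.max (tendsto_w₂_free ha haF hℓ)) (tendsto_snd hb)
          (haF.mono fun _ h => OmegaF.wBar_mem h) (hbC.mono fun _ h => h.2.1)
          (OmegaF.wBar_mem hℓ) hr.2.1
      have hmem := OmegaF.midFC_mem hℓ hr
      have hmemE : ∀ᶠ q : M.Omega × M.Omega in l, M.midFC q.1 q.2 ∈ M.OmegaC := by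
        filter_upwards [haF, hbC] with q h1 h2
        exact OmegaF.midFC_mem h1 h2
      have hne := (OmegaF.lt_of_w₂_eq hℓ hmem (OmegaF.w₂_midFC hℓ hr)).ne
      filter_upwards [ae_ne_real (sigma uℓ (M.midFC uℓ ur)), ae_ne_real ur.2,
        ae_ne_real (sigma (M.midFC uℓ ur) (M.midARZ (M.midFC uℓ ur) ur)),
        ae_continuousAt_fan (M := M) (M.w₂ (M.midFC uℓ ur))] with x h1 h2 h3 h4
      rw [R_free_cong hℓ hr]
      refine (tendsto_ite_lt (tendsto_sigma ha hmid hne) h1 ha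
        (tendsto_RARZ hmid hb hmemE hbC hmem hr h3 h2 h4)).congr' ?_
      filter_upwards [haF, hbC] with q h1 h2
      rw [R_free_cong h1 h2]
  · have haC := eventually_mem_OmegaC ha haΩ hℓ
    rcases hr with hr | hr
    · have hbF := eventually_mem_OmegaF hb hbΩ hr
      have hw := tendsto_w₂_cong ha haC hℓ
      have hwI : ∀ᶠ q : M.Omega × M.Omega in l, M.w₂ q.1 ∈ Set.Icc M.Wc M.Wmax :=
        haC.mono fun _ h => OmegaC.w₂_mem h
      have hmid : Tendsto (fun q : M.Omega × M.Omega => M.midCF₁ q.1) l (𝓝 (M.midCF₁ uℓ)) :=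
        tendsto_cong hw tendsto_const_nhds hwI (Eventually.of_forall fun _ => Vc_mem)
          (OmegaC.w₂_mem hℓ) Vc_mem
      have hρ := tendsto_rhoF hw hwI (OmegaC.w₂_mem hℓ)
      have hmid₂ : Tendsto (fun q : M.Omega × M.Omega => M.midCF₂ q.1) l (𝓝 (M.midCF₂ uℓ)) :=
        hρ.prodMk_nhds (tendsto_comp_of_continuousOn M.vf_cont hρ
          (hwI.mono fun _ h => M.rhoF_mem_free h) (M.rhoF_mem_free (OmegaC.w₂_mem hℓ)))
      have hmem := OmegaC.midCF₁_mem hℓ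
      have hmem₂ := OmegaC.midCF₂_mem hℓ
      have hne : (M.midCF₁ uℓ).1 ≠ (M.midCF₂ uℓ).1 :=
        (rhoF_lt (OmegaC.w₂_mem hℓ) hmem (OmegaC.w₂_midCF₁ hℓ)).ne'
      filter_upwards [ae_ne_real (sigma (M.midCF₁ uℓ) (M.midCF₂ uℓ)), ae_ne_real M.Vc,
        ae_ne_real (sigma uℓ (M.midARZ uℓ (M.midCF₁ uℓ))), ae_continuousAt_fan (M := M) (M.w₂ uℓ),
        ae_ne_real (sigma (M.midCF₂ uℓ) ur)] with x h1 h2 h3 h4 h5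
      rw [R_cong_free hℓ hr]
      refine (tendsto_ite_lt (tendsto_sigma hmid hmid₂ hne) h1
        (tendsto_RARZ ha hmid haC (haC.mono fun _ h => OmegaC.midCF₁_mem h) hℓ hmem h3 h2 h4)
        (tendsto_RLWR hmid₂ hb (haC.mono fun _ h => OmegaC.midCF₂_mem h) hbF hmem₂ hr
          h5)).congr' ?_
      filter_upwards [haC, hbF] with q h1 h2
      rw [R_cong_free h1 h2]
    · have hbC := eventually_mem_OmegaC hb hbΩ hr
      filter_upwards [ae_ne_real ur.2, ae_ne_real (sigma uℓ (M.midARZ uℓ ur)),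
        ae_continuousAt_fan (M := M) (M.w₂ uℓ)] with x h1 h2 h3
      rw [R_cong_cong hℓ hr]
      refine (tendsto_RARZ ha hb haC hbC hℓ hr h2 h1 h3).congr' ?_
      filter_upwards [haC, hbC] with q h1 h2
      rw [R_cong_cong h1 h2]

/-! ### Continuity into `L¹_loc` -/

theorem exists_edist_bound : ∃ C : ENNReal, C ≠ ⊤ ∧
    ∀ u ∈ M.Omega, ∀ u' ∈ M.Omega, edist u u' ≤ C :=
  ⟨Metric.ediam M.Omega, isCompact_Omega.isBounded.ediam_ne_top,
    fun _ hu _ hu' => Metric.edist_le_ediam_of_mem hu hu'⟩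

theorem tendsto_lintegral_R (q₀ : M.Omega × M.Omega) (a b : ℝ) :
    Tendsto (fun q : M.Omega × M.Omega =>
      ∫⁻ x in Set.Icc a b, edist (M.R q.1 q.2 x) (M.R q₀.1 q₀.2 x)) (𝓝 q₀) (𝓝 0) := by
  obtain ⟨C, hC, hb⟩ := exists_edist_bound (M := M)
  refine tendsto_lintegral_Icc_zero hC (Eventually.of_forall fun q => ?_)
    (Eventually.of_forall fun q x => hb _ (R_mem q.1.2 q.2.2 x) _ (R_mem q₀.1.2 q₀.2.2 x)) ?_ a b
  · exact (measurable_R q.1.2 q.2.2).edist (measurable_R q₀.1.2 q₀.2.2)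
  · filter_upwards [ae_tendsto_R q₀.1.2 q₀.2.2] with x hx
    exact tendsto_iff_edist_tendsto_0.1 hx

theorem tendsto_invariants {ι : Type*} {l : Filter ι} {a : ι → ℝ × ℝ} {a₀ : ℝ × ℝ}
    (ha : Tendsto a l (𝓝 a₀)) (hΩ : ∀ᶠ i in l, a i ∈ M.Omega) (h₀ : a₀ ∈ M.Omega) :
    Tendsto (fun i => (M.w₁ (a i), M.w₂ (a i))) l (𝓝 (M.w₁ a₀, M.w₂ a₀)) := by
  rcases h₀ with h₀ | h₀
  · have haF := eventually_mem_OmegaF ha hΩ h₀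
    refine Tendsto.prodMk_nhds ?_ (tendsto_w₂_free ha haF h₀)
    rw [OmegaF.w₁_eq h₀]
    refine tendsto_const_nhds.congr' ?_
    filter_upwards [haF] with i h
    rw [OmegaF.w₁_eq h]
  · have haC := eventually_mem_OmegaC ha hΩ h₀
    refine Tendsto.prodMk_nhds ?_ (tendsto_w₂_cong ha haC h₀)
    rw [OmegaC.w₁_eq h₀]
    refine (tendsto_snd ha).congr' ?_
    filter_upwards [haC] with i h
    rw [OmegaC.w₁_eq h]

theorem continuousOn_invariants : ContinuousOn (fun u => (M.w₁ u, M.w₂ u)) M.Omega :=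
  fun _ hu => tendsto_invariants (tendsto_id.mono_left nhdsWithin_le_nhds) self_mem_nhdsWithin hu

theorem tendsto_lintegral_wDist (q₀ : M.Omega × M.Omega) (a b : ℝ) :
    Tendsto (fun q : M.Omega × M.Omega =>
      ∫⁻ x in Set.Icc a b, ENNReal.ofReal (M.wDist (M.R q.1 q.2 x) (M.R q₀.1 q₀.2 x)))
      (𝓝 q₀) (𝓝 0) := by
  have hK : IsCompact ((fun u => (M.w₁ u, M.w₂ u)) '' M.Omega) :=
    isCompact_Omega.image_of_continuousOn continuousOn_invariants
  obtain ⟨D, hD⟩ := Metric.isBounded_iff.1 hK.isBounded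
  have hbound : ∀ u ∈ M.Omega, ∀ u' ∈ M.Omega, M.wDist u u' ≤ D + D := fun u hu u' hu' => by
    have := hD (Set.mem_image_of_mem _ hu) (Set.mem_image_of_mem _ hu')
    rw [Prod.dist_eq] at this
    exact add_le_add ((le_max_left _ _).trans this) ((le_max_right _ _).trans this)
  refine tendsto_lintegral_Icc_zero (C := ENNReal.ofReal (D + D)) ENNReal.ofReal_ne_top
    (Eventually.of_forall fun q => ?_) (Eventually.of_forall fun q x =>
      ENNReal.ofReal_le_ofReal (hbound _ (R_mem q.1.2 q.2.2 x) _ (R_mem q₀.1.2 q₀.2.2 x))) ?_ a b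
  · have h1 := (profileBV_R q.1.2 q.2.2).2.measurable
    have h2 := (profileBV_R q₀.1.2 q₀.2.2).2.measurable
    refine ENNReal.measurable_ofReal.comp ?_
    have e1 := (h1.fst.sub h2.fst).abs
    have e2 := (h1.snd.sub h2.snd).abs
    exact e1.add e2
  · filter_upwards [ae_tendsto_R q₀.1.2 q₀.2.2] with x hx
    have h := tendsto_invariants hx (Eventually.of_forall fun q => R_mem q.1.2 q.2.2 x)
      (R_mem q₀.1.2 q₀.2.2 x)
    have h1 := ((tendsto_fst h).sub_const (M.w₁ (M.R q₀.1 q₀.2 x))).abs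
    have h2 := ((tendsto_snd h).sub_const (M.w₂ (M.R q₀.1 q₀.2 x))).abs
    have h3 := ENNReal.tendsto_ofReal (h1.add h2)
    simpa [wDist] using h3

/-- The filter `comap W (𝓝 0)` consists of the neighbourhoods of `u` for `wDist`. Compactness of
`Omega` and injectivity of the invariants make it finer than the usual neighbourhood filter. -/
theorem exists_delta_wDist (hinj : Set.InjOn (fun u => (M.w₁ u, M.w₂ u)) M.Omega)
    {u : ℝ × ℝ} (hu : u ∈ M.Omega) {U : Set M.Omega} (hU : U ∈ 𝓝 (⟨u, hu⟩ : M.Omega)) :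
    ∃ δ > 0, ∀ u' (hu' : u' ∈ M.Omega), M.wDist u' u < δ → (⟨u', hu'⟩ : M.Omega) ∈ U := by
  let W : M.Omega → ℝ := fun u' => M.wDist u' u
  have ht : Tendsto (fun u' : M.Omega => (u' : ℝ × ℝ)) (comap W (𝓝 0)) (𝓝 u) := by
    refine isCompact_Omega.tendsto_of_injOn continuousOn_invariants hinj
      (Eventually.of_forall fun u' => u'.2) hu ?_
    have hW : Tendsto W (comap W (𝓝 0)) (𝓝 0) := tendsto_comap
    refine tendsto_iff_dist_tendsto_zero.2 (squeeze_zero (fun _ => dist_nonneg) (fun u' => ?_) hW)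
    rw [Prod.dist_eq]
    exact max_le (le_add_of_nonneg_right (abs_nonneg _)) (le_add_of_nonneg_left (abs_nonneg _))
  have ht' : Tendsto (fun u' : M.Omega => u') (comap W (𝓝 0)) (𝓝 ⟨u, hu⟩) :=
    tendsto_subtype_rng.2 ht
  obtain ⟨V, hV, hVU⟩ := mem_comap.1 (ht' hU)
  obtain ⟨δ, hδ, hδV⟩ := Metric.mem_nhds_iff.1 hV
  refine ⟨δ, hδ, fun u' hu' h => hVU (a := ⟨u', hu'⟩) (hδV ?_)⟩
  rw [Metric.mem_ball, dist_zero_right, Real.norm_of_nonneg]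
  · exact h
  · exact add_nonneg (abs_nonneg _) (abs_nonneg _)

theorem exists_delta_lintegral_wDist (hinj : Set.InjOn (fun u => (M.w₁ u, M.w₂ u)) M.Omega)
    {uℓ ur : ℝ × ℝ} (hℓ : uℓ ∈ M.Omega) (hr : ur ∈ M.Omega) (a b : ℝ) {ε : ℝ} (hε : 0 < ε) :
    ∃ δ > 0, ∀ uℓ' ∈ M.Omega, ∀ ur' ∈ M.Omega, M.wDist uℓ' uℓ < δ → M.wDist ur' ur < δ →
      ∫⁻ x in Set.Icc a b, ENNReal.ofReal (M.wDist (M.R uℓ' ur' x) (M.R uℓ ur x))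
        < ENNReal.ofReal ε := by
  have h := (tendsto_lintegral_wDist (M := M) (⟨uℓ, hℓ⟩, ⟨ur, hr⟩) a b).eventually
    (gt_mem_nhds (ENNReal.ofReal_pos.2 hε))
  rw [nhds_prod_eq, eventually_prod_iff] at h
  obtain ⟨U, hU, V, hV, hUV⟩ := h
  obtain ⟨δ₁, hδ₁, h₁⟩ := exists_delta_wDist hinj hℓ hU
  obtain ⟨δ₂, hδ₂, h₂⟩ := exists_delta_wDist hinj hr hV
  refine ⟨min δ₁ δ₂, lt_min hδ₁ hδ₂, fun uℓ' hℓ' ur' hr' e1 e2 => ?_⟩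
  exact hUV (x := ⟨uℓ', hℓ'⟩) (h₁ uℓ' hℓ' (e1.trans_le (min_le_left _ _)))
    (y := ⟨ur', hr'⟩) (h₂ ur' hr' (e2.trans_le (min_le_right _ _)))

end

end TwoPhase

/-! ### Lax solutions far from the origin, and essential one-sided limits -/

namespace IsConcaveFlux

variable {f lam : ℝ → ℝ} {A B : ℝ}

/-- The Lax solution has not left its left state. -/
theorem lax_eq_left (hf : IsConcaveFlux f lam A B) {a b x : ℝ} (ha : a ∈ Set.Icc A B)
    (h1 : a < b → x < chord f a b) (h2 : b ≤ a → x < lam a) :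
    lax a b (chord f a b) (TwoPhase.fan lam B A x) x = a := by
  unfold lax
  split_ifs with h h'
  · rfl
  · exact absurd (h1 h) h'
  · have h3 := not_lt.1 h
    have h4 : a ≤ TwoPhase.fan lam B A x := by
      by_contra hlt
      exact absurd (TwoPhase.speed_le_of_fan_lt hf.anti ha (not_le.1 hlt)) (not_le.2 (h2 h3))
    rw [min_eq_left h4, max_eq_right h3]

theorem eventually_lax_eq_left (hf : IsConcaveFlux f lam A B) {a : ℝ} (ha : a ∈ Set.Icc A B)
    (b : ℝ) : ∀ᶠ x in atBot, lax a b (chord f a b) (TwoPhase.fan lam B A x) x = a := by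
  filter_upwards [eventually_lt_atBot (chord f a b), eventually_lt_atBot (lam a)] with x h1 h2
  exact hf.lax_eq_left ha (fun _ => h1) fun _ => h2

theorem eventually_lax_eq_right {b : ℝ} (hb : b ∈ Set.Icc A B) (a : ℝ) :
    ∀ᶠ x in atTop, lax a b (chord f a b) (TwoPhase.fan lam B A x) x = b := by
  filter_upwards [eventually_ge_atTop (chord f a b), eventually_ge_atTop (lam b)] with x h1 h2
  exact lax_eq_right hb (fun _ => h1) fun _ => h2

end IsConcaveFlux

/-- A pair which is conserved in both directions can be scaled by any constant. -/
theorem Dissipative.const_mul' {E Q : ℝ → ℝ} (h : Dissipative E Q)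
    (h' : Dissipative (fun x => -E x) (fun x => -Q x)) (k : ℝ) :
    Dissipative (fun x => k * E x) (fun x => k * Q x) := by
  rcases le_total 0 k with hk | hk
  · exact h.const_mul hk
  · simpa using h'.const_mul (neg_nonneg.2 hk)

/-- A one-sided neighbourhood contains an interval of positive measure. Essential traces therefore
lie in any closed set containing the nearby values. -/
theorem nhdsLT_inf_ae_neBot (x : ℝ) : (𝓝[<] x ⊓ ae (volume : Measure ℝ)).NeBot := by
  rw [inf_neBot_iff]
  intro s hs t ht
  obtain ⟨a, ha, has⟩ := (mem_nhdsLT_iff_exists_Ioo_subset' (sub_one_lt x)).1 hs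
  by_contra hne
  have hsub : Set.Ioo a x ⊆ tᶜ := fun y hy hyt => hne ⟨y, has hy, hyt⟩
  have h0 : volume (Set.Ioo a x) = 0 := measure_mono_null hsub ht
  rw [Real.volume_Ioo, ENNReal.ofReal_eq_zero] at h0
  exact absurd ha (not_lt.2 (by linarith : x ≤ a))

theorem nhdsGT_inf_ae_neBot (x : ℝ) : (𝓝[>] x ⊓ ae (volume : Measure ℝ)).NeBot := by
  rw [inf_neBot_iff]
  intro s hs t ht
  obtain ⟨a, ha, has⟩ := (mem_nhdsGT_iff_exists_Ioo_subset' (lt_add_one x)).1 hs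
  by_contra hne
  have hsub : Set.Ioo x a ⊆ tᶜ := fun y hy hyt => hne ⟨y, has hy, hyt⟩
  have h0 : volume (Set.Ioo x a) = 0 := measure_mono_null hsub ht
  rw [Real.volume_Ioo, ENNReal.ofReal_eq_zero] at h0
  exact absurd ha (not_lt.2 (by linarith : a ≤ x))

namespace TwoPhase

noncomputable section

open Classical

variable {M : TwoPhase}

/-! ### Profiles far away from the origin -/

theorem OmegaF.eventually_RLWR {uℓ ur : ℝ × ℝ} (hℓ : uℓ ∈ M.OmegaF) (hr : ur ∈ M.OmegaF) :
    (∀ᶠ ξ in atBot, M.RLWR uℓ ur ξ = uℓ) ∧ ∀ᶠ ξ in atTop, M.RLWR uℓ ur ξ = ur := by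
  constructor
  · filter_upwards [M.isConcaveFlux_fluxF.eventually_lax_eq_left hℓ.1 ur.1] with ξ h
    rw [OmegaF.RLWR_eq hℓ hr, laxF, h, OmegaF.eq_mk hℓ]
  · filter_upwards [IsConcaveFlux.eventually_lax_eq_right (f := M.fluxF) (lam := M.lamF) hr.1 uℓ.1]
      with ξ h
    rw [OmegaF.RLWR_eq hℓ hr, laxF, h, OmegaF.eq_mk hr]

theorem OmegaC.eventually_RARZ {uℓ ur : ℝ × ℝ} (hℓ : uℓ ∈ M.OmegaC) (hr : ur ∈ M.OmegaC) :
    (∀ᶠ ξ in atBot, M.RARZ uℓ ur ξ = uℓ) ∧ ∀ᶠ ξ in atTop, M.RARZ uℓ ur ξ = ur := by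
  constructor
  · filter_upwards [(M.isConcaveFlux_fluxC (M.w₂ uℓ)).eventually_lax_eq_left hℓ.1
      (M.midARZ uℓ ur).1, eventually_lt_atBot ur.2] with ξ h h'
    rw [RARZ, if_pos h', OmegaC.wave₁_eq hℓ (OmegaC.midARZ_mem hℓ hr)
      (OmegaC.w₂_midARZ hℓ hr).symm, laxC, h, OmegaC.w₂_eq hℓ]
    simp
  · filter_upwards [eventually_ge_atTop ur.2] with ξ h
    rw [RARZ, if_neg h.not_gt]

theorem eventually_R {uℓ ur : ℝ × ℝ} (hℓ : uℓ ∈ M.Omega) (hr : ur ∈ M.Omega) :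
    (∀ᶠ ξ in atBot, M.R uℓ ur ξ = uℓ) ∧ ∀ᶠ ξ in atTop, M.R uℓ ur ξ = ur := by
  rcases hℓ with hℓ | hℓ <;> rcases hr with hr | hr
  · simp only [R_free_free hℓ hr]
    exact OmegaF.eventually_RLWR hℓ hr
  · simp only [R_free_cong hℓ hr]
    constructor
    · filter_upwards [eventually_lt_atBot (sigma uℓ (M.midFC uℓ ur))] with ξ h
      rw [if_pos h]
    · filter_upwards [eventually_ge_atTop (sigma uℓ (M.midFC uℓ ur)),
        (OmegaC.eventually_RARZ (OmegaF.midFC_mem hℓ hr) hr).2] with ξ h h'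
      rw [if_neg h.not_gt, h']
  · simp only [R_cong_free hℓ hr]
    constructor
    · filter_upwards [eventually_lt_atBot (sigma (M.midCF₁ uℓ) (M.midCF₂ uℓ)),
        (OmegaC.eventually_RARZ hℓ (OmegaC.midCF₁_mem hℓ)).1] with ξ h h'
      rw [if_pos h, h']
    · filter_upwards [eventually_ge_atTop (sigma (M.midCF₁ uℓ) (M.midCF₂ uℓ)),
        (OmegaF.eventually_RLWR (OmegaC.midCF₂_mem hℓ) hr).2] with ξ h h'
      rw [if_neg h.not_gt, h']
  · simp only [R_cong_cong hℓ hr]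
    exact OmegaC.eventually_RARZ hℓ hr

/-! ### The function space -/

theorem essVariation_comp_le {F : ℝ → ℝ × ℝ} {φ : ℝ → ℝ} (hφ : Monotone φ) :
    essVariation (fun x => F (φ x)) ≤ eVariationOn F Set.univ :=
  iInf_le_of_le _ <| iInf_le_of_le EventuallyEq.rfl
    (eVariationOn.comp_le_of_monotoneOn F φ (hφ.monotoneOn _) (Set.mapsTo_univ _ _))

/-- Monotone reparametrization does not increase variation; applied to `x ↦ x / t`, this makes the
bound uniform in time. -/
theorem ProfileBV.exists_TVLe {F : ℝ → ℝ × ℝ} (h : M.ProfileBV F) :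
    ∃ C, ∀ φ : ℝ → ℝ, Monotone φ → M.TVLe (fun x => F (φ x)) C := by
  refine ⟨max (eVariationOn F Set.univ).toNNReal
    (eVariationOn (fun ξ => (M.w₁ (F ξ), M.w₂ (F ξ))) Set.univ).toNNReal, fun φ hφ => ⟨?_, ?_⟩⟩
  · refine (essVariation_comp_le hφ).trans ?_
    rw [← ENNReal.coe_toNNReal h.1.eVariationOn_ne_top]
    exact ENNReal.coe_le_coe.2 (le_max_left _ _)
  · refine (essVariation_comp_le (F := fun ξ => (M.w₁ (F ξ), M.w₂ (F ξ))) hφ).trans ?_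
    rw [← ENNReal.coe_toNNReal h.2.eVariationOn_ne_top]
    exact ENNReal.coe_le_coe.2 (le_max_right _ _)

theorem profileBV_riemannDatum (uℓ ur : ℝ × ℝ) : M.ProfileBV (riemannDatum uℓ ur) :=
  (ProfileBV.const uℓ).ite (ProfileBV.const ur) 0

theorem riemannDatum_mem {uℓ ur : ℝ × ℝ} (hℓ : uℓ ∈ M.Omega) (hr : ur ∈ M.Omega) (x : ℝ) :
    riemannDatum uℓ ur x ∈ M.Omega := by
  unfold riemannDatum
  split_ifs
  exacts [hℓ, hr]

theorem isBV_riemannDatum {uℓ ur : ℝ × ℝ} (hℓ : uℓ ∈ M.Omega) (hr : ur ∈ M.Omega) :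
    M.IsBV (riemannDatum uℓ ur) := by
  have h := profileBV_riemannDatum (M := M) uℓ ur
  obtain ⟨C, hC⟩ := h.exists_TVLe
  exact ⟨h.1.measurable.aestronglyMeasurable,
    Eventually.of_forall (riemannDatum_mem hℓ hr), C, hC id monotone_id⟩

theorem riemannSolution_of_pos (uℓ ur : ℝ × ℝ) {t : ℝ} (ht : 0 < t) (x : ℝ) :
    M.riemannSolution uℓ ur t x = M.R uℓ ur (x / t) := if_pos ht

theorem riemannSolution_mem {uℓ ur : ℝ × ℝ} (hℓ : uℓ ∈ M.Omega) (hr : ur ∈ M.Omega) (t x : ℝ) :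
    M.riemannSolution uℓ ur t x ∈ M.Omega := by
  unfold riemannSolution
  split_ifs
  · exact R_mem hℓ hr _
  · exact riemannDatum_mem hℓ hr x

theorem measurable_riemannSolution {uℓ ur : ℝ × ℝ} (hℓ : uℓ ∈ M.Omega) (hr : ur ∈ M.Omega) :
    Measurable fun z : ℝ × ℝ => M.riemannSolution uℓ ur z.1 z.2 := by
  unfold riemannSolution
  refine Measurable.ite (measurableSet_lt measurable_const measurable_fst) ?_ ?_
  · exact (measurable_R hℓ hr).comp (measurable_snd.div measurable_fst)
  · exact (profileBV_riemannDatum (M := M) uℓ ur).1.measurable.comp measurable_snd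

/-- As `t → 0`, `x / t` escapes to the region where the profile equals one of the data. At `t₀ > 0`,
the profile is continuous at `x / t₀` for all but countably many `x`. -/
theorem ae_tendsto_riemannSolution {uℓ ur : ℝ × ℝ} (hℓ : uℓ ∈ M.Omega) (hr : ur ∈ M.Omega) {t₀ : ℝ}
    (ht₀ : 0 ≤ t₀) : ∀ᵐ x, Tendsto (fun t => M.riemannSolution uℓ ur t x) (𝓝[Set.Ici 0] t₀)
      (𝓝 (M.riemannSolution uℓ ur t₀ x)) := by
  rcases ht₀.eq_or_lt with rfl | ht₀
  · obtain ⟨h1, h2⟩ := eventually_R hℓ hr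
    filter_upwards [ae_ne_real 0] with x hx
    refine tendsto_const_nhds.congr' ?_
    have hset : Set.Ici (0 : ℝ) = insert 0 (Set.Ioi 0) := Set.Ioi_insert.symm
    rw [hset, nhdsWithin_insert, EventuallyEq, eventually_sup]
    refine ⟨by simp, ?_⟩
    rcases lt_or_gt_of_ne hx with hx | hx
    · have ht : Tendsto (fun t : ℝ => x / t) (𝓝[>] 0) atBot := by
        simp only [div_eq_mul_inv]
        exact tendsto_inv_nhdsGT_zero.const_mul_atTop_of_neg hx
      filter_upwards [ht.eventually h1, self_mem_nhdsWithin] with t h3 h4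
      rw [riemannSolution_of_pos _ _ h4, h3, riemannSolution, if_neg (lt_irrefl _), riemannDatum,
        if_pos hx]
    · have ht : Tendsto (fun t : ℝ => x / t) (𝓝[>] 0) atTop := by
        simp only [div_eq_mul_inv]
        exact tendsto_inv_nhdsGT_zero.const_mul_atTop hx
      filter_upwards [ht.eventually h2, self_mem_nhdsWithin] with t h3 h4
      rw [riemannSolution_of_pos _ _ h4, h3, riemannSolution, if_neg (lt_irrefl _), riemannDatum,
        if_neg hx.not_gt]
  · have hD := (profileBV_R hℓ hr).1.countable_not_continuousAt
    have hinj : Function.Injective fun x : ℝ => x / t₀ :=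
      fun x y h => (div_left_inj' ht₀.ne').1 h
    filter_upwards [(hD.preimage hinj).ae_notMem volume] with x hx
    have hc : ContinuousAt (M.R uℓ ur) (x / t₀) := by
      by_contra h
      exact hx h
    rw [riemannSolution_of_pos _ _ ht₀]
    have hdiv : Tendsto (fun t => x / t) (𝓝 t₀) (𝓝 (x / t₀)) :=
      tendsto_const_nhds.div tendsto_id ht₀.ne'
    refine ((hc.tendsto.comp hdiv).congr' ?_).mono_left nhdsWithin_le_nhds
    filter_upwards [lt_mem_nhds ht₀] with t ht
    exact (riemannSolution_of_pos _ _ ht x).symm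

theorem inSolutionSpace_riemannSolution {uℓ ur : ℝ × ℝ} (hℓ : uℓ ∈ M.Omega) (hr : ur ∈ M.Omega) :
    M.InSolutionSpace (M.riemannSolution uℓ ur) := by
  have hm := measurable_riemannSolution hℓ hr
  have hmt : ∀ t, Measurable (M.riemannSolution uℓ ur t) := fun t =>
    hm.comp measurable_prodMk_left
  refine ⟨hm.aestronglyMeasurable, fun t _ => ⟨(hmt t).aestronglyMeasurable,
    Eventually.of_forall (riemannSolution_mem hℓ hr t)⟩, ?_, fun t₀ ht₀ a b => ?_⟩
  · obtain ⟨C, hC⟩ := (profileBV_R hℓ hr).exists_TVLe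
    refine ⟨C, (ae_restrict_iff' measurableSet_Ioi).2 (Eventually.of_forall fun t ht => ?_)⟩
    have ht : 0 < t := ht
    have := hC (fun x => x / t) fun x y hxy => div_le_div_of_nonneg_right hxy ht.le
    rwa [← funext (riemannSolution_of_pos uℓ ur ht)] at this
  · obtain ⟨C, hC, hb⟩ := exists_edist_bound (M := M)
    refine tendsto_lintegral_Icc_zero hC (Eventually.of_forall fun t => (hmt t).edist (hmt t₀))
      (Eventually.of_forall fun t x => hb _ (riemannSolution_mem hℓ hr t x) _
        (riemannSolution_mem hℓ hr t₀ x)) ?_ a b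
    filter_upwards [ae_tendsto_riemannSolution hℓ hr ht₀] with x hx
    exact tendsto_iff_edist_tendsto_0.1 hx

/-! ### Dissipation along the profiles of LWR and ARZ -/

theorem OmegaF.conservative_RLWR {uℓ ur : ℝ × ℝ} (hℓ : uℓ ∈ M.OmegaF) (hr : ur ∈ M.OmegaF) :
    Dissipative (fun ξ => (M.RLWR uℓ ur ξ).1)
      (fun ξ => (M.RLWR uℓ ur ξ).1 * M.vf (M.RLWR uℓ ur ξ).1) ∧
    Dissipative (fun ξ => -(M.RLWR uℓ ur ξ).1)
      (fun ξ => -((M.RLWR uℓ ur ξ).1 * M.vf (M.RLWR uℓ ur ξ).1)) := by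
  simp only [OmegaF.RLWR_eq hℓ hr]
  exact M.isConcaveFlux_fluxF.dissipative_lax hℓ.1 hr.1

/-- This and `QLWR_eq` write the Kružkov pair as twice the pair of `-min ρ h` plus a conserved pair
and constants. -/
theorem ELWR_eq (h : ℝ) (u : ℝ × ℝ) : ELWR h u = 2 * -min u.1 h + (u.1 + h) := by
  rw [ELWR]
  rcases le_total u.1 h with h1 | h1
  · rw [min_eq_left h1, abs_of_nonpos (sub_nonpos.2 h1)]; ring
  · rw [min_eq_right h1, abs_of_nonneg (sub_nonneg.2 h1)]; ring

theorem QLWR_eq (h : ℝ) (u : ℝ × ℝ) :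
    M.QLWR h u = 2 * -M.fluxF (min u.1 h) + (M.fluxF u.1 + M.fluxF h) := by
  rw [QLWR, fluxF, fluxF, fluxF]
  rcases lt_trichotomy u.1 h with h1 | h1 | h1
  · rw [min_eq_left h1.le, Real.sign_of_neg (sub_neg.2 h1)]; ring
  · rw [h1, min_self]; ring
  · rw [min_eq_right h1.le, Real.sign_of_pos (sub_pos.2 h1)]; ring

theorem OmegaF.dissipative_ELWR {uℓ ur : ℝ × ℝ} (hℓ : uℓ ∈ M.OmegaF) (hr : ur ∈ M.OmegaF) {h : ℝ}
    (hh : h ∈ Set.Icc 0 M.Rf₂) :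
    Dissipative (fun ξ => ELWR h (M.RLWR uℓ ur ξ)) (fun ξ => M.QLWR h (M.RLWR uℓ ur ξ)) := by
  simp only [ELWR_eq, QLWR_eq, OmegaF.RLWR_eq hℓ hr]
  exact ((M.isConcaveFlux_fluxF.dissipative_neg_min_lax hℓ.1 hr.1 hh).const_mul zero_le_two).add
    ((M.isConcaveFlux_fluxF.dissipative_lax hℓ.1 hr.1).1.add (Dissipative.const _ _))

/-- A pair dissipated by the 1-wave and by the contact discontinuity is dissipated by the solution
of ARZ. -/
theorem OmegaC.dissipative_RARZ {uℓ ur : ℝ × ℝ} (hℓ : uℓ ∈ M.OmegaC) (hr : ur ∈ M.OmegaC)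
    {e q : ℝ × ℝ → ℝ}
    (hwave : Dissipative (fun ξ => e (M.wave₁ uℓ (M.midARZ uℓ ur) ξ))
      (fun ξ => q (M.wave₁ uℓ (M.midARZ uℓ ur) ξ)))
    (hcontact : q ur - q (M.midARZ uℓ ur) ≤ ur.2 * (e ur - e (M.midARZ uℓ ur))) :
    Dissipative (fun ξ => e (M.RARZ uℓ ur ξ)) (fun ξ => q (M.RARZ uℓ ur ξ)) := by
  simp only [RARZ, apply_ite e, apply_ite q]
  refine hwave.ite (Dissipative.const _ _) ?_
  rwa [OmegaC.wave₁_of_le hℓ (OmegaC.midARZ_mem hℓ hr) (OmegaC.w₂_midARZ hℓ hr).symm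
    (show (M.midARZ uℓ ur).2 ≤ ur.2 from le_rfl)]

theorem OmegaC.conservative_wave₁ {uℓ um : ℝ × ℝ} (hℓ : uℓ ∈ M.OmegaC) (hm : um ∈ M.OmegaC)
    (hw : M.w₂ uℓ = M.w₂ um) :
    Dissipative (fun ξ => (M.wave₁ uℓ um ξ).1)
      (fun ξ => (M.wave₁ uℓ um ξ).1 * (M.wave₁ uℓ um ξ).2) ∧
    Dissipative (fun ξ => -(M.wave₁ uℓ um ξ).1)
      (fun ξ => -((M.wave₁ uℓ um ξ).1 * (M.wave₁ uℓ um ξ).2)) := by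
  simp only [OmegaC.wave₁_eq hℓ hm hw]
  exact (M.isConcaveFlux_fluxC (M.w₂ uℓ)).dissipative_lax hℓ.1 hm.1

theorem OmegaC.conservative_RARZ_density {uℓ ur : ℝ × ℝ} (hℓ : uℓ ∈ M.OmegaC)
    (hr : ur ∈ M.OmegaC) :
    Dissipative (fun ξ => (M.RARZ uℓ ur ξ).1)
      (fun ξ => (M.RARZ uℓ ur ξ).1 * (M.RARZ uℓ ur ξ).2) ∧
    Dissipative (fun ξ => -(M.RARZ uℓ ur ξ).1)
      (fun ξ => -((M.RARZ uℓ ur ξ).1 * (M.RARZ uℓ ur ξ).2)) := by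
  obtain ⟨h1, h2⟩ := OmegaC.conservative_wave₁ hℓ (OmegaC.midARZ_mem hℓ hr)
    (OmegaC.w₂_midARZ hℓ hr).symm
  have hv : (M.midARZ uℓ ur).2 = ur.2 := rfl
  exact ⟨OmegaC.dissipative_RARZ (e := fun u => u.1) (q := fun u => u.1 * u.2) hℓ hr h1
      (by rw [hv]; linarith),
    OmegaC.dissipative_RARZ (e := fun u => -u.1) (q := fun u => -(u.1 * u.2)) hℓ hr h2
      (by rw [hv]; linarith)⟩

/-- On the 1-wave the second invariant is constant, so momentum is a multiple, possibly negative, of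
the conserved mass pair. At the contact the velocity is common to both sides. -/
theorem OmegaC.conservative_RARZ_momentum {uℓ ur : ℝ × ℝ} (hℓ : uℓ ∈ M.OmegaC)
    (hr : ur ∈ M.OmegaC) :
    Dissipative (fun ξ => (M.RARZ uℓ ur ξ).1 * M.w₂ (M.RARZ uℓ ur ξ))
      (fun ξ => (M.RARZ uℓ ur ξ).1 * M.w₂ (M.RARZ uℓ ur ξ) * (M.RARZ uℓ ur ξ).2) ∧
    Dissipative (fun ξ => -((M.RARZ uℓ ur ξ).1 * M.w₂ (M.RARZ uℓ ur ξ)))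
      (fun ξ => -((M.RARZ uℓ ur ξ).1 * M.w₂ (M.RARZ uℓ ur ξ) * (M.RARZ uℓ ur ξ).2)) := by
  have hmid := OmegaC.midARZ_mem hℓ hr
  have hmidw := (OmegaC.w₂_midARZ hℓ hr).symm
  obtain ⟨h1, h2⟩ := OmegaC.conservative_wave₁ hℓ hmid hmidw
  have hw := fun ξ => (OmegaC.wave₁_mem hℓ hmid hmidw ξ).2
  have hv : (M.midARZ uℓ ur).2 = ur.2 := rfl
  constructor
  · refine OmegaC.dissipative_RARZ (e := fun u => u.1 * M.w₂ u) (q := fun u => u.1 * M.w₂ u * u.2)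
      hℓ hr ?_ (by rw [hv]; linarith)
    have := h1.const_mul' h2 (M.w₂ uℓ)
    refine (congrArg₂ Dissipative ?_ ?_).mp this <;> funext ξ <;> rw [hw] <;> ring
  · refine OmegaC.dissipative_RARZ (e := fun u => -(u.1 * M.w₂ u))
      (q := fun u => -(u.1 * M.w₂ u * u.2)) hℓ hr ?_ (by rw [hv]; linarith)
    have := h1.const_mul' h2 (-M.w₂ uℓ)
    refine (congrArg₂ Dissipative ?_ ?_).mp this <;> funext ξ <;> rw [hw] <;> ring

/-- With `r = pInv (w - k)`, the condition `v ≤ k` reads `r ≤ ρ`, and `fluxC w r = r * k`. On the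
1-wave the pair is thus `1 - min ρ r / r` and `k - fluxC w (min ρ r) / r`; across the contact it is
conserved. -/
theorem OmegaC.dissipative_EARZ {uℓ ur : ℝ × ℝ} (hℓ : uℓ ∈ M.OmegaC) (hr : ur ∈ M.OmegaC) {k : ℝ}
    (hk : k ∈ Set.Icc 0 M.Vc) :
    Dissipative (fun ξ => M.EARZ k (M.RARZ uℓ ur ξ)) (fun ξ => M.QARZ k (M.RARZ uℓ ur ξ)) := by
  have hmid := OmegaC.midARZ_mem hℓ hr
  have hmidw := (OmegaC.w₂_midARZ hℓ hr).symm
  have hwI := OmegaC.w₂_mem hℓ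
  refine OmegaC.dissipative_RARZ (e := M.EARZ k) (q := M.QARZ k) hℓ hr ?_ ?_
  · set w := M.w₂ uℓ with hwdef
    have hrk : M.pInv (w - k) ∈ Set.Icc M.Rf₁ M.Rmax := M.pInv_mem (sub_mem hwI hk)
    have hpk : M.p (M.pInv (w - k)) = w - k := M.p_pInv (sub_mem hwI hk)
    set r := M.pInv (w - k) with hrdef
    have hr0 : 0 < r := M.Rf₁_pos.trans_le hrk.1
    have hfr : M.fluxC w r = r * k := by rw [fluxC, hpk]; ring
    have hd := ((M.isConcaveFlux_fluxC w).dissipative_neg_min_lax hℓ.1 hmid.1 hrk).const_mul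
      (inv_nonneg.2 hr0.le)
    have hd' := hd.add (Dissipative.const 1 k)
    have key : ∀ ξ, M.EARZ k (M.wave₁ uℓ (M.midARZ uℓ ur) ξ) =
        r⁻¹ * -min (M.laxC w uℓ.1 (M.midARZ uℓ ur).1 ξ) r + 1 ∧
        M.QARZ k (M.wave₁ uℓ (M.midARZ uℓ ur) ξ) =
        r⁻¹ * -M.fluxC w (min (M.laxC w uℓ.1 (M.midARZ uℓ ur).1 ξ) r) + k := fun ξ => by
      have hmem : M.laxC w uℓ.1 (M.midARZ uℓ ur).1 ξ ∈ Set.Icc M.Rf₁ M.Rmax :=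
        lax_mem _ _ _ hℓ.1 hmid.1
      rw [EARZ, QARZ, (OmegaC.wave₁_mem hℓ hmid hmidw ξ).2, OmegaC.wave₁_eq hℓ hmid hmidw,
        ← hwdef, ← hrdef]
      set L := M.laxC w uℓ.1 (M.midARZ uℓ ur).1 ξ
      have hiff : w - M.p L ≤ k ↔ r ≤ L := by
        rw [← M.p_le_p hrk.1 hmem.1, hpk]
        constructor <;> intro <;> linarith
      by_cases hrL : r ≤ L
      · rw [if_pos (hiff.2 hrL), if_pos (hiff.2 hrL), min_eq_right hrL, hfr]
        constructor <;> field_simp <;> ring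
      · rw [if_neg (fun h => hrL (hiff.1 h)), if_neg (fun h => hrL (hiff.1 h)),
          min_eq_left (not_le.1 hrL).le, fluxC]
        constructor <;> field_simp <;> ring
    rw [funext fun ξ => (key ξ).1, funext fun ξ => (key ξ).2]
    exact hd'
  · have hv : (M.midARZ uℓ ur).2 = ur.2 := rfl
    rw [EARZ, EARZ, QARZ, QARZ, hv]
    split_ifs
    · simp
    · apply le_of_eq
      ring

/-! ### Localization of the weak formulation -/

/-- Derivatives of the test function vanish where the profile leaves the phase. -/
theorem fderiv_eq_zero_of_notMem {uℓ ur : ℝ × ℝ} {φ : ℝ × ℝ → ℝ} (hφ : IsTest φ)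
    {S : Set (ℝ × ℝ)} (hS : AEOnSupport (M.riemannSolution uℓ ur) φ S) {O : Set ℝ} (hO : IsOpen O)
    (hnot : ∀ ξ ∈ O, M.R uℓ ur ξ ∉ S) {z : ℝ × ℝ} (hz : 0 < z.1) (hzO : z.2 / z.1 ∈ closure O) :
    fderiv ℝ φ z = 0 := by
  have hopen : IsOpen (Set.Ioi (0 : ℝ) ×ˢ (Set.univ : Set ℝ)) := isOpen_Ioi.prod isOpen_univ
  have hq : ContinuousOn (fun z : ℝ × ℝ => z.2 / z.1) (Set.Ioi (0 : ℝ) ×ˢ Set.univ) :=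
    continuousOn_snd.div continuousOn_fst fun z hz => (ne_of_gt hz.1)
  have hU := hq.isOpen_inter_preimage hopen hO
  set U := (Set.Ioi (0 : ℝ) ×ˢ (Set.univ : Set ℝ)) ∩ (fun z : ℝ × ℝ => z.2 / z.1) ⁻¹' O
  have hsupp : IsOpen (Function.support φ) := hφ.1.continuous.isOpen_support
  -- The set is open and contained in the null set where membership in `S` fails on the support, so
  -- it is empty.
  have hempty : U ∩ Function.support φ = ∅ := by
    rw [← (hU.inter hsupp).measure_eq_zero_iff (volume : Measure (ℝ × ℝ))]
    refine measure_mono_null (t := {z : ℝ × ℝ | ¬(z ∈ tsupport φ →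
      M.riemannSolution uℓ ur z.1 z.2 ∈ S)}) (fun z hz h => ?_) (ae_iff.1 hS)
    have h1 := h (subset_tsupport φ hz.2)
    rw [riemannSolution_of_pos _ _ hz.1.1.1] at h1
    exact hnot _ hz.1.2 h1
  have hzero : ∀ z ∈ U, fderiv ℝ φ z = 0 := fun z hz => by
    have : φ =ᶠ[𝓝 z] fun _ => 0 := by
      filter_upwards [hU.mem_nhds hz] with y hy
      by_contra hne
      exact (Set.eq_empty_iff_forall_notMem.1 hempty y) ⟨hy, hne⟩
    rw [this.fderiv_eq]
    simp
  have hcl : IsClosed {z | fderiv ℝ φ z = 0} :=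
    isClosed_eq (hφ.1.continuous_fderiv (by simp)) continuous_const
  have hmem : z ∈ closure U := by
    have hmap : (fun ξ => (z.1, z.1 * ξ)) (z.2 / z.1) = z := by
      ext
      · rfl
      · exact mul_div_cancel₀ _ hz.ne'
    rw [← hmap]
    refine map_mem_closure (f := fun ξ => (z.1, z.1 * ξ)) (by fun_prop) hzO
      fun ξ hξ => ⟨⟨hz, trivial⟩, ?_⟩
    change z.1 * ξ / z.1 ∈ O
    rwa [mul_div_cancel_left₀ _ hz.ne']
  exact hcl.closure_subset_iff.2 hzero hmem

/-- The derivatives of `φ` vanish over `closure O`, so the profile may be altered there at will. The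
closure also covers the ray of the transition itself. -/
theorem setIntegral_congr_profile {uℓ ur : ℝ × ℝ} {φ : ℝ × ℝ → ℝ} (hφ : IsTest φ)
    {S : Set (ℝ × ℝ)} (hS : AEOnSupport (M.riemannSolution uℓ ur) φ S) {O : Set ℝ} (hO : IsOpen O)
    (hnot : ∀ ξ ∈ O, M.R uℓ ur ξ ∉ S) {r : ℝ → ℝ × ℝ}
    (hr : ∀ ξ, M.R uℓ ur ξ = r ξ ∨ ξ ∈ closure O) (e q : ℝ × ℝ → ℝ) :
    ∫ z in halfPlane, (e (M.riemannSolution uℓ ur z.1 z.2) * dt φ z +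
        q (M.riemannSolution uℓ ur z.1 z.2) * dx φ z) =
      ∫ z in halfPlane, (e (r (z.2 / z.1)) * dt φ z + q (r (z.2 / z.1)) * dx φ z) := by
  refine setIntegral_congr_fun (measurableSet_Ioi.prod MeasurableSet.univ) fun z hz => ?_
  have hz0 : 0 < z.1 := hz.1
  rcases hr (z.2 / z.1) with h | h
  · simp only [riemannSolution_of_pos _ _ hz0, h]
  · have := fderiv_eq_zero_of_notMem hφ hS hO hnot hz0 h
    simp [dt, dx, this]

/-- On the free phase the profile is a solution of LWR. -/
theorem exists_free_profile {uℓ ur : ℝ × ℝ} (hℓ : uℓ ∈ M.Omega) (hr : ur ∈ M.Omega) :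
    ∃ a ∈ M.OmegaF, ∃ b ∈ M.OmegaF, ∃ O : Set ℝ, IsOpen O ∧ (∀ ξ ∈ O, M.R uℓ ur ξ ∉ M.OmegaF) ∧
      ∀ ξ, M.R uℓ ur ξ = M.RLWR a b ξ ∨ ξ ∈ closure O := by
  rcases hℓ with hℓ | hℓ <;> rcases hr with hr | hr
  · exact ⟨uℓ, hℓ, ur, hr, ∅, isOpen_empty, by simp, fun ξ => Or.inl (R_free_free hℓ hr ξ)⟩
  · refine ⟨uℓ, hℓ, uℓ, hℓ, Set.Ioi (sigma uℓ (M.midFC uℓ ur)), isOpen_Ioi, fun ξ hξ => ?_,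
      fun ξ => ?_⟩
    · rw [R_free_cong hℓ hr, if_neg (lt_asymm hξ)]
      exact notMem_OmegaF (OmegaC.RARZ_mem (OmegaF.midFC_mem hℓ hr) hr ξ)
    · rw [closure_Ioi, R_free_cong hℓ hr, OmegaF.RLWR_self hℓ]
      rcases lt_or_ge ξ (sigma uℓ (M.midFC uℓ ur)) with h | h
      · exact Or.inl (if_pos h)
      · exact Or.inr h
  · refine ⟨_, OmegaC.midCF₂_mem hℓ, ur, hr, Set.Iio (sigma (M.midCF₁ uℓ) (M.midCF₂ uℓ)),
      isOpen_Iio, fun ξ hξ => ?_, fun ξ => ?_⟩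
    · rw [R_cong_free hℓ hr, if_pos (Set.mem_Iio.1 hξ)]
      exact notMem_OmegaF (OmegaC.RARZ_mem hℓ (OmegaC.midCF₁_mem hℓ) ξ)
    · rw [closure_Iio, R_cong_free hℓ hr]
      rcases lt_or_ge ξ (sigma (M.midCF₁ uℓ) (M.midCF₂ uℓ)) with h | h
      · exact Or.inr h.le
      · exact Or.inl (if_neg h.not_gt)
  -- No free state occurs, so any constant free profile serves, with `O` the whole line.
  · refine ⟨_, M.free_mem M.Rf₁_mem, _, M.free_mem M.Rf₁_mem, Set.univ, isOpen_univ, fun ξ _ => ?_,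
      fun ξ => Or.inr (by simp)⟩
    rw [R_cong_cong hℓ hr]
    exact notMem_OmegaF (OmegaC.RARZ_mem hℓ hr ξ)

/-- On the congested phase the profile is a solution of ARZ. -/
theorem exists_cong_profile {uℓ ur : ℝ × ℝ} (hℓ : uℓ ∈ M.Omega) (hr : ur ∈ M.Omega) :
    ∃ a ∈ M.OmegaC, ∃ b ∈ M.OmegaC, ∃ O : Set ℝ, IsOpen O ∧ (∀ ξ ∈ O, M.R uℓ ur ξ ∉ M.OmegaC) ∧
      ∀ ξ, M.R uℓ ur ξ = M.RARZ a b ξ ∨ ξ ∈ closure O := by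
  rcases hℓ with hℓ | hℓ <;> rcases hr with hr | hr
  · have h := cong_mem (M := M) ⟨le_rfl, M.Wc_lt_Wmax.le⟩ Vc_mem
    refine ⟨_, h, _, h, Set.univ, isOpen_univ, fun ξ _ => ?_, fun ξ => Or.inr (by simp)⟩
    rw [R_free_free hℓ hr]
    exact notMem_OmegaC (OmegaF.RLWR_mem hℓ hr ξ)
  · refine ⟨_, OmegaF.midFC_mem hℓ hr, ur, hr, Set.Iio (sigma uℓ (M.midFC uℓ ur)), isOpen_Iio,
      fun ξ hξ => ?_, fun ξ => ?_⟩
    · rw [R_free_cong hℓ hr, if_pos (Set.mem_Iio.1 hξ)]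
      exact notMem_OmegaC hℓ
    · rw [closure_Iio, R_free_cong hℓ hr]
      rcases lt_or_ge ξ (sigma uℓ (M.midFC uℓ ur)) with h | h
      · exact Or.inr h.le
      · exact Or.inl (if_neg h.not_gt)
  · refine ⟨uℓ, hℓ, _, OmegaC.midCF₁_mem hℓ, Set.Ioi (sigma (M.midCF₁ uℓ) (M.midCF₂ uℓ)),
      isOpen_Ioi, fun ξ hξ => ?_, fun ξ => ?_⟩
    · rw [R_cong_free hℓ hr, if_neg (lt_asymm hξ)]
      exact notMem_OmegaC (OmegaF.RLWR_mem (OmegaC.midCF₂_mem hℓ) hr ξ)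
    · rw [closure_Ioi, R_cong_free hℓ hr]
      rcases lt_or_ge ξ (sigma (M.midCF₁ uℓ) (M.midCF₂ uℓ)) with h | h
      · exact Or.inl (if_pos h)
      · exact Or.inr h
  · exact ⟨uℓ, hℓ, ur, hr, ∅, isOpen_empty, by simp, fun ξ => Or.inl (R_cong_cong hℓ hr ξ)⟩

/-! ### Phase transitions -/

theorem eventually_nhdsLT_div {t : ℝ} (ht : 0 < t) {x : ℝ} {P : ℝ → Prop}
    (h : ∀ᶠ ξ in 𝓝[<] (x / t), P ξ) : ∀ᶠ y in 𝓝[<] x, P (y / t) := by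
  refine Tendsto.eventually (tendsto_nhdsWithin_iff.2 ⟨?_, ?_⟩) h
  · exact ((continuous_id.div_const t).tendsto x).mono_left nhdsWithin_le_nhds
  · filter_upwards [self_mem_nhdsWithin] with y hy
    exact div_lt_div_of_pos_right hy ht

theorem eventually_nhdsGT_div {t : ℝ} (ht : 0 < t) {x : ℝ} {P : ℝ → Prop}
    (h : ∀ᶠ ξ in 𝓝[>] (x / t), P ξ) : ∀ᶠ y in 𝓝[>] x, P (y / t) := by
  refine Tendsto.eventually (tendsto_nhdsWithin_iff.2 ⟨?_, ?_⟩) h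
  · exact ((continuous_id.div_const t).tendsto x).mono_left nhdsWithin_le_nhds
  · filter_upwards [self_mem_nhdsWithin] with y hy
    exact div_lt_div_of_pos_right hy ht

section Transition

variable {uℓ ur um up : ℝ × ℝ} {t x : ℝ}

theorem PhaseTransition.left_mem (h : M.PhaseTransition (M.riemannSolution uℓ ur t) x um up)
    (ht : 0 < t) {S : Set (ℝ × ℝ)} (hS : IsClosed S)
    (hev : ∀ᶠ ξ in 𝓝[<] (x / t), M.R uℓ ur ξ ∈ S) : um ∈ S := by
  have := nhdsLT_inf_ae_neBot x
  refine hS.mem_of_tendsto h.1 (Eventually.filter_mono inf_le_left ?_)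
  filter_upwards [eventually_nhdsLT_div ht hev] with y hy
  rwa [riemannSolution_of_pos _ _ ht]

theorem PhaseTransition.right_mem (h : M.PhaseTransition (M.riemannSolution uℓ ur t) x um up)
    (ht : 0 < t) {S : Set (ℝ × ℝ)} (hS : IsClosed S)
    (hev : ∀ᶠ ξ in 𝓝[>] (x / t), M.R uℓ ur ξ ∈ S) : up ∈ S := by
  have := nhdsGT_inf_ae_neBot x
  refine hS.mem_of_tendsto h.2.1 (Eventually.filter_mono inf_le_left ?_)
  filter_upwards [eventually_nhdsGT_div ht hev] with y hy
  rwa [riemannSolution_of_pos _ _ ht]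

theorem PhaseTransition.not_free (h : M.PhaseTransition (M.riemannSolution uℓ ur t) x um up)
    (ht : 0 < t) (hev : ∀ᶠ ξ in 𝓝 (x / t), M.R uℓ ur ξ ∈ M.OmegaF) : False := by
  have h1 := h.left_mem ht isCompact_OmegaF.isClosed (hev.filter_mono nhdsWithin_le_nhds)
  have h2 := h.right_mem ht isCompact_OmegaF.isClosed (hev.filter_mono nhdsWithin_le_nhds)
  rcases h.2.2 with h3 | h3
  · exact notMem_OmegaC h2 h3.2
  · exact notMem_OmegaC h1 h3.1

theorem PhaseTransition.not_cong (h : M.PhaseTransition (M.riemannSolution uℓ ur t) x um up)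
    (ht : 0 < t) (hev : ∀ᶠ ξ in 𝓝 (x / t), M.R uℓ ur ξ ∈ M.OmegaC) : False := by
  have h1 := h.left_mem ht isCompact_OmegaC.isClosed (hev.filter_mono nhdsWithin_le_nhds)
  have h2 := h.right_mem ht isCompact_OmegaC.isClosed (hev.filter_mono nhdsWithin_le_nhds)
  rcases h.2.2 with h3 | h3
  · exact notMem_OmegaC h3.1 h1
  · exact notMem_OmegaC h3.2 h2

/-- The phase transition of `𝓡[uℓ, ur]` from the free to the congested phase. -/
theorem PhaseTransition.free_cong (h : M.PhaseTransition (M.riemannSolution uℓ ur t) x um up)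
    (ht : 0 < t) (hℓ : uℓ ∈ M.OmegaF) (hr : ur ∈ M.OmegaC) :
    x / t = sigma uℓ (M.midFC uℓ ur) ∧ sigma um up = sigma uℓ (M.midFC uℓ ur) ∧
      (um, up) ∈ M.G₁ ∪ M.G₂ := by
  have hmid := OmegaF.midFC_mem hℓ hr
  have hR := R_free_cong hℓ hr
  have hσ := OmegaF.sigma_midFC_le hℓ hr
  have hx : x / t = sigma uℓ (M.midFC uℓ ur) := by
    rcases lt_trichotomy (x / t) (sigma uℓ (M.midFC uℓ ur)) with hlt | heq | hlt
    · refine (h.not_free ht ?_).elim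
      filter_upwards [gt_mem_nhds hlt] with ξ hξ
      rw [hR, if_pos hξ]
      exact hℓ
    · exact heq
    · refine (h.not_cong ht ?_).elim
      filter_upwards [lt_mem_nhds hlt] with ξ hξ
      rw [hR, if_neg hξ.not_gt]
      exact OmegaC.RARZ_mem hmid hr ξ
  refine ⟨hx, ?_⟩
  obtain rfl : um = uℓ := by
    refine h.left_mem (S := {uℓ}) ht isClosed_singleton ?_
    filter_upwards [self_mem_nhdsWithin] with ξ hξ
    have hξ : ξ < x / t := hξ
    rw [hR, if_pos (hx ▸ hξ)]
    rfl
  -- At vacuum the transition moves at velocity `ur.2` and coincides with the contact: the right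
  -- trace is `ur`, whose second invariant need not be `Wc`. This is why `G₁` leaves it free when
  -- the left density is zero.
  rcases hℓ.1.1.eq_or_lt with h0 | h0
  · have hσ' := sigma_of_eq_zero (u := um) h0.symm (OmegaC.pos hmid).ne'
    obtain rfl : up = ur := by
      refine h.right_mem (S := {ur}) ht isClosed_singleton ?_
      filter_upwards [self_mem_nhdsWithin] with ξ hξ
      have hξ : x / t < ξ := hξ
      rw [hx] at hξ
      rw [hR, if_neg hξ.not_gt, OmegaF.midFC_contact hℓ hr, if_neg]
      · rfl
      · rw [hσ'] at hξ
        exact hξ.not_gt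
    refine ⟨?_, Or.inl ⟨⟨hℓ, ?_⟩, hr, ?_⟩⟩
    · rw [hσ', sigma_of_eq_zero h0.symm (OmegaC.pos hr).ne']
      rfl
    · exact h0 ▸ M.Rf₁_pos
    · change (M.w₂ up - M.Wc) * um.1 = 0
      rw [← h0, mul_zero]
  -- For positive density the transition is strictly slower than the contact, so `midFC` occupies an
  -- interval to its right and is the trace.
  · have hlt : sigma um (M.midFC um ur) < ur.2 :=
      sigma_lt h0 (OmegaF.lt_of_w₂_eq hℓ hmid (OmegaF.w₂_midFC hℓ hr))
        (hr.2.1.2.trans_lt (Vc_lt_of_mem hℓ))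
    obtain rfl : up = M.midFC um ur := by
      refine h.right_mem (S := {M.midFC um ur}) ht isClosed_singleton ?_
      filter_upwards [Ioo_mem_nhdsGT (hx ▸ hlt)] with ξ hξ
      have hξ1 := hξ.1
      rw [hx] at hξ1
      rw [hR, if_neg hξ1.not_gt, OmegaF.midFC_contact hℓ hr, if_pos hξ.2]
      rfl
    refine ⟨rfl, ?_⟩
    rcases lt_or_ge um.1 M.Rf₁ with h1 | h1
    · refine Or.inl ⟨⟨hℓ, h1⟩, hmid, ?_⟩
      change (M.w₂ (M.midFC um ur) - M.Wc) * um.1 = 0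
      rw [OmegaF.w₂_midFC hℓ hr, OmegaF.wBar_of_lt hℓ h1, sub_self, zero_mul]
    · refine Or.inr ⟨⟨hℓ, h1⟩, hmid, ?_⟩
      change M.w₂ um = M.w₂ (M.midFC um ur)
      rw [OmegaF.w₂_midFC hℓ hr, OmegaF.wBar_of_ge hℓ h1]

/-- The phase transition of `𝓡[uℓ, ur]` from the congested to the free phase. -/
theorem PhaseTransition.cong_free (h : M.PhaseTransition (M.riemannSolution uℓ ur t) x um up)
    (ht : 0 < t) (hℓ : uℓ ∈ M.OmegaC) (hr : ur ∈ M.OmegaF) :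
    x / t = sigma (M.midCF₁ uℓ) (M.midCF₂ uℓ) ∧ um = M.midCF₁ uℓ ∧ up = M.midCF₂ uℓ := by
  have hmid := OmegaC.midCF₁_mem hℓ
  have hmidw := (OmegaC.w₂_midCF₁ hℓ).symm
  have hmid₂ := OmegaC.midCF₂_mem hℓ
  have hR := R_cong_free hℓ hr
  have hx : x / t = sigma (M.midCF₁ uℓ) (M.midCF₂ uℓ) := by
    rcases lt_trichotomy (x / t) (sigma (M.midCF₁ uℓ) (M.midCF₂ uℓ)) with hlt | heq | hlt
    · refine (h.not_cong ht ?_).elim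
      filter_upwards [gt_mem_nhds hlt] with ξ hξ
      rw [hR, if_pos hξ]
      exact OmegaC.RARZ_mem hℓ hmid ξ
    · exact heq
    · refine (h.not_free ht ?_).elim
      filter_upwards [lt_mem_nhds hlt] with ξ hξ
      rw [hR, if_neg hξ.not_gt]
      exact OmegaF.RLWR_mem hmid₂ hr ξ
  refine ⟨hx, ?_, ?_⟩
  · refine h.left_mem (S := {M.midCF₁ uℓ}) ht isClosed_singleton ?_
    filter_upwards [Ioo_mem_nhdsLT (hx ▸ OmegaC.lam₁_lt_sigma_midCF hℓ)] with ξ hξ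
    -- Since `Vc` is the largest congested velocity, the 1-wave to `midCF₁` is not a shock; for `ξ`
    -- between its final speed `lam₁` and the transition speed it is completed.
    have hle : (M.midCF₁ uℓ).1 ≤ uℓ.1 := by
      by_contra hlt
      have := (OmegaC.lt_iff hℓ hmid hmidw).1 (not_le.1 hlt)
      exact absurd hℓ.2.1.2 (not_le.2 this)
    rw [hR, if_pos (hx ▸ hξ.2), OmegaC.RARZ_eq_wave₁ hℓ hmid hmidw]
    exact OmegaC.wave₁_eq_right hℓ hmid hmidw (fun h' => absurd hle (not_le.2 h'))
      fun _ => hξ.1.le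
  · refine h.right_mem (S := {M.midCF₂ uℓ}) ht isClosed_singleton ?_
    -- The transition speed is negative and free waves have positive speed, so for negative `ξ`
    -- beyond the transition the profile is still `midCF₂`.
    filter_upwards [Ioo_mem_nhdsGT (hx ▸ OmegaC.sigma_midCF_neg hℓ)] with ξ hξ
    have hξ1 := hξ.1
    rw [hx] at hξ1
    rw [hR, if_neg hξ1.not_gt, OmegaF.RLWR_eq hmid₂ hr, laxF,
      M.isConcaveFlux_fluxF.lax_eq_left hmid₂.1, OmegaF.eq_mk hmid₂]
    · rfl
    · intro hlt
      exact (hξ.2.trans (M.lamF_pos hr.1)).trans_le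
        (M.isConcaveFlux_fluxF.speed_le_chord hmid₂.1 hr.1 hlt)
    · exact fun _ => hξ.2.trans (M.lamF_pos hmid₂.1)

end Transition

theorem G₃_subset_Gw {q : (ℝ × ℝ) × (ℝ × ℝ)} (h : q ∈ M.G₃) : q ∈ M.Gw :=
  Or.inr ⟨h.2.1, h.1, h.2.2.1.symm⟩

/-- All phase transitions of a solution to a Riemann problem lie on one ray. -/
theorem exists_transition_speed {uℓ ur : ℝ × ℝ} (hℓ : uℓ ∈ M.Omega) (hr : ur ∈ M.Omega) :
    ∃ s : ℝ, ∀ t, 0 < t → ∀ x um up, M.PhaseTransition (M.riemannSolution uℓ ur t) x um up →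
      x = s * t ∧ sigma um up = s ∧ (um, up) ∈ M.Gw ∧ (um, up) ∈ M.Ge := by
  rcases hℓ with hℓ | hℓ <;> rcases hr with hr | hr
  · refine ⟨0, fun t ht x um up h => (h.not_free ht (Eventually.of_forall fun ξ => ?_)).elim⟩
    rw [R_free_free hℓ hr]
    exact OmegaF.RLWR_mem hℓ hr ξ
  · refine ⟨sigma uℓ (M.midFC uℓ ur), fun t ht x um up h => ?_⟩
    obtain ⟨h1, h2, h3⟩ := h.free_cong ht hℓ hr
    exact ⟨(div_eq_iff ht.ne').1 h1, h2, Or.inl (Or.inl h3), Or.inl h3⟩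
  · refine ⟨sigma (M.midCF₁ uℓ) (M.midCF₂ uℓ), fun t ht x um up h => ?_⟩
    obtain ⟨h1, rfl, rfl⟩ := h.cong_free ht hℓ hr
    have h3 : (M.midCF₁ uℓ, M.midCF₂ uℓ) ∈ M.G₃ := by
      refine ⟨OmegaC.midCF₁_mem hℓ, ⟨OmegaC.midCF₂_mem hℓ, (M.rhoF_mem (OmegaC.w₂_mem hℓ)).1⟩, ?_,
        rfl⟩
      exact (OmegaC.w₂_midCF₁ hℓ).trans (OmegaC.w₂_midCF₂ hℓ).symm
    exact ⟨(div_eq_iff ht.ne').1 h1, rfl, G₃_subset_Gw h3, Or.inr h3⟩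
  · refine ⟨0, fun t ht x um up h => (h.not_cong ht (Eventually.of_forall fun ξ => ?_)).elim⟩
    rw [R_cong_cong hℓ hr]
    exact OmegaC.RARZ_mem hℓ hr ξ

/-! ### Entropy solutions -/

theorem isWeakSolution_riemannSolution {uℓ ur : ℝ × ℝ} (hℓ : uℓ ∈ M.Omega) (hr : ur ∈ M.Omega) :
    M.IsWeakSolution (riemannDatum uℓ ur) (M.riemannSolution uℓ ur) where
  datum_bv := isBV_riemannDatum hℓ hr
  space := inSolutionSpace_riemannSolution hℓ hr
  initial := Eventually.of_forall fun x => if_neg (lt_irrefl 0)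
  free φ hφ hS := by
    obtain ⟨a, ha, b, hb, O, hO, hnot, heq⟩ := exists_free_profile hℓ hr
    obtain ⟨h1, h2⟩ := OmegaF.conservative_RLWR ha hb
    have := setIntegral_congr_profile hφ hS hO hnot heq (fun u => u.1) fun u => u.1 * M.vf u.1
    rw [h1.integral_eq_zero h2 hφ] at this
    simpa only [WeakLWR, mul_add, mul_assoc] using this
  congested φ hφ hS := by
    obtain ⟨a, ha, b, hb, O, hO, hnot, heq⟩ := exists_cong_profile hℓ hr
    obtain ⟨h1, h2⟩ := OmegaC.conservative_RARZ_density ha hb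
    obtain ⟨h3, h4⟩ := OmegaC.conservative_RARZ_momentum ha hb
    constructor
    · have := setIntegral_congr_profile hφ hS hO hnot heq (fun u => u.1) fun u => u.1 * u.2
      rw [h1.integral_eq_zero h2 hφ] at this
      simpa only [mul_add, mul_assoc] using this
    · have := setIntegral_congr_profile hφ hS hO hnot heq (fun u => u.1 * M.w₂ u)
        fun u => u.1 * M.w₂ u * u.2
      rw [h3.integral_eq_zero h4 hφ] at this
      simpa only [mul_add, mul_assoc] using this
  transitions := by
    obtain ⟨s, hs⟩ := exists_transition_speed hℓ hr
    refine ⟨1, fun _ t => s * t, fun _ => ⟨‖s‖₊, ?_⟩, fun t ht x um up h => ⟨0, ?_⟩,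
      fun _ t ht um up h => ?_⟩
    · exact (LipschitzWith.of_dist_le_mul fun x y => by
        simp [Real.dist_eq, ← mul_sub, abs_mul]).lipschitzOnWith
    · exact (hs t ht x um up h).1
    · obtain ⟨-, h2, h3, -⟩ := hs t ht _ um up h
      rw [h2]
      exact ⟨by simpa using (hasDerivAt_id t).const_mul s, h3⟩

theorem isEntropySolution_riemannSolution {uℓ ur : ℝ × ℝ} (hℓ : uℓ ∈ M.Omega)
    (hr : ur ∈ M.Omega) :
    M.IsEntropySolution (riemannDatum uℓ ur) (M.riemannSolution uℓ ur) where
  weak := isWeakSolution_riemannSolution hℓ hr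
  free φ hφ hnn hS h hh := by
    obtain ⟨a, ha, b, hb, O, hO, hnot, heq⟩ := exists_free_profile hℓ hr
    rw [setIntegral_congr_profile hφ hS hO hnot heq (ELWR h) (M.QLWR h)]
    exact (OmegaF.dissipative_ELWR ha hb hh).integral_nonneg hφ hnn
  congested φ hφ hnn hS k hk := by
    obtain ⟨a, ha, b, hb, O, hO, hnot, heq⟩ := exists_cong_profile hℓ hr
    rw [setIntegral_congr_profile hφ hS hO hnot heq (M.EARZ k) (M.QARZ k)]
    exact (OmegaC.dissipative_EARZ ha hb hk).integral_nonneg hφ hnn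
  transitions := by
    obtain ⟨s, hs⟩ := exists_transition_speed hℓ hr
    exact fun t ht x um up h => (hs t ht x um up h).2.2.2

end

end TwoPhase

theorem mainTheorem2 (M : TwoPhase) :
    -- 𝓡 takes values in the measurable functions with values in Ω
    (∀ uℓ ∈ M.Omega, ∀ ur ∈ M.Omega,
      Measurable (M.R uℓ ur) ∧ ∀ x, M.R uℓ ur x ∈ M.Omega) ∧
    -- consistency
    M.ConsistentI ∧ M.ConsistentII ∧
    -- continuity from Ω × Ω to L¹_loc, in the coordinates (ρ, v)
    (∀ q₀ : M.Omega × M.Omega, ∀ a b : ℝ,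
      Tendsto (fun q : M.Omega × M.Omega =>
        ∫⁻ x in Set.Icc a b, edist (M.R q.1 q.2 x) (M.R q₀.1 q₀.2 x)) (𝓝 q₀) (𝓝 0)) ∧
    -- and in the extended Riemann invariant coordinates, whenever these separate the points of Ω
    (Set.InjOn (fun u => (M.w₁ u, M.w₂ u)) M.Omega →
      ∀ uℓ ∈ M.Omega, ∀ ur ∈ M.Omega, ∀ a b ε : ℝ, 0 < ε → ∃ δ > 0,
        ∀ uℓ' ∈ M.Omega, ∀ ur' ∈ M.Omega, M.wDist uℓ' uℓ < δ → M.wDist ur' ur < δ →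
          ∫⁻ x in Set.Icc a b, ENNReal.ofReal (M.wDist (M.R uℓ' ur' x) (M.R uℓ ur x))
            < ENNReal.ofReal ε) ∧
    -- entropy solutions
    (∀ uℓ ∈ M.Omega, ∀ ur ∈ M.Omega,
      M.IsEntropySolution (TwoPhase.riemannDatum uℓ ur) (M.riemannSolution uℓ ur)) := by
  exact ⟨fun _ hℓ _ hr => ⟨TwoPhase.measurable_R hℓ hr, TwoPhase.R_mem hℓ hr⟩,
    fun _ hℓ _ _ _ hr _ h =>
      ⟨fun x => (TwoPhase.R_split hℓ hr h x).1, fun x => (TwoPhase.R_split hℓ hr h x).2⟩,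
    fun _ hℓ _ hm _ hr _ h1 h2 x => TwoPhase.R_merge hℓ hm hr h1 h2 x,
    TwoPhase.tendsto_lintegral_R,
    fun hinj _ hℓ _ hr a b _ hε => TwoPhase.exists_delta_lintegral_wDist hinj hℓ hr a b hε,
    fun _ hℓ _ hr => TwoPhase.isEntropySolution_riemannSolution hℓ hr⟩
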